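/- Let $\mathbb{T}^2=(\mathbb{R}/2\pi\mathbb{Z})^2$ with normalized Lebesgue measure, let $\Box=\partial_{x_1}^2-\partial_{x_2}^2$, and consider the cubic hyperbolic nonlinear Schrödinger equation $$ i\partial_t u+\Box u+|u|^2u=0 \quad\text{on } \mathbb{T}^2. \tag{HNLS} $$ For $s\in\mathbb{R}$ and $1\le p\le\infty$ let $\mathcal{F}L^{s,p}(\mathbb{T}^2)$ be the space of distributions $f$ on $\mathbb{T}^2$ with $\|f\|_{\mathcal{F}L^{s,p}}=\|\langle n\rangle^s\widehat f(n)\|_{\ell^p(\mathbb{Z}^2)}<\infty$, where $\langle n\rangle=(1+|n|^2)^{1/2}$. Given $T>0$ and $u_0\in\mathcal{F}L^{s,p}(\mathbb{T}^2)$, a function $u\in C([0,T];\mathcal{F}L^{s,p}(\mathbb{T}^2))$ is called a sensible weak solution to (HNLS) on $[0,T]$ with initial datum $u_0$ if there is a distribution $v$ on $(0,T)\times\mathbb{T}^2$ such that, for every sequence $(u_{0,m})_{m\in\mathbb{N}}$ in $C^\infty(\mathbb{T}^2)$ converging to $u_0$ in $\mathcal{F}L^{s,p}(\mathbb{T}^2)$,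 the classical (smooth) solutions $u_m$ to (HNLS) with $u_m|_{t=0}=u_{0,m}$ exist on $[0,T]$ for all sufficiently large $m$, $u_m\to u$ in $C([0,T];\mathcal{F}L^{s,p}(\mathbb{T}^2))$, and $|u_m|^2u_m\to v$ in the sense of distributions on $(0,T)\times\mathbb{T}^2$. **Corollary.** Let $1<p<\infty$ and $s>1-\frac1p$. Then (HNLS) is locally well-posed in $\mathcal{F}L^{s,p}(\mathbb{T}^2)$ in the sense of sensible weak solutions. That is, for every $R\ge 0$ there is $T=T(R)>0$ such that every $u_0$ with $\|u_0\|_{\mathcal{F}L^{s,p}}\le R$ has exactly one sensible weak solution $u\in C([0,T];\mathcal{F}L^{s,p}(\mathbb{T}^2))$ on $[0,T]$, and the solution map $u_0\mapsto u$ is continuous from $\{\|u_0\|_{\mathcal{F}L^{s,p}}\le R\}\subset\mathcal{F}L^{s,p}(\mathbb{T}^2)$ to $C([0,T];\mathcal{F}L^{s,p}(\mathbb{T}^2))$. -/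

import Mathlib

open Filter Topology MeasureTheory Set
open scoped ENNReal NNReal ContDiff

noncomputable section

namespace HNLS

/-! ## Functions and distributions on the torus `𝕋² = (ℝ/2πℤ)²`

A function on `𝕋²` is a function on `ℝ × ℝ` that is `2π`-periodic in each variable. -/

/-- `2π`-periodicity in each of the two variables. -/
def IsPeriodic (f : ℝ × ℝ → ℂ) : Prop :=
  ∀ x : ℝ × ℝ, f (x.1 + 2 * Real.pi, x.2) = f x ∧ f (x.1, x.2 + 2 * Real.pi) = f x

/-- `C^∞(𝕋²)`, the space of smooth complex-valued functions on the torus. -/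
def SmoothTorus : Submodule ℂ (ℝ × ℝ → ℂ) where
  carrier := {f | ContDiff ℝ ∞ f ∧ IsPeriodic f}
  add_mem' := by
    rintro f g ⟨hf, hf'⟩ ⟨hg, hg'⟩
    exact ⟨hf.add hg, fun x => by simp [(hf' x).1, (hf' x).2, (hg' x).1, (hg' x).2]⟩
  zero_mem' := ⟨contDiff_const, fun x => by simp⟩
  smul_mem' := by
    rintro c f ⟨hf, hf'⟩
    exact ⟨contDiff_const.smul hf, fun x => by simp [(hf' x).1, (hf' x).2]⟩

/-- The space `𝒟'(𝕋²)` of distributions on the torus: linear functionals on `C^∞(𝕋²)` that are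
continuous for the `C^∞` topology, i.e. bounded by finitely many of the seminorms
`sup_x ‖D^k φ(x)‖`. -/
def TorusDistribution : Submodule ℂ (Module.Dual ℂ SmoothTorus) where
  carrier := {L | ∃ (C : ℝ) (N : ℕ), ∀ (φ : SmoothTorus) (M : ℝ),
    (∀ k ≤ N, ∀ x, ‖iteratedFDeriv ℝ k (φ : ℝ × ℝ → ℂ) x‖ ≤ M) → ‖L φ‖ ≤ C * M}
  add_mem' := by
    rintro L₁ L₂ ⟨C₁, N₁, h₁⟩ ⟨C₂, N₂, h₂⟩
    refine ⟨C₁ + C₂, max N₁ N₂, fun φ M hM => ?_⟩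
    have e₁ := h₁ φ M fun k hk => hM k (hk.trans (le_max_left _ _))
    have e₂ := h₂ φ M fun k hk => hM k (hk.trans (le_max_right _ _))
    calc ‖(L₁ + L₂) φ‖ ≤ ‖L₁ φ‖ + ‖L₂ φ‖ := norm_add_le _ _
      _ ≤ (C₁ + C₂) * M := by linarith
  zero_mem' := ⟨0, 0, fun φ M _ => by simp⟩
  smul_mem' := by
    rintro c L ⟨C, N, h⟩
    refine ⟨‖c‖ * C, N, fun φ M hM => ?_⟩
    have e := mul_le_mul_of_nonneg_left (h φ M hM) (norm_nonneg c)
    calc ‖(c • L) φ‖ = ‖c‖ * ‖L φ‖ := by simp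
      _ ≤ ‖c‖ * C * M := by linarith

/-- A fundamental domain of the torus. -/
def torusBox : Set (ℝ × ℝ) := Icc 0 (2 * Real.pi) ×ˢ Icc 0 (2 * Real.pi)

/-- Integration over the torus against the normalized Lebesgue measure `(2π)⁻² dx`. -/
def torusIntegral (f : ℝ × ℝ → ℂ) : ℂ :=
  (((2 * Real.pi) ^ 2)⁻¹ : ℝ) • ∫ x in torusBox, f x

theorem integrableOn_torusBox {f : ℝ × ℝ → ℂ} (hf : Continuous f) :
    IntegrableOn f torusBox :=
  hf.continuousOn.integrableOn_compact (isCompact_Icc.prod isCompact_Icc)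

/-- A smooth function `f` regarded as the distribution `φ ↦ ∫_{𝕋²} f φ`. -/
def toDistribution (f : SmoothTorus) : TorusDistribution :=
  ⟨{  toFun := fun φ => torusIntegral fun x => f.1 x * φ.1 x
      map_add' := by
        intro φ ψ
        have h₁ : IntegrableOn (fun x => f.1 x * φ.1 x) torusBox :=
          integrableOn_torusBox (f.2.1.continuous.mul φ.2.1.continuous)
        have h₂ : IntegrableOn (fun x => f.1 x * ψ.1 x) torusBox :=
          integrableOn_torusBox (f.2.1.continuous.mul ψ.2.1.continuous)
        simp only [torusIntegral, ← smul_add]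
        rw [← integral_add h₁ h₂]
        simp [mul_add]
      map_smul' := by
        intro c φ
        simp only [torusIntegral, RingHom.id_apply]
        rw [smul_comm c, ← integral_smul c]
        congr 2
        funext x
        simp [mul_left_comm] },
    by
      obtain ⟨B, hB⟩ := (isCompact_Icc.prod isCompact_Icc :
        IsCompact torusBox).exists_bound_of_continuousOn f.2.1.continuous.continuousOn
      refine ⟨‖(((2 * Real.pi) ^ 2)⁻¹ : ℝ)‖ * (B * volume.real torusBox), 0, fun φ M hM => ?_⟩
      have hM' : ∀ x, ‖φ.1 x‖ ≤ M := fun x => by simpa using hM 0 le_rfl x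
      have key := norm_setIntegral_le_of_norm_le_const (μ := volume) (s := torusBox)
        (f := fun x => f.1 x * φ.1 x) (C := B * M)
        (isCompact_Icc.prod isCompact_Icc : IsCompact torusBox).measure_lt_top
        (fun x hx => by
          rw [norm_mul]
          exact mul_le_mul (hB x hx) (hM' x) (norm_nonneg _) ((norm_nonneg _).trans (hB x hx)))
      calc ‖torusIntegral fun x => f.1 x * φ.1 x‖
          = ‖(((2 * Real.pi) ^ 2)⁻¹ : ℝ)‖ * ‖∫ x in torusBox, f.1 x * φ.1 x‖ := norm_smul _ _
        _ ≤ ‖(((2 * Real.pi) ^ 2)⁻¹ : ℝ)‖ * (B * M * volume.real torusBox) :=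
            mul_le_mul_of_nonneg_left key (norm_nonneg _)
        _ = ‖(((2 * Real.pi) ^ 2)⁻¹ : ℝ)‖ * (B * volume.real torusBox) * M := by ring⟩

/-! ## Fourier–Lebesgue spaces -/

/-- The exponential `x ↦ e^{i n · x}`, `n ∈ ℤ²`. -/
def expMode (n : ℤ × ℤ) : SmoothTorus :=
  ⟨fun x => Complex.exp (Complex.I * ((n.1 * x.1 + n.2 * x.2 : ℝ) : ℂ)), by
    constructor
    · have h : ContDiff ℝ ∞ fun x : ℝ × ℝ => ((n.1 * x.1 + n.2 * x.2 : ℝ) : ℂ) :=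
        Complex.ofRealCLM.contDiff.comp
          ((contDiff_const.mul contDiff_fst).add (contDiff_const.mul contDiff_snd))
      exact (contDiff_const.mul h).cexp
    · intro x
      constructor
      · rw [Complex.exp_eq_exp_iff_exists_int]
        exact ⟨n.1, by push_cast; ring⟩
      · rw [Complex.exp_eq_exp_iff_exists_int]
        exact ⟨n.2, by push_cast; ring⟩⟩

/-- The Fourier coefficient `f̂(n) = ⟨f, e^{-i n · x}⟩` of a distribution on the torus. -/
def fourierCoeff (f : TorusDistribution) (n : ℤ × ℤ) : ℂ := f.1 (expMode (-n))

/-- The Japanese bracket `⟨n⟩ = (1 + |n|²)^{1/2}`. -/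
def japaneseBracket (n : ℤ × ℤ) : ℝ := Real.sqrt (1 + ((n.1 : ℝ) ^ 2 + (n.2 : ℝ) ^ 2))

/-- The sequence `⟨n⟩^s f̂(n)`. -/
def weightedCoeff (s : ℝ) (f : TorusDistribution) (n : ℤ × ℤ) : ℂ :=
  ((japaneseBracket n ^ s : ℝ) : ℂ) * fourierCoeff f n

/-- The Fourier–Lebesgue norm `‖⟨n⟩^s f̂(n)‖_{ℓ^p(ℤ²)}`, with the value `∞` allowed. -/
def flNorm (s : ℝ) (p : ℝ≥0∞) (f : TorusDistribution) : ℝ≥0∞ :=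
  eLpNorm (weightedCoeff s f) p Measure.count

theorem weightedCoeff_add (s : ℝ) (f g : TorusDistribution) :
    weightedCoeff s (f + g) = weightedCoeff s f + weightedCoeff s g := by
  ext n
  simp [weightedCoeff, fourierCoeff, mul_add]

theorem weightedCoeff_smul (s : ℝ) (c : ℂ) (f : TorusDistribution) :
    weightedCoeff s (c • f) = c • weightedCoeff s f := by
  ext n
  simp [weightedCoeff, fourierCoeff, mul_left_comm]

/-- The Fourier–Lebesgue space `ℱL^{s,p}(𝕋²)`: the distributions of finite norm. -/
def FL (s : ℝ) (p : ℝ≥0∞) : Submodule ℂ TorusDistribution where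
  carrier := {f | flNorm s p f < ⊤}
  add_mem' := by
    intro f g hf hg
    simp only [mem_ofPred_eq, flNorm, weightedCoeff_add] at *
    exact eLpNorm_add_lt_top ⟨.of_discrete, hf⟩ ⟨.of_discrete, hg⟩
  zero_mem' := by
    have h : weightedCoeff s 0 = 0 := by ext n; simp [weightedCoeff, fourierCoeff]
    simp [flNorm, h]
  smul_mem' := by
    intro c f hf
    simp only [mem_ofPred_eq, flNorm, weightedCoeff_smul] at *
    exact (MemLp.const_smul (⟨.of_discrete, hf⟩ : MemLp _ p Measure.count) c).2

/-- `ℱL^{s,p}(𝕋²)` carries the distance `‖f - g‖_{ℱL^{s,p}}` and the topology it induces. -/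
instance instPseudoEMetricSpaceFL (s : ℝ) (p : ℝ≥0∞) [Fact (1 ≤ p)] :
    PseudoEMetricSpace (FL s p) where
  edist f g := flNorm s p (f.1 - g.1)
  edist_self f := by
    have h : weightedCoeff s 0 = 0 := by ext n; simp [weightedCoeff, fourierCoeff]
    simp [flNorm, h]
  edist_comm f g := by
    have h : weightedCoeff s (f.1 - g.1) = -weightedCoeff s (g.1 - f.1) := by
      ext n
      simp [weightedCoeff, fourierCoeff, mul_sub]
    simp only [flNorm, h, eLpNorm_neg]
  edist_triangle f g k := by
    have h : weightedCoeff s (f.1 - k.1)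
        = weightedCoeff s (f.1 - g.1) + weightedCoeff s (g.1 - k.1) := by
      rw [← weightedCoeff_add, sub_add_sub_cancel]
    simp only [flNorm, h]
    exact eLpNorm_add_le .of_discrete .of_discrete Fact.out

/-! ## The equation and its classical solutions -/

/-- The hyperbolic Laplacian `□ = ∂²_{x₁} - ∂²_{x₂}`. -/
def box (f : ℝ × ℝ → ℂ) (x : ℝ × ℝ) : ℂ :=
  iteratedDeriv 2 (fun y => f (y, x.2)) x.1 - iteratedDeriv 2 (fun y => f (x.1, y)) x.2

/-- The cubic nonlinearity `|u|² u`. -/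
def cubic (z : ℂ) : ℂ := (‖z‖ : ℂ) ^ 2 * z

/-- `w ∈ C^∞([0,T] × 𝕋²)` solves `i ∂ₜ w + □ w + |w|² w = 0` on `[0,T] × 𝕋²`, the time derivative
being one-sided at the end points. The values `w t` for `t ∉ [0,T]` play no role. -/
def IsClassicalSolution (T : ℝ) (w : ℝ → SmoothTorus) : Prop :=
  ContDiffOn ℝ ∞ (fun q : ℝ × (ℝ × ℝ) => (w q.1).1 q.2) (Icc 0 T ×ˢ univ) ∧
  ∀ t ∈ Icc 0 T, ∀ x : ℝ × ℝ,
    Complex.I * derivWithin (fun τ => (w τ).1 x) (Icc 0 T) t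
      + box (w t).1 x + cubic ((w t).1 x) = 0

/-! ## Space-time distributions -/

/-- `φ` vanishes for times outside `[a,b]`. -/
def SupportedIn (a b : ℝ) (φ : ℝ × (ℝ × ℝ) → ℂ) : Prop :=
  ∀ t, t ∉ Icc a b → ∀ x, φ (t, x) = 0

/-- The space-time test functions `C_c^∞((0,T) × 𝕋²)`. -/
def SpaceTimeTest (T : ℝ) : Submodule ℂ (ℝ × (ℝ × ℝ) → ℂ) where
  carrier := {φ | ContDiff ℝ ∞ φ ∧ (∀ t, IsPeriodic fun x => φ (t, x)) ∧
    ∃ a b, 0 < a ∧ b < T ∧ SupportedIn a b φ}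
  add_mem' := by
    rintro f g ⟨hf, hf', a, b, ha, hb, hab⟩ ⟨hg, hg', c, d, hc, hd, hcd⟩
    refine ⟨hf.add hg, fun t x => ?_, min a c, max b d, lt_min ha hc, max_lt hb hd,
      fun t ht x => ?_⟩
    · have h₁ := hf' t x
      have h₂ := hg' t x
      simp only at h₁ h₂
      simp [h₁.1, h₁.2, h₂.1, h₂.2]
    · have h₁ := hab t (fun h => ht ⟨(min_le_left _ _).trans h.1, h.2.trans (le_max_left _ _)⟩) x
      have h₂ := hcd t (fun h => ht ⟨(min_le_right _ _).trans h.1, h.2.trans (le_max_right _ _)⟩) x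
      simp [h₁, h₂]
  zero_mem' := ⟨contDiff_const, fun t x => by simp, 1, T - 1, one_pos, by linarith,
    fun t _ x => by simp⟩
  smul_mem' := by
    rintro c f ⟨hf, hf', a, b, ha, hb, hab⟩
    refine ⟨contDiff_const.smul hf, fun t x => ?_, a, b, ha, hb, fun t ht x => ?_⟩
    · have h₁ := hf' t x
      simp only at h₁
      simp [h₁.1, h₁.2]
    · simp [hab t ht x]

/-- The space `𝒟'((0,T) × 𝕋²)` of space-time distributions: linear functionals on the test functions
whose restriction to the test functions supported in `[a,b] × 𝕋²` is continuous for the `C^∞`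
topology, for all `0 < a`, `b < T`. -/
structure SpaceTimeDistribution (T : ℝ) where
  toLinearMap : SpaceTimeTest T →ₗ[ℂ] ℂ
  continuous' : ∀ a b : ℝ, 0 < a → b < T → ∃ (C : ℝ) (N : ℕ), ∀ φ : SpaceTimeTest T,
    SupportedIn a b φ → ∀ M : ℝ,
      (∀ k ≤ N, ∀ q, ‖iteratedFDeriv ℝ k (φ : ℝ × (ℝ × ℝ) → ℂ) q‖ ≤ M) →
        ‖toLinearMap φ‖ ≤ C * M

/-- The pairing `∫₀ᵀ ∫_{𝕋²} |w|² w φ dx dt` of the nonlinearity with a test function. -/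
def nonlinearityPairing (T : ℝ) (w : ℝ → SmoothTorus) (φ : SpaceTimeTest T) : ℂ :=
  ∫ t in Icc 0 T, torusIntegral fun x => cubic ((w t).1 x) * φ.1 (t, x)

/-! ## Sensible weak solutions -/

/-- `u ∈ C([0,T]; ℱL^{s,p}(𝕋²))` is a sensible weak solution with initial datum `u₀`: there is a
space-time distribution `v` such that for every sequence `a` of smooth functions converging to `u₀`
in `ℱL^{s,p}(𝕋²)`, the classical solutions with data `a m` exist on `[0,T]` for all large `m`, they
converge to `u` in `C([0,T]; ℱL^{s,p}(𝕋²))`, and their nonlinearities converge to `v` in the sense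
of distributions. -/
def IsSensibleWeakSolution (s : ℝ) (p : ℝ≥0∞) [Fact (1 ≤ p)] (T : ℝ)
    (u₀ : FL s p) (u : C(Icc (0 : ℝ) T, FL s p)) : Prop :=
  ∃ v : SpaceTimeDistribution T, ∀ a : ℕ → SmoothTorus,
    Tendsto (fun m => flNorm s p (toDistribution (a m) - u₀)) atTop (𝓝 0) →
      (∀ᶠ m in atTop, ∃ w : ℝ → SmoothTorus, IsClassicalSolution T w ∧ w 0 = a m) ∧
      ∀ w : ℕ → ℝ → SmoothTorus,
        (∀ᶠ m in atTop, IsClassicalSolution T (w m) ∧ w m 0 = a m) →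
          Tendsto (fun m => ⨆ t : Icc (0 : ℝ) T, flNorm s p (toDistribution (w m t) - u t))
            atTop (𝓝 0) ∧
          ∀ φ : SpaceTimeTest T,
            Tendsto (fun m => nonlinearityPairing T (w m) φ) atTop (𝓝 (v.toLinearMap φ))

end HNLS

end

open Filter Topology MeasureTheory Set
open scoped ENNReal NNReal ContDiff

noncomputable section

namespace HNLS

/-! ## Divisor bound and lattice points on hyperbolas -/

/-! Write û(t,n) = e^{-i(n₁²-n₂²)t} a(t,n). Then ∂ₜa(n) = i Σ e^{2i·hyp(m,k)t} a(n-m) ā(n-m-k)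
a(n-k), summed over m, k ∈ ℤ², where hyp(m,k) = m₁k₁ - m₂k₂. Time is slowed down by a large integer
M, a is expanded in temporal frequencies λ_l = l + 1/2, and the integral equation is solved for the
coefficients A(n,l) by contraction in the norm ‖⟨n⟩^s λ_l A(n,l)‖_{ℓ^p}. If Q is the exponent
conjugate to p, then 1/λ ∈ ℓ^Q, so this norm controls the solution in C([0,T]; ℱL^{s,p})
(`exists_lpn_amp_le`).

The trilinear estimate (`lpn_triMaj_le`) is Hölder's inequality for the pair p, Q. It reduces
everything to one arithmetic statement (`exists_tsum_level_set_le`): for σ = sQ > 1, the product of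
the three weights (1+|·|)^{-σ}, summed over a single level set hyp(m,k) = μ, is at most
C(1+|n|)^{-σ}, uniformly in μ. The hypothesis s > 1 - 1/p says precisely that sQ > 1. The largest of
the three frequencies is at least |n|/3 and supplies the factor (1+|n|)^{-σ}; two weights remain to
be summed. If the conjugated frequency n-m-k is the smallest, then for each value of it another
frequency runs over a hyperbola, and lattice points on a hyperbola are few in every box
(`exists_card_hyperbola_le`). Otherwise one frequency is fixed and another runs over a line, whose
lattice points are spaced by a primitive vector (`exists_tsum_tsum_line_le`).

At time scale 1/M about M level sets contribute near a given temporal frequency. This costs M^{1/Q},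
while the time integral gains 1/M; the net factor M^{-1/p} makes the map a contraction for large M
(`exists_smallCubic`), and T = 1/M depends only on the size of the data.

The solutions are then shown to be sensible. The estimates also hold with an extra weight
(1+δ|n|)^k, with the same M, and for smooth data a small δ keeps the weighted norm small; hence
smooth data have smooth solutions on all of [0,T] (`isClassicalSolution_solution`). Classical
solutions are unique by an L² energy estimate, so they agree with the fixed point, which is
Lipschitz in the data; this gives convergence for every approximating sequence. Moving the linear
operator onto the test function turns the pairing of |w|²w into an expression linear in w
(`nonlinearityPairing_eq`), so the nonlinearities converge as well. Uniqueness is automatic: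
truncated Fourier series approximate any datum and determine the limit. -/

theorem exists_card_divisors_le {ε : ℝ} (hε : 0 < ε) :
    ∃ C : ℝ, 0 < C ∧ ∀ n : ℕ, n ≠ 0 → (n.divisors.card : ℝ) ≤ C * (n : ℝ) ^ ε := by
  -- The bound is checked one prime power at a time. Primes p ≥ P satisfy p^ε ≥ 2, hence a + 1 ≤ 2^a
  -- ≤ p^{aε}; each of the at most P smaller primes costs a factor K.
  obtain ⟨P, hP⟩ := exists_nat_ge ((2 : ℝ) ^ (1 / ε))
  set K : ℝ := max 1 (1 / (ε * Real.log 2)) with hK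
  have hl : 0 < ε * Real.log 2 := mul_pos hε (Real.log_pos (by norm_num))
  have hK1 : 1 ≤ K := le_max_left _ _
  have key : ∀ (p a : ℕ), p.Prime →
      ((a : ℝ) + 1) ≤ (if p < P then K else 1) * ((p : ℝ) ^ a) ^ ε := by
    intro p a hp
    have hp2 : (2 : ℝ) ≤ p := by exact_mod_cast hp.two_le
    have e1 : ((p : ℝ) ^ a) ^ ε = (p : ℝ) ^ (ε * a) := by
      rw [← Real.rpow_natCast, ← Real.rpow_mul (by linarith), mul_comm]
    rw [e1]
    split_ifs with h
    · have h2 : (2 : ℝ) ^ (ε * a) ≤ (p : ℝ) ^ (ε * a) :=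
        Real.rpow_le_rpow (by norm_num) hp2 (by positivity)
      have h3 : 1 + ε * Real.log 2 * a ≤ (2 : ℝ) ^ (ε * a) := by
        rw [Real.rpow_def_of_pos (by norm_num)]
        have := Real.add_one_le_exp (Real.log 2 * (ε * a))
        linarith
      have h4 : 1 ≤ K * (ε * Real.log 2) := by
        have : 1 / (ε * Real.log 2) ≤ K := le_max_right _ _
        rwa [div_le_iff₀ hl] at this
      have ha : (0 : ℝ) ≤ a := Nat.cast_nonneg a
      nlinarith [mul_le_mul_of_nonneg_right h4 ha,
        mul_le_mul_of_nonneg_left (h3.trans h2) (zero_le_one.trans hK1)]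
    · push Not at h
      have h2 : (2 : ℝ) ≤ (p : ℝ) ^ ε := by
        have : ((2 : ℝ) ^ (1 / ε)) ^ ε ≤ (p : ℝ) ^ ε :=
          Real.rpow_le_rpow (by positivity) (hP.trans (by exact_mod_cast h)) hε.le
        rwa [← Real.rpow_mul (by norm_num), one_div_mul_cancel hε.ne', Real.rpow_one] at this
      rw [one_mul, Real.rpow_mul (by linarith), Real.rpow_natCast]
      have h3 : (a : ℝ) + 1 ≤ 2 ^ a := by exact_mod_cast Nat.lt_two_pow_self
      exact h3.trans (pow_le_pow_left₀ (by norm_num) h2 a)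
  refine ⟨K ^ P, by positivity, fun n hn => ?_⟩
  rw [Nat.card_divisors hn]
  push_cast
  calc ∏ p ∈ n.primeFactors, ((n.factorization p : ℝ) + 1)
      ≤ ∏ p ∈ n.primeFactors,
          (if p < P then K else 1) * ((p : ℝ) ^ n.factorization p) ^ ε :=
        Finset.prod_le_prod (fun _ _ => by positivity)
          fun p hp => key p _ (Nat.prime_of_mem_primeFactors hp)
    _ = (∏ p ∈ n.primeFactors, if p < P then K else 1) * (n : ℝ) ^ ε := by
        rw [Finset.prod_mul_distrib, Real.finsetProd_rpow _ _ (fun _ _ => by positivity)]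
        congr 2
        exact_mod_cast Nat.prod_factorization_pow_eq_self hn
    _ ≤ K ^ P * (n : ℝ) ^ ε := by
        refine mul_le_mul_of_nonneg_right ?_ (by positivity)
        rw [← Finset.prod_filter, Finset.prod_const]
        refine pow_le_pow_right₀ hK1 ?_
        calc _ ≤ (Finset.range P).card := Finset.card_le_card fun x hx => by
              simpa using (Finset.mem_filter.1 hx).2
          _ = P := Finset.card_range P

/-- Three points of the hyperbola uv = K span a triangle whose doubled area D is a nonzero integer.
Clearing denominators, x₁y₁z₁D equals K times the Vandermonde product of the first coordinates,
which is at most (2N)³. Each first coordinate is at least |K|^{1/2}, so |K|^{3/2} ≤ 8N³|K|,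
contradicting |K| > 64N⁶. -/
theorem card_hyperbola_le_two {K a : ℤ} {N : ℝ} (hN : 1 ≤ N) (hK : 64 * N ^ 6 < |(K : ℝ)|)
    (S : Finset (ℤ × ℤ)) (hS : ∀ z ∈ S, z.1 * z.2 = K ∧ |(z.1 : ℝ) - a| ≤ N)
    (hS' : ∀ z ∈ S, |K| ≤ z.1 ^ 2) : S.card ≤ 2 := by
  by_contra! h
  have hK0 : K ≠ 0 := by
    rintro rfl
    simp at hK
    nlinarith [pow_pos (zero_lt_one.trans_le hN) 6]
  obtain ⟨x, hx, y, hy, z, hz, hxy, hxz, hyz⟩ := Finset.two_lt_card.1 h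
  have inj : ∀ u ∈ S, ∀ v ∈ S, u ≠ v → u.1 ≠ v.1 := by
    intro u hu v hv huv h1
    have h2 := (hS u hu).1
    rw [h1, ← (hS v hv).1] at h2
    have h3 : v.1 ≠ 0 := by
      intro h0
      have := (hS v hv).1
      rw [h0, zero_mul] at this
      exact hK0 this.symm
    exact huv (Prod.ext h1 (mul_left_cancel₀ h3 h2))
  have nz : ∀ u ∈ S, u.1 ≠ 0 := by
    intro v hv h0
    have := (hS v hv).1
    rw [h0, zero_mul] at this
    exact hK0 this.symm
  set D : ℤ := (y.1 - x.1) * (z.2 - x.2) - (z.1 - x.1) * (y.2 - x.2) with hD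
  have eD : x.1 * y.1 * z.1 * D = K * ((y.1 - x.1) * (z.1 - x.1) * (z.1 - y.1)) := by
    have e1 := (hS x hx).1
    have e2 := (hS y hy).1
    have e3 := (hS z hz).1
    have : x.1 * y.1 * z.1 * D = x.1 * y.1 * (y.1 - x.1) * (z.1 * z.2)
      - y.1 * z.1 * (y.1 - x.1) * (x.1 * x.2) - x.1 * z.1 * (z.1 - x.1) * (y.1 * y.2)
      + y.1 * z.1 * (z.1 - x.1) * (x.1 * x.2) := by rw [hD]; ring
    rw [this, e1, e2, e3]; ring
  have hD0 : D ≠ 0 := by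
    intro h0
    rw [h0, mul_zero] at eD
    have : (y.1 - x.1) * (z.1 - x.1) * (z.1 - y.1) ≠ 0 :=
      mul_ne_zero (mul_ne_zero (sub_ne_zero.2 (inj y hy x hx hxy.symm))
        (sub_ne_zero.2 (inj z hz x hx hxz.symm))) (sub_ne_zero.2 (inj z hz y hy hyz.symm))
    exact mul_ne_zero hK0 this eD.symm
  have hD1 : 1 ≤ |(D : ℝ)| := by exact_mod_cast Int.one_le_abs hD0
  have dist : ∀ u ∈ S, ∀ v ∈ S, |(u.1 : ℝ) - v.1| ≤ 2 * N := by
    intro u hu v hv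
    have h1 := (hS u hu).2
    have h2 := (hS v hv).2
    rw [abs_le] at *
    constructor <;> linarith
  have b : |(x.1 : ℝ)| * |(y.1 : ℝ)| * |(z.1 : ℝ)| ≤ |(K : ℝ)| * (8 * N ^ 3) := by
    calc |(x.1 : ℝ)| * |(y.1 : ℝ)| * |(z.1 : ℝ)|
        ≤ |(x.1 : ℝ)| * |(y.1 : ℝ)| * |(z.1 : ℝ)| * |(D : ℝ)| :=
          le_mul_of_one_le_right (by positivity) hD1
      _ = |(K : ℝ)| * (|(y.1 : ℝ) - x.1| * |(z.1 : ℝ) - x.1| * |(z.1 : ℝ) - y.1|) := by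
          rw [← abs_mul, ← abs_mul, ← abs_mul, ← abs_mul, ← abs_mul, ← abs_mul]
          congr 1
          exact_mod_cast eD
      _ ≤ |(K : ℝ)| * (2 * N * (2 * N) * (2 * N)) := by
          gcongr
          · exact dist y hy x hx
          · exact dist z hz x hx
          · exact dist z hz y hy
      _ = _ := by ring
  have sq : ∀ u ∈ S, |(K : ℝ)| ≤ |(u.1 : ℝ)| ^ 2 := by
    intro u hu
    rw [sq_abs]
    exact_mod_cast hS' u hu
  have hKpos : 0 < |(K : ℝ)| := abs_pos.2 (by exact_mod_cast hK0)
  have c1 : |(K : ℝ)| * |(K : ℝ)| * |(K : ℝ)| ≤ (|(K : ℝ)| * (8 * N ^ 3)) ^ 2 := by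
    calc |(K : ℝ)| * |(K : ℝ)| * |(K : ℝ)|
        ≤ |(x.1 : ℝ)| ^ 2 * |(y.1 : ℝ)| ^ 2 * |(z.1 : ℝ)| ^ 2 := by
          gcongr
          exacts [sq x hx, sq y hy, sq z hz]
      _ = (|(x.1 : ℝ)| * |(y.1 : ℝ)| * |(z.1 : ℝ)|) ^ 2 := by ring
      _ ≤ _ := by gcongr
  have c2 : |(K : ℝ)| ^ 2 * |(K : ℝ)| ≤ |(K : ℝ)| ^ 2 * (64 * N ^ 6) := by
    calc _ = |(K : ℝ)| * |(K : ℝ)| * |(K : ℝ)| := by ring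
      _ ≤ _ := c1
      _ = _ := by ring
  have := le_of_mul_le_mul_left c2 (by positivity)
  linarith

/-- The bound must be uniform in K and in the position of the box. If |K| ≤ 64N⁶, the divisor bound
with exponent ε/6 gives a power N^ε. If |K| is larger, every point has a coordinate of size at least
|K|^{1/2}, and each of the two coordinates accounts for at most two points. -/
theorem exists_card_hyperbola_le {ε : ℝ} (hε : 0 < ε) :
    ∃ C : ℝ, 0 < C ∧ ∀ (K a b : ℤ) (N : ℝ), K ≠ 0 → 1 ≤ N → ∀ S : Finset (ℤ × ℤ),
      (∀ z ∈ S, z.1 * z.2 = K ∧ |(z.1 : ℝ) - a| ≤ N ∧ |(z.2 : ℝ) - b| ≤ N) →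
        (S.card : ℝ) ≤ C * N ^ ε := by
  obtain ⟨C, hC, hd⟩ := exists_card_divisors_le (ε := ε / 6) (by positivity)
  refine ⟨2 * C * 64 ^ (ε / 6) + 4, by positivity, fun K a b N hK hN S hS => ?_⟩
  have hNε : 1 ≤ N ^ ε := Real.one_le_rpow hN hε.le
  have nz : ∀ u ∈ S, u.1 ≠ 0 := by
    intro v hv h0
    have := (hS v hv).1
    rw [h0, zero_mul] at this
    exact hK this.symm
  rcases le_or_gt |(K : ℝ)| (64 * N ^ 6) with h | h
  · have hcard : S.card ≤ 2 * K.natAbs.divisors.card := by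
      have : S.card ≤ (K.natAbs.divisors ×ˢ (Finset.univ : Finset Bool)).card := by
        refine Finset.card_le_card_of_injOn (fun z => (z.1.natAbs, decide (0 ≤ z.1))) ?_ ?_
        · intro z hz
          simp only [Finset.coe_product, Set.mem_prod, Finset.mem_coe, Nat.mem_divisors,
            Finset.mem_univ, and_true]
          refine ⟨?_, by simpa using hK⟩
          rw [Int.natAbs_dvd_natAbs]
          exact ⟨z.2, (hS z hz).1.symm⟩
        · intro z hz w hw hzw
          simp only [Prod.mk.injEq, decide_eq_decide] at hzw
          have h1 : z.1 = w.1 := by omega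
          have h2 := (hS z hz).1
          rw [h1, ← (hS w hw).1] at h2
          exact Prod.ext h1 (mul_left_cancel₀ (nz w hw) h2)
      simpa [Finset.card_product, mul_comm] using this
    have h1 := hd K.natAbs (by simpa using hK)
    have h2 : (K.natAbs : ℝ) = |(K : ℝ)| := by rw [Nat.cast_natAbs]; simp
    rw [h2] at h1
    have h3 : |(K : ℝ)| ^ (ε / 6) ≤ 64 ^ (ε / 6) * N ^ ε := by
      calc |(K : ℝ)| ^ (ε / 6) ≤ (64 * N ^ 6) ^ (ε / 6) :=
            Real.rpow_le_rpow (abs_nonneg _) h (by positivity)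
        _ = 64 ^ (ε / 6) * N ^ ε := by
            rw [Real.mul_rpow (by norm_num) (by positivity), ← Real.rpow_natCast,
              ← Real.rpow_mul (by linarith)]
            congr 2
            push_cast
            ring
    calc (S.card : ℝ) ≤ 2 * (K.natAbs.divisors.card : ℝ) := by exact_mod_cast hcard
      _ ≤ 2 * (C * (64 ^ (ε / 6) * N ^ ε)) := by gcongr; exact h1.trans (by gcongr)
      _ ≤ _ := by nlinarith
  · have hsub : S ⊆ (S.filter fun z => |K| ≤ z.1 ^ 2) ∪ (S.filter fun z => |K| ≤ z.2 ^ 2) := by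
      intro z hz
      rw [Finset.mem_union, Finset.mem_filter, Finset.mem_filter]
      by_contra! hcon
      have h1 := hcon.1 hz
      have h2 := hcon.2 hz
      have h3 : |K| * |K| = z.1 ^ 2 * z.2 ^ 2 := by
        rw [← (hS z hz).1, ← abs_mul, abs_of_nonneg (mul_self_nonneg _)]; ring
      have h4 : z.1 ^ 2 * z.2 ^ 2 < |K| * |K| :=
        mul_lt_mul'' h1 h2 (by positivity) (by positivity)
      omega
    have c1 : (S.filter fun z => |K| ≤ z.1 ^ 2).card ≤ 2 :=
      card_hyperbola_le_two (a := a) hN h _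
        (fun z hz => ⟨(hS z (Finset.mem_filter.1 hz).1).1, (hS z (Finset.mem_filter.1 hz).1).2.1⟩)
        (fun z hz => (Finset.mem_filter.1 hz).2)
    have c2 : (S.filter fun z => |K| ≤ z.2 ^ 2).card ≤ 2 := by
      rw [← Finset.card_map ⟨Prod.swap, Prod.swap_injective⟩]
      refine card_hyperbola_le_two (a := b) hN h _ (fun z hz => ?_) (fun z hz => ?_)
      · obtain ⟨w, hw, rfl⟩ := Finset.mem_map.1 hz
        have := hS w (Finset.mem_filter.1 hw).1
        exact ⟨by simpa [mul_comm] using this.1, by simpa using this.2.2⟩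
      · obtain ⟨w, hw, rfl⟩ := Finset.mem_map.1 hz
        simpa using (Finset.mem_filter.1 hw).2
    have c3 : S.card ≤ 4 := (Finset.card_le_card hsub).trans
      ((Finset.card_union_le _ _).trans (by omega))
    calc (S.card : ℝ) ≤ 4 := by exact_mod_cast c3
      _ ≤ (2 * C * 64 ^ (ε / 6) + 4) * 1 := by rw [mul_one]; linarith [show 0 ≤ 2 * C * 64 ^ (ε / 6) by positivity]
      _ ≤ _ := by gcongr

/-! ## Weighted lattice sums -/

/-- The sup norm on `ℤ²`. -/
def sz (n : ℤ × ℤ) : ℕ := max n.1.natAbs n.2.natAbs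

/-- The extended real `k ^ (-τ)`. -/
def pw (τ : ℝ) (k : ℕ) : ℝ≥0∞ := (k : ℝ≥0∞) ^ (-τ)

/-- The weight `(1 + |n|) ^ (-τ)`. -/
def wt (τ : ℝ) (n : ℤ × ℤ) : ℝ≥0∞ := pw τ (sz n + 1)

theorem pw_anti {τ : ℝ} (hτ : 0 ≤ τ) {a b : ℕ} (h : a ≤ b) : pw τ b ≤ pw τ a := by
  unfold pw
  rw [ENNReal.rpow_neg, ENNReal.rpow_neg, ENNReal.inv_le_inv]
  exact ENNReal.rpow_le_rpow (by exact_mod_cast h) hτ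

theorem pw_mul (τ : ℝ) (a b : ℕ) : pw τ (a * b) = pw τ a * pw τ b := by
  unfold pw
  rw [Nat.cast_mul, ENNReal.mul_rpow_of_ne_top (by simp) (by simp)]

theorem pw_add (σ τ : ℝ) {k : ℕ} (hk : k ≠ 0) : pw (σ + τ) k = pw σ k * pw τ k := by
  unfold pw
  rw [neg_add, ENNReal.rpow_add _ _ (by simpa using hk) (by simp)]

theorem pw_two_mul (τ : ℝ) (k : ℕ) : (2 : ℝ≥0∞) ^ τ * pw τ (2 * k) = pw τ k := by
  rw [pw_mul, ← mul_assoc]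
  unfold pw
  push_cast
  rw [← ENNReal.rpow_add _ _ (by simp) (by simp)]
  simp

theorem tsum_pw_succ_ne_top {τ : ℝ} (hτ : 1 < τ) : ∑' k : ℕ, pw τ (k + 1) ≠ ⊤ := by
  have h : Summable fun k : ℕ => ((k : ℝ≥0) + 1) ^ (-τ) := by
    have := (NNReal.summable_nat_add_iff (f := fun k : ℕ => (k : ℝ≥0) ^ (-τ)) 1).2
      (NNReal.summable_rpow.2 (by linarith))
    simpa using this
  rw [← ENNReal.tsum_coe_ne_top_iff_summable] at h
  convert h using 3 with k
  unfold pw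
  rw [ENNReal.coe_rpow_of_ne_zero (by positivity)]
  simp

theorem tsum_pw_natAbs_succ_ne_top {τ : ℝ} (hτ : 1 < τ) :
    ∑' a : ℤ, pw τ (a.natAbs + 1) ≠ ⊤ := by
  rw [tsum_of_nat_of_neg_add_one ENNReal.summable ENNReal.summable]
  refine ENNReal.add_ne_top.2 ⟨by simpa using tsum_pw_succ_ne_top hτ, ?_⟩
  refine ne_top_of_le_ne_top (tsum_pw_succ_ne_top hτ) (ENNReal.tsum_le_tsum fun k => ?_)
  exact pw_anti (by linarith) (by omega)

theorem pw_le_two_rpow_mul {τ : ℝ} (hτ : 0 ≤ τ) {a b : ℕ} (h : a ≤ 2 * b) :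
    pw τ b ≤ (2 : ℝ≥0∞) ^ τ * pw τ a := by
  rw [← pw_two_mul]
  gcongr
  exact pw_anti hτ h

theorem tsum_pw_natAbs_ne_top {τ : ℝ} (hτ : 1 < τ) :
    ∑' a : ℤ, (if a = 0 then 0 else pw τ a.natAbs) ≠ ⊤ := by
  refine ne_top_of_le_ne_top (b := ∑' a : ℤ, (2 : ℝ≥0∞) ^ τ * pw τ (a.natAbs + 1)) ?_
    (ENNReal.tsum_le_tsum fun a => ?_)
  · rw [ENNReal.tsum_mul_left]
    exact ENNReal.mul_ne_top (ENNReal.rpow_ne_top_of_nonneg (by linarith) (by simp))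
      (tsum_pw_natAbs_succ_ne_top hτ)
  · split_ifs with h
    · simp
    · exact pw_le_two_rpow_mul (by linarith) (by omega)

/-- The weight is dominated by a product of one-dimensional weights of exponent τ/2 > 1. -/
theorem tsum_wt_ne_top {τ : ℝ} (hτ : 2 < τ) : ∑' n, wt τ n ≠ ⊤ := by
  have h1 := tsum_pw_natAbs_succ_ne_top (τ := τ / 2) (by linarith)
  refine ne_top_of_le_ne_top (ENNReal.mul_ne_top h1 h1) ?_
  rw [← ENNReal.tsum_mul_right]
  simp_rw [← ENNReal.tsum_mul_left]
  rw [← ENNReal.tsum_prod]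
  refine ENNReal.tsum_le_tsum fun n => ?_
  unfold wt
  rw [show τ = τ / 2 + τ / 2 by ring, pw_add _ _ (by omega)]
  simp only [add_halves]
  gcongr <;> exact pw_anti (by linarith) (by unfold sz; omega)

/-! ### Sums of weights along lattice lines. -/

theorem sz_add_le (a b : ℤ × ℤ) : sz (a + b) ≤ sz a + sz b := by
  simp only [sz, Prod.fst_add, Prod.snd_add]; omega

theorem sz_neg (a : ℤ × ℤ) : sz (-a) = sz a := by simp [sz]

theorem sz_smul (j : ℤ) (e : ℤ × ℤ) : sz (j • e) = j.natAbs * sz e := by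
  simp only [sz, Prod.smul_fst, Prod.smul_snd, smul_eq_mul, Int.natAbs_mul, Nat.mul_max_mul_left]

theorem sz_eq_zero {e : ℤ × ℤ} : sz e = 0 ↔ e = 0 := by
  rw [Prod.ext_iff]; simp only [sz, Prod.fst_zero, Prod.snd_zero]; omega

/-- Let j₀ minimize the size along the progression p + je. The triangle inequality gives |j||e| ≤
2|p + (j₀+j)e|, so the terms with j ≠ 0 are bounded by a convergent series times |e|^{-σ}. The point
of minimal size is controlled only through the cutoff, which gives the term `pw σ r`. -/
theorem exists_tsum_line_le {σ : ℝ} (hσ : 1 < σ) :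
    ∃ C : ℝ≥0∞, C ≠ ⊤ ∧ ∀ (e p : ℤ × ℤ) (r : ℕ), e ≠ 0 →
      ∑' j : ℤ, (if r ≤ sz (p + j • e) + 1 then wt σ (p + j • e) else 0)
        ≤ pw σ r + C * pw σ (sz e) := by
  have hσ0 : 0 ≤ σ := by linarith
  refine ⟨2 ^ σ * ∑' a : ℤ, (if a = 0 then 0 else pw σ a.natAbs),
    ENNReal.mul_ne_top (ENNReal.rpow_ne_top_of_nonneg (by linarith) (by simp))
      (tsum_pw_natAbs_ne_top hσ), fun e p r he => ?_⟩
  set j₀ := Function.argmin (fun j : ℤ => sz (p + j • e)) with hj₀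
  have hmin : ∀ j : ℤ, sz (p + j₀ • e) ≤ sz (p + j • e) := fun j =>
    Function.argmin_le (fun j : ℤ => sz (p + j • e)) j
  rw [← (Equiv.addLeft j₀).tsum_eq]
  change ∑' j : ℤ, (if r ≤ sz (p + (j₀ + j) • e) + 1 then wt σ (p + (j₀ + j) • e) else 0) ≤ _
  calc _ ≤ ∑' j : ℤ, ((if j = 0 then pw σ r else 0)
        + 2 ^ σ * (if j = 0 then 0 else pw σ j.natAbs) * pw σ (sz e)) := by
        refine ENNReal.tsum_le_tsum fun j => ?_
        by_cases hj : j = 0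
        · subst hj
          simp only [if_true, mul_zero, zero_mul, add_zero]
          split_ifs with h
          · exact pw_anti hσ0 h
          · exact zero_le
        · simp only [hj, if_false, zero_add]
          rw [mul_assoc, ← pw_mul, ← sz_smul]
          rcases le_or_gt r (sz (p + (j₀ + j) • e) + 1) with h | h
          · rw [if_pos h]
            refine pw_le_two_rpow_mul hσ0 ?_
            have h1 := hmin (j₀ + j)
            have h2 := sz_add_le (p + (j₀ + j) • e) (-(p + j₀ • e))
            rw [sz_neg] at h2
            have h3 : p + (j₀ + j) • e + -(p + j₀ • e) = j • e := by
              rw [add_smul]; abel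
            rw [h3] at h2
            omega
          · rw [if_neg (not_le.2 h)]
            exact zero_le
    _ = _ := by
        rw [ENNReal.tsum_add, tsum_ite_eq, ENNReal.tsum_mul_right, ENNReal.tsum_mul_left]

/-- The primitive vector in the direction of `m`. -/
def prim (m : ℤ × ℤ) : ℤ × ℤ := (m.1 / (m.1.gcd m.2 : ℤ), m.2 / (m.1.gcd m.2 : ℤ))

theorem gcd_smul_prim (m : ℤ × ℤ) : (m.1.gcd m.2 : ℤ) • prim m = m := by
  ext
  · exact Int.mul_ediv_cancel' (Int.gcd_dvd_left ..)
  · exact Int.mul_ediv_cancel' (Int.gcd_dvd_right ..)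

theorem prim_ne_zero {m : ℤ × ℤ} (hm : m ≠ 0) : prim m ≠ 0 := by
  intro h
  apply hm
  rw [← gcd_smul_prim m, h, smul_zero]

/-- Write m = ge with e primitive. If |e| > |n-m| + 1, the product is at most (1+|n-m|)^{-2σ},
summable since 2σ > 2. Otherwise, for fixed e, the sum over g is a line sum with cutoff r = |e|; it
is O(|e|^{-σ}), which leaves the summable |e|^{-2σ}. The auxiliary F runs over all pairs (e, j),
which is harmless because m ↦ (e, g) is injective. -/
theorem exists_tsum_wt_mul_prim_le {σ : ℝ} (hσ : 1 < σ) :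
    ∃ C : ℝ≥0∞, C ≠ ⊤ ∧ ∀ n : ℤ × ℤ,
      ∑' m : ℤ × ℤ, (if m = 0 then 0 else wt σ (n - m) * pw σ (sz (prim m))) ≤ C := by
  have hσ0 : 0 ≤ σ := by linarith
  obtain ⟨C, hC, hline⟩ := exists_tsum_line_le hσ
  have hS := tsum_wt_ne_top (τ := 2 * σ) (by linarith)
  have h2 : (2 : ℝ≥0∞) ^ (2 * σ) ≠ ⊤ := ENNReal.rpow_ne_top_of_nonneg (by linarith) (by simp)
  refine ⟨∑' n, wt (2 * σ) n + (1 + C) * (2 ^ (2 * σ) * ∑' n, wt (2 * σ) n), by finiteness,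
    fun n => ?_⟩
  have dbl : ∀ k : ℕ, k ≠ 0 → pw σ k * pw σ k = pw (2 * σ) k := fun k hk => by
    rw [two_mul, pw_add _ _ hk]
  set F : (ℤ × ℤ) × ℤ → ℝ≥0∞ := fun z => if z.1 = 0 then 0 else
    pw σ (sz z.1) * (if sz z.1 ≤ sz (n + z.2 • (-z.1)) + 1 then wt σ (n + z.2 • (-z.1)) else 0)
    with hF
  have step : ∑' z, F z ≤ (1 + C) * (2 ^ (2 * σ) * ∑' n, wt (2 * σ) n) := by
    rw [ENNReal.tsum_prod', ← ENNReal.tsum_mul_left, ← ENNReal.tsum_mul_left]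
    refine ENNReal.tsum_le_tsum fun e => ?_
    by_cases he : e = 0
    · simp [hF, he]
    · simp only [hF, he, if_false]
      rw [ENNReal.tsum_mul_left]
      have h1 := hline (-e) n (sz e) (neg_ne_zero.2 he)
      rw [sz_neg] at h1
      have he' : sz e ≠ 0 := by rwa [Ne, sz_eq_zero]
      calc _ ≤ pw σ (sz e) * (pw σ (sz e) + C * pw σ (sz e)) := by gcongr
        _ = (1 + C) * pw (2 * σ) (sz e) := by rw [← dbl _ he']; ring
        _ ≤ _ := by
          gcongr
          exact pw_le_two_rpow_mul (by linarith) (by omega)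
  calc _ ≤ ∑' m, (wt (2 * σ) (n - m) + F (prim m, (m.1.gcd m.2 : ℤ))) := by
        refine ENNReal.tsum_le_tsum fun m => ?_
        split_ifs with hm
        · exact zero_le
        · have e1 : n + (m.1.gcd m.2 : ℤ) • (-prim m) = n - m := by
            rw [smul_neg, gcd_smul_prim, sub_eq_add_neg]
          simp only [hF, prim_ne_zero hm, if_false, e1]
          rcases le_or_gt (sz (prim m)) (sz (n - m) + 1) with h | h
          · rw [if_pos h, mul_comm]
            exact le_add_self
          · refine le_add_right ?_
            unfold wt
            rw [← dbl _ (by omega)]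
            gcongr
            exact pw_anti hσ0 h.le
    _ ≤ _ := by
        rw [ENNReal.tsum_add]
        refine add_le_add ?_ (le_trans ?_ step)
        · exact ((Equiv.subLeft n).tsum_eq (wt (2 * σ))).le
        · refine ENNReal.tsum_comp_le_tsum_of_injective
            (f := fun m : ℤ × ℤ => (prim m, (m.1.gcd m.2 : ℤ))) (fun a b hab => ?_) F
          simp only [Prod.mk.injEq] at hab
          rw [← gcd_smul_prim a, ← gcd_smul_prim b, hab.1, hab.2]

/-- Pairs `(n - m, q)` with `q` on a line depending on `m`. -/
theorem exists_tsum_tsum_line_le {σ : ℝ} (hσ : 1 < σ) :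
    ∃ C : ℝ≥0∞, C ≠ ⊤ ∧ ∀ (n : ℤ × ℤ) (c : ℤ × ℤ → ℤ),
      ∑' m : ℤ × ℤ, ∑' q : ℤ × ℤ,
        (if m ≠ 0 ∧ m.1 * q.1 - m.2 * q.2 = c m ∧ sz (n - m) ≤ sz q
          then wt σ (n - m) * wt σ q else 0) ≤ C := by
  have hσ0 : 0 ≤ σ := by linarith
  obtain ⟨C, hC, hline⟩ := exists_tsum_line_le hσ
  obtain ⟨C', hC', hprim⟩ := exists_tsum_wt_mul_prim_le hσ
  have hS := tsum_wt_ne_top (τ := 2 * σ) (by linarith)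
  refine ⟨∑' n, wt (2 * σ) n + C * C', by finiteness, fun n c => ?_⟩
  -- For fixed m ≠ 0 the admissible q lie in one coset of ℤe, where e is the primitive vector of m
  -- with its coordinates exchanged. The condition |n-m| ≤ |q| provides the cutoff r = |n-m| + 1 of
  -- the line estimate.
  have main : ∀ m : ℤ × ℤ, ∑' q : ℤ × ℤ,
        (if m ≠ 0 ∧ m.1 * q.1 - m.2 * q.2 = c m ∧ sz (n - m) ≤ sz q
          then wt σ (n - m) * wt σ q else 0)
      ≤ wt (2 * σ) (n - m) + C * (if m = 0 then 0 else wt σ (n - m) * pw σ (sz (prim m))) := by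
    intro m
    by_cases hm : m = 0
    · simp [hm]
    by_cases hex : ∃ q₀ : ℤ × ℤ, m.1 * q₀.1 - m.2 * q₀.2 = c m
    swap
    · push Not at hex
      simp [hex]
    obtain ⟨q₀, hq₀⟩ := hex
    set g : ℤ := (m.1.gcd m.2 : ℤ) with hg
    have hpm := gcd_smul_prim m
    have hp0 := prim_ne_zero hm
    set e : ℤ × ℤ := ((prim m).2, (prim m).1) with he
    have he0 : e ≠ 0 := fun h => hp0 (by
      rw [Prod.ext_iff] at h ⊢; exact ⟨h.2, h.1⟩)
    have hsz : sz e = sz (prim m) := by simp only [sz, he]; omega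
    have hg0 : g ≠ 0 := by
      intro h0; apply hm; rw [← hpm, ← hg, h0, zero_smul]
    have hcop : IsCoprime (prim m).1 (prim m).2 := by
      rw [Int.isCoprime_iff_gcd_eq_one]
      exact Int.gcd_div_gcd_div_gcd (Nat.pos_of_ne_zero (by simpa [hg] using hg0))
    have hm1 : m.1 = g * (prim m).1 := by
      conv_lhs => rw [← hpm]
      rfl
    have hm2 : m.2 = g * (prim m).2 := by
      conv_lhs => rw [← hpm]
      rfl
    have inj : Function.Injective fun j : ℤ => q₀ + j • e := by
      intro a b hab
      exact smul_left_injective ℤ he0 (add_left_cancel hab)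
    have supp : Function.support (fun q : ℤ × ℤ =>
        (if m ≠ 0 ∧ m.1 * q.1 - m.2 * q.2 = c m ∧ sz (n - m) ≤ sz q
          then wt σ (n - m) * wt σ q else 0)) ⊆ Set.range fun j : ℤ => q₀ + j • e := by
      intro q hq
      simp only [Function.mem_support, ne_eq, ite_eq_right_iff, Classical.not_imp] at hq
      have h1 := hq.1.2.1
      have h2 : (prim m).1 * (q.1 - q₀.1) = (prim m).2 * (q.2 - q₀.2) := by
        apply mul_left_cancel₀ hg0
        rw [← mul_assoc, ← mul_assoc, ← hm1, ← hm2]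
        linarith
      obtain ⟨a, b, hab⟩ := hcop
      refine ⟨a * (q.2 - q₀.2) + b * (q.1 - q₀.1), ?_⟩
      ext
      · simp only [he, Prod.fst_add, Prod.smul_fst, smul_eq_mul]
        linear_combination (q.1 - q₀.1) * hab - a * h2
      · simp only [he, Prod.snd_add, Prod.smul_snd, smul_eq_mul]
        linear_combination (q.2 - q₀.2) * hab + b * h2
    rw [← inj.tsum_eq supp]
    calc _ ≤ ∑' j : ℤ, wt σ (n - m) *
          (if sz (n - m) + 1 ≤ sz (q₀ + j • e) + 1 then wt σ (q₀ + j • e) else 0) := by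
          refine ENNReal.tsum_le_tsum fun j => ?_
          by_cases hj : sz (n - m) ≤ sz (q₀ + j • e)
          · rw [if_pos (by omega : sz (n - m) + 1 ≤ sz (q₀ + j • e) + 1)]
            split_ifs
            · exact le_rfl
            · exact zero_le
          · rw [if_neg fun h => hj h.2.2]
            exact zero_le
      _ ≤ wt σ (n - m) * (pw σ (sz (n - m) + 1) + C * pw σ (sz e)) := by
          rw [ENNReal.tsum_mul_left]
          gcongr
          exact hline e q₀ _ he0
      _ = _ := by
          rw [if_neg hm, hsz, mul_add]
          congr 1
          · rw [two_mul]; unfold wt; rw [pw_add _ _ (by omega)]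
          · ring
  calc _ ≤ _ := ENNReal.tsum_le_tsum main
    _ ≤ _ := by
      rw [ENNReal.tsum_add, ENNReal.tsum_mul_left]
      exact add_le_add ((Equiv.subLeft n).tsum_eq (wt (2 * σ))).le (mul_le_mul_right (hprim n) _)

/-- With x = 2q₁ - c₁ and y = 2q₂ - c₂ the equation reads (x-y)(x+y) = K. In the dyadic region |q| +
1 < 2^{j+1} both factors stay in intervals of radius 8·2^j around points depending only on c, so
there are O(2^{jε/2}) solutions. The weight 2^{-jε} then leaves a geometric series. -/
theorem exists_tsum_hyperbola_le {ε : ℝ} (hε : 0 < ε) :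
    ∃ C : ℝ≥0∞, C ≠ ⊤ ∧ ∀ (K : ℤ) (c : ℤ × ℤ), K ≠ 0 →
      ∑' q : ℤ × ℤ, (if (2 * q.1 - c.1) ^ 2 - (2 * q.2 - c.2) ^ 2 = K then wt ε q else 0) ≤ C := by
  obtain ⟨C, hC, hcard⟩ := exists_card_hyperbola_le (ε := ε / 2) (by positivity)
  have hr : (2 : ℝ≥0∞) ^ (-(ε / 2)) < 1 :=
    ENNReal.rpow_lt_one_of_one_lt_of_neg (by simp) (by linarith)
  refine ⟨ENNReal.ofReal (C * 8 ^ (ε / 2)) * (1 - (2 : ℝ≥0∞) ^ (-(ε / 2)))⁻¹, ?_,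
    fun K c hK => ?_⟩
  · refine ENNReal.mul_ne_top (by simp) (ENNReal.inv_ne_top.2 ?_)
    exact (tsub_pos_of_lt hr).ne'
  rw [ENNReal.tsum_eq_iSup_sum]
  refine iSup_le fun S => ?_
  rw [← Finset.sum_filter]
  set S' := S.filter fun q => (2 * q.1 - c.1) ^ 2 - (2 * q.2 - c.2) ^ 2 = K with hS'
  have hcount : ∀ j : ℕ, ((S'.filter fun q => sz q + 1 < 2 ^ (j + 1)).card : ℝ≥0∞)
      ≤ ENNReal.ofReal (C * 8 ^ (ε / 2)) * ((2 ^ j : ℕ) : ℝ≥0∞) ^ (ε / 2) := by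
    intro j
    have h1 := hcard K (-(c.1 - c.2)) (-(c.1 + c.2)) (8 * 2 ^ j) hK
      (by have : (1 : ℝ) ≤ 2 ^ j := one_le_pow₀ (by norm_num)
          linarith)
      ((S'.filter fun q => sz q + 1 < 2 ^ (j + 1)).image fun q =>
        ((2 * q.1 - c.1) - (2 * q.2 - c.2), (2 * q.1 - c.1) + (2 * q.2 - c.2))) ?_
    · rw [Finset.card_image_of_injective] at h1
      · rw [Real.mul_rpow (by norm_num) (by positivity), ← mul_assoc] at h1
        calc _ = ENNReal.ofReal ((S'.filter fun q => sz q + 1 < 2 ^ (j + 1)).card : ℝ) := by simp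
          _ ≤ _ := ENNReal.ofReal_le_ofReal h1
          _ = _ := by
            rw [ENNReal.ofReal_mul (by positivity), ← ENNReal.ofReal_rpow_of_pos (by positivity)]
            congr 2
            rw [ENNReal.ofReal_pow (by norm_num)]
            simp
      · intro a b hab
        simp only [Prod.mk.injEq] at hab
        exact Prod.ext (by omega) (by omega)
    · intro z hz
      obtain ⟨q, hq, rfl⟩ := Finset.mem_image.1 hz
      rw [Finset.mem_filter, hS', Finset.mem_filter] at hq
      obtain ⟨⟨-, h2⟩, h3⟩ := hq
      have h4 : (sz q : ℤ) < 2 * 2 ^ j := by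
        have : sz q + 1 < 2 * 2 ^ j := by rw [pow_succ] at h3; omega
        exact_mod_cast (by omega : sz q < 2 * 2 ^ j)
      have b1 : |q.1| ≤ (sz q : ℤ) := by rw [Int.abs_eq_natAbs]; exact_mod_cast le_max_left _ _
      have b2 : |q.2| ≤ (sz q : ℤ) := by rw [Int.abs_eq_natAbs]; exact_mod_cast le_max_right _ _
      rw [abs_le] at b1 b2
      refine ⟨by rw [← h2]; ring, ?_, ?_⟩
      · have : |((2 * q.1 - c.1) - (2 * q.2 - c.2)) - (-(c.1 - c.2))| ≤ 8 * 2 ^ j := by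
          rw [abs_le]; constructor <;> linarith
        exact_mod_cast this
      · have : |((2 * q.1 - c.1) + (2 * q.2 - c.2)) - (-(c.1 + c.2))| ≤ 8 * 2 ^ j := by
          rw [abs_le]; constructor <;> linarith
        exact_mod_cast this
  calc ∑ q ∈ S', wt ε q
      ≤ ∑ q ∈ S', ∑' j : ℕ, (if sz q + 1 < 2 ^ (j + 1) then pw ε (2 ^ j) else 0) := by
        refine Finset.sum_le_sum fun q _ => ?_
        refine le_trans ?_ (ENNReal.le_tsum (Nat.log 2 (sz q + 1)))
        rw [if_pos (Nat.lt_pow_succ_log_self (by norm_num) _)]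
        exact pw_anti hε.le (Nat.pow_log_le_self 2 (by omega))
    _ = ∑' j : ℕ, ((S'.filter fun q => sz q + 1 < 2 ^ (j + 1)).card : ℝ≥0∞) * pw ε (2 ^ j) := by
        rw [← Summable.tsum_finsetSum fun _ _ => ENNReal.summable]
        refine tsum_congr fun j => ?_
        rw [← Finset.sum_filter, Finset.sum_const, nsmul_eq_mul]
    _ ≤ ∑' j : ℕ, ENNReal.ofReal (C * 8 ^ (ε / 2)) * ((2 : ℝ≥0∞) ^ (-(ε / 2))) ^ j := by
        refine ENNReal.tsum_le_tsum fun j => ?_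
        refine (mul_le_mul_left (hcount j) _).trans (le_of_eq ?_)
        rw [mul_assoc]
        congr 1
        unfold pw
        rw [← ENNReal.rpow_add _ _ (by simp) (by simp), ← ENNReal.rpow_natCast,
          ← ENNReal.rpow_mul, mul_comm, ENNReal.rpow_mul]
        push_cast
        rw [ENNReal.rpow_natCast]
        congr 1
        ring
    _ = _ := by rw [ENNReal.tsum_mul_left, ENNReal.tsum_geometric]

/-- This also covers the degenerate conics, on which the divisor bound fails. Each value of q₁
admits at most two values of q₂, and since σ > 1 the weight is summable in q₁ alone. -/
theorem exists_tsum_conic_le {σ : ℝ} (hσ : 1 < σ) :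
    ∃ C : ℝ≥0∞, C ≠ ⊤ ∧ ∀ (d κ : ℤ) (c : ℤ × ℤ), d ≠ 0 →
      ∑' q : ℤ × ℤ, (if (d * q.1 - c.1) ^ 2 - (d * q.2 - c.2) ^ 2 = κ then wt σ q else 0) ≤ C := by
  have h1 := tsum_pw_natAbs_succ_ne_top hσ
  refine ⟨2 * ∑' a : ℤ, pw σ (a.natAbs + 1), by finiteness, fun d κ c hd => ?_⟩
  rw [ENNReal.tsum_prod', ← ENNReal.tsum_mul_left]
  refine ENNReal.tsum_le_tsum fun a => ?_
  by_cases hex : ∃ b₀ : ℤ, (d * a - c.1) ^ 2 - (d * b₀ - c.2) ^ 2 = κ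
  · obtain ⟨b₀, hb₀⟩ := hex
    -- The mirror image of the root b₀. The division is exact whenever a second integer root exists;
    -- otherwise the extra term only enlarges the bound.
    set b₁ := (2 * c.2 - d * b₀) / d with hb₁
    calc _ ≤ ∑' b : ℤ, ((if b = b₀ then pw σ (a.natAbs + 1) else 0)
          + (if b = b₁ then pw σ (a.natAbs + 1) else 0)) := by
          refine ENNReal.tsum_le_tsum fun b => ?_
          dsimp only
          split_ifs with h h2 h3 h4
          · exact le_add_right (pw_anti (by linarith) (by simp only [sz]; omega))
          · exact le_add_right (pw_anti (by linarith) (by simp only [sz]; omega))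
          · exact le_add_left (pw_anti (by linarith) (by simp only [sz]; omega))
          · exfalso
            have h5 : (d * b - c.2 - (d * b₀ - c.2)) * (d * b - c.2 + (d * b₀ - c.2)) = 0 := by
              linear_combination hb₀ - h
            rcases mul_eq_zero.1 h5 with h6 | h6
            · exact h2 (mul_left_cancel₀ hd (by linarith))
            · apply h4
              exact Int.eq_ediv_of_mul_eq_right hd (by linarith)
          all_goals exact zero_le
      _ = _ := by rw [ENNReal.tsum_add, tsum_ite_eq, tsum_ite_eq, two_mul]
  · push Not at hex
    simp [hex]

/-- The bilinear form polarizing `n₁² - n₂²`. -/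
def hyp (m k : ℤ × ℤ) : ℤ := m.1 * k.1 - m.2 * k.2

theorem hyp_comm (m k : ℤ × ℤ) : hyp m k = hyp k m := by unfold hyp; ring

/-- The case in which the conjugated frequency is the smallest. -/
theorem exists_tsum_conjugate_smallest_le {σ : ℝ} (hσ : 1 < σ) :
    ∃ C : ℝ≥0∞, C ≠ ⊤ ∧ ∀ (n : ℤ × ℤ) (μ : ℤ),
      ∑' m : ℤ × ℤ, ∑' k : ℤ × ℤ, (if hyp m k = μ ∧ sz (n - m - k) ≤ sz (n - m)
          then wt σ (n - m - k) * wt σ (n - m) else 0) ≤ C := by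
  have hσ0 : 0 ≤ σ := by linarith
  obtain ⟨C₁, hC₁, h₁⟩ := exists_tsum_hyperbola_le (ε := σ - 1) (by linarith)
  obtain ⟨C₂, hC₂, h₂⟩ := exists_tsum_conic_le hσ
  have hS := tsum_wt_ne_top (τ := σ + 1) (by linarith)
  refine ⟨(∑' b, wt (σ + 1) b) * C₁ + C₂ * C₂, by finiteness, fun n μ => ?_⟩
  have e1 : ∑' m : ℤ × ℤ, ∑' k : ℤ × ℤ, (if hyp m k = μ ∧ sz (n - m - k) ≤ sz (n - m)
          then wt σ (n - m - k) * wt σ (n - m) else 0)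
      = ∑' b : ℤ × ℤ, ∑' a : ℤ × ℤ, (if hyp (n - a) (a - b) = μ ∧ sz b ≤ sz a
          then wt σ b * wt σ a else 0) := by
    conv_rhs => rw [ENNReal.tsum_comm]
    rw [← (Equiv.subLeft n).tsum_eq]
    refine tsum_congr fun a => ?_
    rw [← (Equiv.subLeft a).tsum_eq]
    refine tsum_congr fun b => ?_
    simp only [Equiv.subLeft_apply, sub_sub_cancel]
  rw [e1]
  -- Completing the square: with b = n-m-k fixed, a = n-m lies on a hyperbola centred at (n+b)/2.
  have key : ∀ a b : ℤ × ℤ, hyp (n - a) (a - b) = μ →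
      (2 * a.1 - (n + b).1) ^ 2 - (2 * a.2 - (n + b).2) ^ 2
        = (n.1 - b.1) ^ 2 - (n.2 - b.2) ^ 2 - 4 * μ := by
    intro a b h
    rw [← h]
    simp only [hyp, Prod.fst_sub, Prod.snd_sub, Prod.fst_add, Prod.snd_add]
    ring
  calc _ ≤ ∑' b : ℤ × ℤ, (wt (σ + 1) b * C₁ +
        (if (1 * b.1 - n.1) ^ 2 - (1 * b.2 - n.2) ^ 2 = 4 * μ then wt σ b else 0) * C₂) := by
        refine ENNReal.tsum_le_tsum fun b => ?_
        set K := (n.1 - b.1) ^ 2 - (n.2 - b.2) ^ 2 - 4 * μ with hK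
        -- When the hyperbola degenerates, b itself lies on a conic centred at n, and the conic
        -- bound is applied in both variables. Otherwise one power of the weight of a is transferred
        -- to the smaller b: exponent σ + 1 > 2 is summable in b, and σ - 1 > 0 suffices on the
        -- hyperbola.
        by_cases hK0 : K = 0
        · rw [if_pos (by rw [← sub_eq_zero, ← hK0, hK]; ring)]
          refine le_add_left ?_
          refine le_trans ?_ (mul_le_mul_right (h₂ 2 K (n + b) (by norm_num)) _)
          rw [← ENNReal.tsum_mul_left]
          refine ENNReal.tsum_le_tsum fun a => ?_
          split_ifs with h h'
          · exact le_rfl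
          · exact absurd (key a b h.1) h'
          all_goals simp
        · refine le_add_right ?_
          refine le_trans ?_ (mul_le_mul_right (h₁ K (n + b) hK0) _)
          rw [← ENNReal.tsum_mul_left]
          refine ENNReal.tsum_le_tsum fun a => ?_
          split_ifs with h h'
          · unfold wt
            rw [pw_add _ _ (by omega), mul_assoc]
            gcongr
            calc pw σ (sz a + 1) = pw 1 (sz a + 1) * pw (σ - 1) (sz a + 1) := by
                  rw [← pw_add _ _ (by omega)]; congr 1; ring
              _ ≤ _ := by
                  gcongr
                  exact pw_anti zero_le_one (by omega)
          · exact absurd (key a b h.1) h'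
          all_goals simp
    _ ≤ _ := by
        rw [ENNReal.tsum_add, ENNReal.tsum_mul_right, ENNReal.tsum_mul_right]
        gcongr
        exact h₂ 1 (4 * μ) n one_ne_zero

/-- For fixed m the condition hyp(m,k) = μ is linear in k, so both q = n-m-k and q = n-k run over a
line, and only the constant of the line differs. -/
theorem exists_tsum_line_pair_le {σ : ℝ} (hσ : 1 < σ) :
    ∃ C : ℝ≥0∞, C ≠ ⊤ ∧ ∀ (n : ℤ × ℤ) (μ : ℤ),
      ∑' m : ℤ × ℤ, ∑' k : ℤ × ℤ, (if m ≠ 0 ∧ hyp m k = μ ∧ sz (n - m) ≤ sz (n - m - k)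
          then wt σ (n - m) * wt σ (n - m - k) else 0) ≤ C ∧
      ∑' m : ℤ × ℤ, ∑' k : ℤ × ℤ, (if m ≠ 0 ∧ hyp m k = μ ∧ sz (n - m) ≤ sz (n - k)
          then wt σ (n - m) * wt σ (n - k) else 0) ≤ C := by
  obtain ⟨C, hC, h⟩ := exists_tsum_tsum_line_le hσ
  refine ⟨C, hC, fun n μ => ⟨?_, ?_⟩⟩
  · refine le_trans (le_of_eq ?_) (h n fun m => hyp m (n - m) - μ)
    refine tsum_congr fun m => ?_
    rw [← (Equiv.subLeft (n - m)).tsum_eq]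
    refine tsum_congr fun q => ?_
    simp only [Equiv.subLeft_apply, sub_sub_cancel]
    congr 1
    simp only [hyp, Prod.fst_sub, Prod.snd_sub, eq_iff_iff]
    refine and_congr Iff.rfl (and_congr ⟨fun h => ?_, fun h => ?_⟩ Iff.rfl) <;> linear_combination -h
  · refine le_trans (le_of_eq ?_) (h n fun m => hyp m n - μ)
    refine tsum_congr fun m => ?_
    rw [← (Equiv.subLeft n).tsum_eq]
    refine tsum_congr fun q => ?_
    simp only [Equiv.subLeft_apply, sub_sub_cancel]
    congr 1
    simp only [hyp, Prod.fst_sub, Prod.snd_sub, eq_iff_iff]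
    refine and_congr Iff.rfl (and_congr ⟨fun h => ?_, fun h => ?_⟩ Iff.rfl) <;> linear_combination -h

/-- The estimate on the level sets of the resonance function. -/
theorem exists_tsum_level_set_le {σ : ℝ} (hσ : 1 < σ) :
    ∃ C : ℝ≥0∞, C ≠ ⊤ ∧ ∀ (n : ℤ × ℤ) (μ : ℤ),
      ∑' m : ℤ × ℤ, ∑' k : ℤ × ℤ, (if hyp m k = μ
          then wt σ (n - m) * wt σ (n - m - k) * wt σ (n - k) else 0) ≤ C * wt σ n := by
  have hσ0 : 0 ≤ σ := by linarith
  obtain ⟨C₁, hC₁, h₁⟩ := exists_tsum_conjugate_smallest_le hσ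
  obtain ⟨C₂, hC₂, h₂⟩ := exists_tsum_line_pair_le hσ
  have hS := tsum_wt_ne_top (τ := 2 * σ) (by linarith)
  have h3 : (3 : ℝ≥0∞) ^ σ ≠ ⊤ := ENNReal.rpow_ne_top_of_nonneg hσ0 (by simp)
  refine ⟨2 * ∑' b, wt (2 * σ) b + 3 ^ σ * (2 * C₁ + 4 * C₂), by finiteness, fun n μ => ?_⟩
  set T0 : ℤ × ℤ → ℤ × ℤ → ℝ≥0∞ := fun m k => if m = 0 then wt (2 * σ) (n - k) else 0
  set T1 : ℤ × ℤ → ℤ × ℤ → ℝ≥0∞ := fun m k =>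
    if m ≠ 0 ∧ hyp m k = μ ∧ sz (n - m) ≤ sz (n - m - k) then wt σ (n - m) * wt σ (n - m - k) else 0
  set T2 : ℤ × ℤ → ℤ × ℤ → ℝ≥0∞ := fun m k =>
    if m ≠ 0 ∧ hyp m k = μ ∧ sz (n - m) ≤ sz (n - k) then wt σ (n - m) * wt σ (n - k) else 0
  set T3 : ℤ × ℤ → ℤ × ℤ → ℝ≥0∞ := fun m k =>
    if hyp m k = μ ∧ sz (n - m - k) ≤ sz (n - m) then wt σ (n - m - k) * wt σ (n - m) else 0
  have s0 : ∑' m, ∑' k, T0 m k ≤ ∑' b, wt (2 * σ) b := by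
    rw [tsum_eq_single 0 fun m hm => by simp [T0, hm]]
    simp only [T0, if_true]
    exact ((Equiv.subLeft n).tsum_eq (wt (2 * σ))).le
  have s1 : ∑' m, ∑' k, T1 m k ≤ C₂ := (h₂ n μ).1
  have s2 : ∑' m, ∑' k, T2 m k ≤ C₂ := (h₂ n μ).2
  have s3 : ∑' m, ∑' k, T3 m k ≤ C₁ := h₁ n μ
  have dbl : ∀ q, wt σ q * wt σ q = wt (2 * σ) q := fun q => by
    unfold wt; rw [two_mul, pw_add _ _ (by omega)]
  -- From n = (n-m) - (n-m-k) + (n-k), the largest of the three frequencies has size at least |n|/3.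
  have big : ∀ m k q, (sz (n - m) ≤ sz q ∧ sz (n - m - k) ≤ sz q ∧ sz (n - k) ≤ sz q) →
      wt σ q ≤ 3 ^ σ * wt σ n := by
    intro m k q hq
    have e : n = (n - m) + -(n - m - k) + (n - k) := by abel
    have b1 := sz_add_le ((n - m) + -(n - m - k)) (n - k)
    have b2 := sz_add_le (n - m) (-(n - m - k))
    rw [sz_neg] at b2
    rw [← e] at b1
    have : (3 : ℝ≥0∞) ^ σ * pw σ (3 * (sz q + 1)) = pw σ (sz q + 1) := by
      rw [pw_mul, ← mul_assoc]
      unfold pw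
      push_cast
      rw [← ENNReal.rpow_add _ _ (by simp) (by simp)]
      simp
    unfold wt
    rw [← this]
    gcongr
    exact pw_anti hσ0 (by omega)
  -- Pointwise bound according to the ordering of the three sizes: the largest weight becomes 3^σ
  -- wt(n), and the other two form one of the summands T1, T2, T3, up to the symmetry m ↔ k. The
  -- trivial interactions m = 0 or k = 0 contain wt(n) exactly and go to T0.
  have pt : ∀ m k, (if hyp m k = μ
          then wt σ (n - m) * wt σ (n - m - k) * wt σ (n - k) else 0) ≤
      wt σ n * (T0 m k + T0 k m) + 3 ^ σ * wt σ n *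
        ((T1 m k + T1 k m) + (T2 m k + T2 k m) + (T3 m k + T3 k m)) := by
    intro m k
    split_ifs with h
    swap
    · exact zero_le
    have hk : hyp k m = μ := by rw [hyp_comm, h]
    have ekm : n - k - m = n - m - k := by abel
    by_cases hm0 : m = 0
    · refine le_add_right ?_
      rw [mul_add]
      refine le_add_right ?_
      simp only [T0, hm0, if_true, sub_zero]
      rw [mul_assoc, dbl]
    by_cases hk0 : k = 0
    · refine le_add_right ?_
      rw [mul_add]
      refine le_add_left ?_
      simp only [T0, hk0, if_true, sub_zero]
      rw [dbl, mul_comm]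
    refine le_add_left ?_
    set a := n - m
    set b := n - m - k with hb
    set c := n - k
    have big' : ∀ q, sz a ≤ sz q → sz b ≤ sz q → sz c ≤ sz q → wt σ q ≤ 3 ^ σ * wt σ n :=
      fun q h1 h2 h3 => big m k q ⟨h1, h2, h3⟩
    have bb : ∀ x y z q : ℝ≥0∞, wt σ a * wt σ b * wt σ c = x * y → x ≤ 3 ^ σ * wt σ n → y ≤ z →
        wt σ a * wt σ b * wt σ c ≤ 3 ^ σ * wt σ n * z := fun x y z q h1 h2 h3 => by
      rw [h1]; gcongr
    rcases le_total (sz a) (sz b) with hab | hab <;> rcases le_total (sz b) (sz c) with hbc | hbc <;>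
      rcases le_total (sz a) (sz c) with hac | hac
    · refine bb (wt σ c) (T1 m k) _ 0 ?_ (big' c (by omega) (by omega) (by omega)) ?_
      · simp only [T1]; rw [if_pos ⟨hm0, h, hab⟩]; ring
      · exact le_add_right (le_add_right (le_add_right le_rfl))
    · refine bb (wt σ c) (T1 m k) _ 0 ?_ (big' c (by omega) (by omega) (by omega)) ?_
      · simp only [T1]; rw [if_pos ⟨hm0, h, hab⟩]; ring
      · exact le_add_right (le_add_right (le_add_right le_rfl))
    · refine bb (wt σ b) (T2 m k) _ 0 ?_ (big' b (by omega) (by omega) (by omega)) ?_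
      · simp only [T2]; rw [if_pos ⟨hm0, h, hac⟩]; ring
      · exact le_add_right (le_add_left (le_add_right le_rfl))
    · refine bb (wt σ b) (T2 k m) _ 0 ?_ (big' b (by omega) (by omega) (by omega)) ?_
      · simp only [T2]; rw [if_pos ⟨hk0, hk, hac⟩]; ring
      · exact le_add_right (le_add_left (le_add_left le_rfl))
    · refine bb (wt σ c) (T3 m k) _ 0 ?_ (big' c (by omega) (by omega) (by omega)) ?_
      · simp only [T3]; rw [if_pos ⟨h, hab⟩]; ring
      · exact le_add_left (le_add_right le_rfl)
    · refine bb (wt σ a) (T3 k m) _ 0 ?_ (big' a (by omega) (by omega) (by omega)) ?_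
      · simp only [T3]; rw [ekm, if_pos ⟨hk, hbc⟩]; ring
      · exact le_add_left (le_add_left le_rfl)
    · refine bb (wt σ a) (T1 k m) _ 0 ?_ (big' a (by omega) (by omega) (by omega)) ?_
      · simp only [T1]; rw [ekm, if_pos ⟨hk0, hk, hbc⟩]; ring
      · exact le_add_right (le_add_right (le_add_left le_rfl))
    · refine bb (wt σ a) (T1 k m) _ 0 ?_ (big' a (by omega) (by omega) (by omega)) ?_
      · simp only [T1]; rw [ekm, if_pos ⟨hk0, hk, hbc⟩]; ring
      · exact le_add_right (le_add_right (le_add_left le_rfl))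
  calc _ ≤ _ := ENNReal.tsum_le_tsum fun m => ENNReal.tsum_le_tsum fun k => pt m k
    _ = wt σ n * (∑' m, ∑' k, T0 m k + ∑' m, ∑' k, T0 k m) + 3 ^ σ * wt σ n *
        ((∑' m, ∑' k, T1 m k + ∑' m, ∑' k, T1 k m) + (∑' m, ∑' k, T2 m k + ∑' m, ∑' k, T2 k m)
          + (∑' m, ∑' k, T3 m k + ∑' m, ∑' k, T3 k m)) := by
        simp only [ENNReal.tsum_add, ENNReal.tsum_mul_left]
    _ ≤ wt σ n * (∑' b, wt (2 * σ) b + ∑' b, wt (2 * σ) b) + 3 ^ σ * wt σ n *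
        ((C₂ + C₂) + (C₂ + C₂) + (C₁ + C₁)) := by
        have c0 : ∑' m, ∑' k, T0 k m ≤ ∑' b, wt (2 * σ) b := by rw [ENNReal.tsum_comm]; exact s0
        have c1 : ∑' m, ∑' k, T1 k m ≤ C₂ := by rw [ENNReal.tsum_comm]; exact s1
        have c2 : ∑' m, ∑' k, T2 k m ≤ C₂ := by rw [ENNReal.tsum_comm]; exact s2
        have c3 : ∑' m, ∑' k, T3 k m ≤ C₁ := by rw [ENNReal.tsum_comm]; exact s3
        exact add_le_add (mul_le_mul_right (add_le_add s0 c0) _)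
          (mul_le_mul_right (add_le_add (add_le_add (add_le_add s1 c1) (add_le_add s2 c2))
            (add_le_add s3 c3)) _)
    _ = _ := by ring

/-! ## The trilinear estimate -/

/-- The kernel `(1 + x²)⁻¹`. -/
def decay (x : ℝ) : ℝ≥0∞ := ENNReal.ofReal (1 / (1 + x ^ 2))

theorem exists_tsum_decay_le :
    ∃ B : ℝ≥0∞, B ≠ ⊤ ∧ ∀ y : ℝ, ∑' l : ℤ, decay (l - y) ≤ B := by
  have h2 := tsum_pw_natAbs_succ_ne_top (τ := 2) (by norm_num)
  -- The constant 6 works because |l| ≤ |x| + 1 for x = l - fract y, and (|x|+2)² ≤ 6(1+x²).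
  refine ⟨ENNReal.ofReal 6 * ∑' a : ℤ, pw 2 (a.natAbs + 1), by finiteness, fun y => ?_⟩
  rw [← (Equiv.addRight ⌊y⌋).tsum_eq, ← ENNReal.tsum_mul_left]
  refine ENNReal.tsum_le_tsum fun l => ?_
  have e : ((Equiv.addRight ⌊y⌋ l : ℤ) : ℝ) - y = l - Int.fract y := by
    simp only [Equiv.coe_addRight, Int.cast_add, ← Int.self_sub_floor]; ring
  rw [e]
  unfold decay pw
  have h0 := Int.fract_nonneg y
  have h1 := Int.fract_lt_one y
  set r := Int.fract y
  rw [ENNReal.rpow_neg, ← ENNReal.ofReal_natCast, ENNReal.ofReal_rpow_of_nonneg (by positivity)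
    (by norm_num), ← ENNReal.ofReal_inv_of_pos (by positivity), ← ENNReal.ofReal_mul (by norm_num)]
  refine ENNReal.ofReal_le_ofReal ?_
  rw [← div_eq_mul_inv, div_le_div_iff₀ (by positivity) (by positivity)]
  push_cast
  rw [show ((2 : ℝ)) = ((2 : ℕ) : ℝ) by norm_num, Real.rpow_natCast]
  have h3 : |(l : ℝ)| ≤ |l - r| + 1 := by
    have := abs_sub_abs_le_abs_sub (l : ℝ) (l - r)
    rw [sub_sub_cancel, abs_of_nonneg h0] at this
    linarith
  have h5 : ((l.natAbs : ℕ) : ℝ) = |(l : ℝ)| := by rw [Nat.cast_natAbs]; simp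
  rw [h5, ← sq_abs ((l : ℝ) - r)]
  have := abs_nonneg (l : ℝ)
  have := abs_nonneg ((l : ℝ) - r)
  nlinarith [sq_nonneg (|(l : ℝ) - r| - 1)]

/-- Splitting μ into residue classes modulo M turns each class into a sum over shifted even
integers, bounded by B. The factor M is the only loss caused by slowing down time. -/
theorem tsum_decay_scaled_le {B : ℝ≥0∞} (hB : ∀ y : ℝ, ∑' l : ℤ, decay (l - y) ≤ B)
    (M : ℕ) (hM : M ≠ 0) (y : ℝ) : ∑' μ : ℤ, decay (y - 2 * μ / M) ≤ M * B := by
  have : NeZero M := ⟨hM⟩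
  rw [← (Int.divModEquiv M).symm.tsum_eq, ENNReal.tsum_prod', ENNReal.tsum_comm, tsum_fintype]
  calc _ ≤ ∑ r : Fin M, B := Finset.sum_le_sum fun r _ => ?_
    _ = M * B := by simp
  refine le_trans ?_ (hB (y - 2 * (r : ℕ) / M))
  refine le_trans ?_ (ENNReal.tsum_comp_le_tsum_of_injective (f := fun q : ℤ => 2 * q)
    (fun a b h => by simpa using h) _)
  refine ENNReal.tsum_le_tsum fun q => le_of_eq ?_
  unfold decay
  congr 2
  rw [Int.divModEquiv_symm_apply]
  have : (M : ℝ) ≠ 0 := by exact_mod_cast hM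
  push_cast
  field_simp
  ring

/-! ### Hölder's inequality and ℓ^p norms with values in [0,∞]. -/

theorem tsum_mul_le_Lp_mul_Lq {ι : Type*} (f g : ι → ℝ≥0∞) {P Q : ℝ} (h : P.HolderConjugate Q) :
    ∑' i, f i * g i ≤ (∑' i, f i ^ P) ^ (1 / P) * (∑' i, g i ^ Q) ^ (1 / Q) := by
  rw [ENNReal.tsum_eq_iSup_sum]
  refine iSup_le fun s => (ENNReal.inner_le_Lp_mul_Lq s f g h).trans ?_
  have := h.pos
  have := h.symm.pos
  gcongr <;> exact ENNReal.sum_le_tsum s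

/-- The `ℓ^p` norm of a sequence with values in `[0,∞]`. -/
abbrev lpn {ι : Type*} [MeasurableSpace ι] (p : ℝ≥0∞) (F : ι → ℝ≥0∞) : ℝ≥0∞ :=
  eLpNorm F p Measure.count

theorem lpn_eq {ι : Type*} [MeasurableSpace ι] [MeasurableSingletonClass ι] {p : ℝ≥0∞}
    (h0 : p ≠ 0) (h : p ≠ ⊤) (F : ι → ℝ≥0∞) :
    lpn p F = (∑' z, F z ^ p.toReal) ^ (1 / p.toReal) := by
  rw [lpn, eLpNorm_eq_lintegral_rpow_enorm_toReal h0 h, lintegral_count]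
  simp

theorem lpn_rpow {ι : Type*} [MeasurableSpace ι] [MeasurableSingletonClass ι] {p : ℝ≥0∞}
    (h0 : p ≠ 0) (h : p ≠ ⊤) (F : ι → ℝ≥0∞) :
    lpn p F ^ p.toReal = ∑' z, F z ^ p.toReal := by
  rw [lpn_eq h0 h, ← ENNReal.rpow_mul, one_div_mul_cancel (ENNReal.toReal_pos h0 h).ne',
    ENNReal.rpow_one]

theorem lpn_mono {ι : Type*} [MeasurableSpace ι] {p : ℝ≥0∞} {F G : ι → ℝ≥0∞}
    (h : ∀ z, F z ≤ G z) : lpn p F ≤ lpn p G := eLpNorm_mono_enorm fun z => by simpa using h z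

theorem lpn_add_le {ι : Type*} [Countable ι] [MeasurableSpace ι] [MeasurableSingletonClass ι]
    {p : ℝ≥0∞} (hp : 1 ≤ p) (F G : ι → ℝ≥0∞) :
    lpn p (fun z => F z + G z) ≤ lpn p F + lpn p G :=
  eLpNorm_add_le .of_discrete .of_discrete hp

theorem lpn_const_mul {ι : Type*} [MeasurableSpace ι] [MeasurableSingletonClass ι] {p : ℝ≥0∞}
    (h0 : p ≠ 0) (h : p ≠ ⊤) (c : ℝ≥0∞) (F : ι → ℝ≥0∞) :
    lpn p (fun z => c * F z) = c * lpn p F := by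
  have hp := ENNReal.toReal_pos h0 h
  rw [lpn_eq h0 h, lpn_eq h0 h]
  simp_rw [ENNReal.mul_rpow_of_nonneg _ _ hp.le]
  rw [ENNReal.tsum_mul_left, ENNReal.mul_rpow_of_nonneg _ _ (by positivity), ← ENNReal.rpow_mul,
    mul_one_div_cancel hp.ne', ENNReal.rpow_one]

/-- Space-time frequencies: a spatial frequency in `ℤ²` and a temporal one. -/
abbrev Freq := (ℤ × ℤ) × ℤ

/-- The summation index of the cubic convolution: three temporal frequencies and the two
differences of spatial frequencies. -/
abbrev TriIdx := (ℤ × ℤ × ℤ) × ((ℤ × ℤ) × (ℤ × ℤ))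

/-- The temporal frequency offset of an interaction, at time scale `1 / M`. -/
def phase (M : ℕ) (l : ℤ) (j : TriIdx) : ℝ :=
  l - (j.1.1 - j.1.2.1 + j.1.2.2 : ℤ) - 2 * hyp j.2.1 j.2.2 / M

/-- The frequency in the first factor of the cubic convolution. -/
def slot₁ (n : ℤ × ℤ) (j : TriIdx) : Freq := (n - j.2.1, j.1.1)
/-- The frequency in the second factor of the cubic convolution. -/
def slot₂ (n : ℤ × ℤ) (j : TriIdx) : Freq := (n - j.2.1 - j.2.2, j.1.2.1)
/-- The frequency in the third factor of the cubic convolution. -/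
def slot₃ (n : ℤ × ℤ) (j : TriIdx) : Freq := (n - j.2.2, j.1.2.2)

/-- The majorant of the cubic convolution. -/
def triMaj (M : ℕ) (F G H : Freq → ℝ≥0∞) (z : Freq) : ℝ≥0∞ :=
  ∑' j, decay (phase M z.2 j) * (F (slot₁ z.1 j) * G (slot₂ z.1 j) * H (slot₃ z.1 j))

/-- The kernel depends on (m,k) only through hyp(m,k). Grouping the sum by level sets separates the
arithmetic bound D from the sum of the kernel over the levels. -/
theorem tsum_phase_mul_le {B : ℝ≥0∞} (hB : ∀ y : ℝ, ∑' l : ℤ, decay (l - y) ≤ B)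
    (M : ℕ) (hM : M ≠ 0) (y : ℝ) (G : ℤ × ℤ → ℤ × ℤ → ℝ≥0∞) (D : ℝ≥0∞)
    (hG : ∀ μ, ∑' m, ∑' k, (if hyp m k = μ then G m k else 0) ≤ D) :
    ∑' m, ∑' k, decay (y - 2 * hyp m k / M) * G m k ≤ M * B * D := by
  calc _ = ∑' m, ∑' k, ∑' μ : ℤ, decay (y - 2 * μ / M) * (if hyp m k = μ then G m k else 0) := by
        refine tsum_congr fun m => tsum_congr fun k => ?_
        rw [tsum_eq_single (hyp m k) fun μ hμ => by rw [if_neg hμ.symm, mul_zero], if_pos rfl]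
    _ = ∑' μ : ℤ, decay (y - 2 * μ / M) *
          ∑' m, ∑' k, (if hyp m k = μ then G m k else 0) := by
        simp_rw [← ENNReal.tsum_mul_left]
        rw [ENNReal.tsum_comm]
        conv_rhs => rw [ENNReal.tsum_comm]
        conv_lhs => rw [ENNReal.tsum_comm]
        refine tsum_congr fun m => ?_
        rw [ENNReal.tsum_comm]
    _ ≤ ∑' μ : ℤ, decay (y - 2 * μ / M) * D :=
        ENNReal.tsum_le_tsum fun μ => mul_le_mul_right (hG μ) _
    _ ≤ _ := by
        rw [ENNReal.tsum_mul_right]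
        gcongr
        exact tsum_decay_scaled_le hB M hM y

/-- The dual half of the trilinear estimate. The temporal weights are summed freely, since the level
set estimate is uniform in the shift y produced by the temporal frequencies. -/
theorem tsum_weights_le {B : ℝ≥0∞} (hB : ∀ y : ℝ, ∑' l : ℤ, decay (l - y) ≤ B)
    (M : ℕ) (hM : M ≠ 0) (a : ℤ × ℤ → ℝ≥0∞) (b : ℤ → ℝ≥0∞) (D : ℝ≥0∞)
    (hD : ∀ n μ, ∑' m, ∑' k, (if hyp m k = μ then a (n - m) * a (n - m - k) * a (n - k) else 0)
      ≤ D * a n) (z : Freq) :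
    ∑' j, decay (phase M z.2 j) *
      (a (slot₁ z.1 j).1 * b (slot₁ z.1 j).2 * (a (slot₂ z.1 j).1 * b (slot₂ z.1 j).2)
        * (a (slot₃ z.1 j).1 * b (slot₃ z.1 j).2))
      ≤ (∑' l, b l) ^ 3 * (M * B * D) * a z.1 := by
  rw [ENNReal.tsum_prod']
  calc _ ≤ ∑' L : ℤ × ℤ × ℤ, (b L.1 * (b L.2.1 * b L.2.2)) * (M * B * (D * a z.1)) := by
        refine ENNReal.tsum_le_tsum fun L => ?_
        rw [ENNReal.tsum_prod']
        refine le_trans (le_of_eq ?_) (mul_le_mul_right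
          (tsum_phase_mul_le hB M hM (z.2 - (L.1 - L.2.1 + L.2.2 : ℤ))
            (fun m k => a (z.1 - m) * a (z.1 - m - k) * a (z.1 - k)) _ (hD z.1)) _)
        simp_rw [← ENNReal.tsum_mul_left]
        refine tsum_congr fun m => tsum_congr fun k => ?_
        simp only [phase, slot₁, slot₂, slot₃]
        ring
    _ = _ := by
        rw [ENNReal.tsum_mul_right, ENNReal.tsum_prod']
        simp_rw [ENNReal.tsum_mul_left, ENNReal.tsum_prod', ENNReal.tsum_mul_left,
          ENNReal.tsum_mul_right]
        ring

/-- The ℓ¹ half of the trilinear estimate. Summing over the output temporal frequency removes the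
kernel. What is left is a sum over output and interaction indices, and these determine, and are
determined by, the three input frequencies, so it is at most the full product. -/
theorem tsum_triIdx_le {B : ℝ≥0∞} (hB : ∀ y : ℝ, ∑' l : ℤ, decay (l - y) ≤ B) (M : ℕ)
    (F G H : Freq → ℝ≥0∞) :
    ∑' z, triMaj M F G H z ≤ B * ((∑' z, F z) * (∑' z, G z) * ∑' z, H z) := by
  unfold triMaj
  rw [ENNReal.tsum_prod']
  calc _ ≤ ∑' n : ℤ × ℤ, ∑' j : TriIdx, B * (F (slot₁ n j) * G (slot₂ n j) * H (slot₃ n j)) := by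
        refine ENNReal.tsum_le_tsum fun n => ?_
        rw [ENNReal.tsum_comm]
        refine ENNReal.tsum_le_tsum fun j => ?_
        change ∑' l : ℤ, decay (phase M l j) * (F (slot₁ n j) * G (slot₂ n j) * H (slot₃ n j)) ≤ _
        rw [ENNReal.tsum_mul_right]
        gcongr
        refine le_trans (le_of_eq (tsum_congr fun l => ?_))
          (hB ((j.1.1 - j.1.2.1 + j.1.2.2 : ℤ) + 2 * hyp j.2.1 j.2.2 / M))
        simp only [phase]
        congr 1
        ring
    _ = B * ∑' x : (ℤ × ℤ) × TriIdx, F (slot₁ x.1 x.2) * G (slot₂ x.1 x.2) * H (slot₃ x.1 x.2) := by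
        rw [← ENNReal.tsum_mul_left]
        conv_rhs => rw [ENNReal.tsum_prod']
    _ ≤ B * ∑' y : Freq × Freq × Freq, F y.1 * G y.2.1 * H y.2.2 := by
        gcongr
        refine ENNReal.tsum_comp_le_tsum_of_injective
          (f := fun x : (ℤ × ℤ) × TriIdx => (slot₁ x.1 x.2, slot₂ x.1 x.2, slot₃ x.1 x.2)) ?_
          (fun y : Freq × Freq × Freq => F y.1 * G y.2.1 * H y.2.2)
        rintro ⟨n, ⟨l₁, l₂, l₃⟩, m, k⟩ ⟨n', ⟨l₁', l₂', l₃'⟩, m', k'⟩ h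
        simp only [slot₁, slot₂, slot₃, Prod.mk.injEq] at h
        obtain ⟨⟨h1, rfl⟩, ⟨h2, rfl⟩, h3, rfl⟩ := h
        have hk : k = k' := by
          have : n - m - (n - m - k) = n' - m' - (n' - m' - k') := by rw [h2, h1]
          simpa using this
        subst hk
        have hn : n = n' := by simpa using h3
        subst hn
        have hm : m = m' := by simpa using h1
        subst hm
        rfl
    _ = _ := by
        rw [ENNReal.tsum_prod']
        simp_rw [ENNReal.tsum_prod', ENNReal.tsum_mul_left, ENNReal.tsum_mul_right,
          ENNReal.tsum_mul_left, ENNReal.tsum_mul_right]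

/-- Insert W·W^{-1} in each factor, with W = vΛ, split the kernel as decay^{1/P}·decay^{1/Q}, and
apply Hölder in the interaction index. The factor with exponent Q is bounded by a constant times
v(n)^{-1}, which cancels the outer weight; the factor with exponent P is the cubic majorant of the
P-th powers and is summed with `tsum_triIdx_le`. -/
theorem lpn_triMaj_le {p : ℝ≥0∞} (hp0 : p ≠ 0) (hp : p ≠ ⊤) {Q : ℝ}
    (hPQ : p.toReal.HolderConjugate Q)
    {B : ℝ≥0∞} (hB : ∀ y : ℝ, ∑' l : ℤ, decay (l - y) ≤ B) (M : ℕ) (hM : M ≠ 0)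
    (v : ℤ × ℤ → ℝ≥0∞) (hv : ∀ n, v n ≠ 0) (hv' : ∀ n, v n ≠ ⊤)
    (Λ : ℤ → ℝ≥0∞) (hΛ : ∀ l, Λ l ≠ 0) (hΛ' : ∀ l, Λ l ≠ ⊤) (D : ℝ≥0∞)
    (hD : ∀ n μ, ∑' m, ∑' k, (if hyp m k = μ then
      v (n - m) ^ (-Q) * v (n - m - k) ^ (-Q) * v (n - k) ^ (-Q) else 0) ≤ D * v n ^ (-Q))
    (F G H : Freq → ℝ≥0∞) :
    lpn p (fun z => v z.1 * triMaj M F G H z) ≤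
      ((∑' l, Λ l ^ (-Q)) ^ 3 * (M * B * D)) ^ (1 / Q) * B ^ (1 / p.toReal) *
        (lpn p (fun z => v z.1 * Λ z.2 * F z) * lpn p (fun z => v z.1 * Λ z.2 * G z)
          * lpn p (fun z => v z.1 * Λ z.2 * H z)) := by
  set P := p.toReal with hP
  have hP0 : 0 < P := hPQ.pos
  have hQ0 : 0 < Q := hPQ.symm.pos
  set W : Freq → ℝ≥0∞ := fun z => v z.1 * Λ z.2 with hW
  have hW0 : ∀ z, W z ≠ 0 := fun z => mul_ne_zero (hv _) (hΛ _)
  have hWt : ∀ z, W z ≠ ⊤ := fun z => ENNReal.mul_ne_top (hv' _) (hΛ' _)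
  set A : ℝ≥0∞ := (∑' l, Λ l ^ (-Q)) ^ 3 * (M * B * D) with hA
  set f : Freq → ℝ≥0∞ := fun z => (W z * F z) ^ P
  set g : Freq → ℝ≥0∞ := fun z => (W z * G z) ^ P
  set h : Freq → ℝ≥0∞ := fun z => (W z * H z) ^ P
  have hinv : ∀ z, (W z)⁻¹ ^ Q = v z.1 ^ (-Q) * Λ z.2 ^ (-Q) := fun z => by
    rw [← ENNReal.rpow_neg_one, ← ENNReal.rpow_mul, neg_one_mul,
      ENNReal.mul_rpow_of_ne_top (hv' _) (hΛ' _)]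
  have pt : ∀ z, v z.1 * triMaj M F G H z ≤ A ^ (1 / Q) * (triMaj M f g h z) ^ (1 / P) := by
    intro z
    have e : triMaj M F G H z = ∑' j,
        (decay (phase M z.2 j) ^ (1 / P) * (W (slot₁ z.1 j) * F (slot₁ z.1 j) *
          (W (slot₂ z.1 j) * G (slot₂ z.1 j)) * (W (slot₃ z.1 j) * H (slot₃ z.1 j)))) *
        (decay (phase M z.2 j) ^ (1 / Q) * ((W (slot₁ z.1 j))⁻¹ * (W (slot₂ z.1 j))⁻¹ *
          (W (slot₃ z.1 j))⁻¹)) := by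
      unfold triMaj
      refine tsum_congr fun j => ?_
      have e1 : decay (phase M z.2 j) ^ (1 / P) * decay (phase M z.2 j) ^ (1 / Q)
          = decay (phase M z.2 j) := by
        rw [← ENNReal.rpow_add_of_nonneg _ _ (by positivity) (by positivity), one_div, one_div,
          hPQ.inv_add_inv_eq_one, ENNReal.rpow_one]
      have e2 : ∀ (w x : ℝ≥0∞), w ≠ 0 → w ≠ ⊤ → w * x * w⁻¹ = x := fun w x h0 ht => by
        rw [mul_comm w x, mul_assoc, ENNReal.mul_inv_cancel h0 ht, mul_one]
      symm
      calc _ = (decay (phase M z.2 j) ^ (1 / P) * decay (phase M z.2 j) ^ (1 / Q)) *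
            (W (slot₁ z.1 j) * F (slot₁ z.1 j) * (W (slot₁ z.1 j))⁻¹ *
            (W (slot₂ z.1 j) * G (slot₂ z.1 j) * (W (slot₂ z.1 j))⁻¹) *
            (W (slot₃ z.1 j) * H (slot₃ z.1 j) * (W (slot₃ z.1 j))⁻¹)) := by ring
        _ = _ := by
            rw [e1, e2 _ _ (hW0 _) (hWt _), e2 _ _ (hW0 _) (hWt _), e2 _ _ (hW0 _) (hWt _)]
    rw [e]
    calc _ ≤ v z.1 * (_ * _) := mul_le_mul_right (tsum_mul_le_Lp_mul_Lq _ _ hPQ) _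
      _ ≤ v z.1 * ((triMaj M f g h z) ^ (1 / P) * (A * v z.1 ^ (-Q)) ^ (1 / Q)) := by
          gcongr
          · refine le_of_eq (tsum_congr fun j => ?_)
            simp only [ENNReal.mul_rpow_of_nonneg _ _ hP0.le, ← ENNReal.rpow_mul,
              one_div_mul_cancel hP0.ne', ENNReal.rpow_one, f, g, h]
          · refine le_trans (le_of_eq (tsum_congr fun j => ?_)) (tsum_weights_le hB M hM
              (fun n => v n ^ (-Q)) (fun l => Λ l ^ (-Q)) D hD z)
            simp only [ENNReal.mul_rpow_of_nonneg _ _ hQ0.le, ← ENNReal.rpow_mul,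
              one_div_mul_cancel hQ0.ne', ENNReal.rpow_one, hinv]
      _ = _ := by
          rw [ENNReal.mul_rpow_of_nonneg _ _ (by positivity : 0 ≤ 1 / Q), ← ENNReal.rpow_mul,
            neg_mul, mul_one_div_cancel hQ0.ne', ENNReal.rpow_neg_one]
          calc _ = (v z.1 * (v z.1)⁻¹) * (A ^ (1 / Q) * (triMaj M f g h z) ^ (1 / P)) := by ring
            _ = _ := by rw [ENNReal.mul_inv_cancel (hv _) (hv' _), one_mul]
  calc _ ≤ lpn p (fun z => A ^ (1 / Q) * (triMaj M f g h z) ^ (1 / P)) := lpn_mono pt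
    _ = A ^ (1 / Q) * (∑' z, triMaj M f g h z) ^ (1 / P) := by
        rw [lpn_const_mul hp0 hp, lpn_eq hp0 hp]
        simp_rw [← ENNReal.rpow_mul, ← hP, one_div_mul_cancel hP0.ne', ENNReal.rpow_one]
    _ ≤ A ^ (1 / Q) * (B * ((∑' z, f z) * (∑' z, g z) * ∑' z, h z)) ^ (1 / P) := by
        gcongr
        exact tsum_triIdx_le hB M f g h
    _ = _ := by
        simp only [lpn_eq hp0 hp, ENNReal.mul_rpow_of_nonneg _ _ (by positivity : 0 ≤ 1 / P)]
        simp only [f, g, h, W, ← hP]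
        ring

/-! ## A temporal cutoff and its Fourier transform -/

/-- A smooth cutoff, equal to `1` on `[-2, 2]` and supported in `[-3, 3]`. -/
def cutoffBump : ContDiffBump (0 : ℝ) := ⟨2, 3, by norm_num, by norm_num⟩

/-- The cutoff as a Schwartz function. -/
def cutoff : SchwartzMap ℝ ℂ :=
  HasCompactSupport.toSchwartzMap (f := fun t => (cutoffBump t : ℂ))
    (cutoffBump.hasCompactSupport.comp_left Complex.ofReal_zero)
    (Complex.ofRealCLM.contDiff.comp cutoffBump.contDiff)

theorem cutoff_apply (t : ℝ) : cutoff t = (cutoffBump t : ℂ) := rfl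

/-- The Fourier transform `(2π)⁻¹ ∫ θ(t) e^{-iξt} dt` of the cutoff. -/
def cutoffHat (ξ : ℝ) : ℂ :=
  ((2 * Real.pi)⁻¹ : ℝ) • ∫ t : ℝ, Complex.exp (-(Complex.I * ξ * t)) * cutoff t

/-- The cutoff is a Schwartz function, so its Fourier transform has quadratic decay; the two
normalizations differ by the dilation by 2π. -/
theorem exists_cutoffHat_le : ∃ C : ℝ, 0 < C ∧ ∀ ξ, ‖cutoffHat ξ‖ ≤ C * (1 / (1 + ξ ^ 2)) := by
  set g : SchwartzMap ℝ ℂ := FourierTransform.fourier cutoff with hg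
  obtain ⟨C₀, hC₀, h0⟩ := g.decay 0 0
  obtain ⟨C₂, hC₂, h2⟩ := g.decay 2 0
  simp only [norm_iteratedFDeriv_zero, pow_zero, one_mul] at h0 h2
  have e : ∀ ξ, cutoffHat ξ = ((2 * Real.pi)⁻¹ : ℝ) • g (ξ / (2 * Real.pi)) := by
    intro ξ
    rw [hg, SchwartzMap.fourier_coe, Real.fourier_eq', cutoffHat]
    congr 2
    ext t
    rw [smul_eq_mul]
    congr 2
    have := Real.pi_ne_zero
    simp only [RCLike.inner_apply, conj_trivial]
    push_cast
    field_simp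
  have hpi := Real.pi_pos
  refine ⟨(2 * Real.pi)⁻¹ * (C₀ + C₂ * (2 * Real.pi) ^ 2), by positivity, fun ξ => ?_⟩
  rw [e, norm_smul, Real.norm_of_nonneg (by positivity), mul_assoc]
  refine mul_le_mul_of_nonneg_left ?_ (by positivity)
  rw [mul_one_div, le_div_iff₀ (by positivity)]
  have h3 := h2 (ξ / (2 * Real.pi))
  have h4 := h0 (ξ / (2 * Real.pi))
  rw [Real.norm_eq_abs, sq_abs, div_pow, div_mul_eq_mul_div, div_le_iff₀ (by positivity)] at h3
  nlinarith

theorem exists_cutoffHat_enorm_le :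
    ∃ C : ℝ≥0∞, C ≠ ⊤ ∧ ∀ ξ, ‖cutoffHat ξ‖ₑ ≤ C * decay ξ := by
  obtain ⟨C, hC, h⟩ := exists_cutoffHat_le
  refine ⟨ENNReal.ofReal C, by simp, fun ξ => ?_⟩
  rw [decay, ← ENNReal.ofReal_mul hC.le, ← ofReal_norm]
  exact ENNReal.ofReal_le_ofReal (h ξ)

theorem summable_cutoffHat (ν : ℝ) : Summable fun k : ℤ => ‖cutoffHat (k - ν)‖ := by
  obtain ⟨C, hC, h⟩ := exists_cutoffHat_le
  obtain ⟨B, hB, h'⟩ := exists_tsum_decay_le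
  have : Summable fun k : ℤ => 1 / (1 + ((k : ℝ) - ν) ^ 2) := by
    have := ENNReal.summable_toReal (ne_top_of_le_ne_top hB (h' ν))
    refine this.congr fun k => ?_
    rw [decay, ENNReal.toReal_ofReal (by positivity)]
  exact Summable.of_nonneg_of_le (fun _ => norm_nonneg _) (fun k => h _) (this.mul_left C)

/-- The cutoff is supported in [-3,3] ⊂ (-π,π), so cutoff·e^{iνt} extends 2π-periodically with
Fourier coefficients `cutoffHat (k - ν)`. Where the cutoff equals 1, this writes an arbitrary real
frequency ν in terms of integer ones, with coefficients concentrated near ν. -/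
theorem hasSum_cutoffHat (ν t : ℝ) (ht : |t| ≤ 2) :
    HasSum (fun k : ℤ => cutoffHat (k - ν) * Complex.exp (Complex.I * k * t))
      (Complex.exp (Complex.I * ν * t)) := by
  have hpi := Real.pi_gt_three
  have : Fact (0 < 2 * Real.pi) := ⟨by positivity⟩
  set g : ℝ → ℂ := fun t => cutoff t * Complex.exp (Complex.I * ν * t) with hg
  have hzero : ∀ t : ℝ, 3 ≤ |t| → cutoff t = 0 := by
    intro t ht
    rw [cutoff_apply, cutoffBump.zero_of_le_dist (by simpa [cutoffBump] using ht)]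
    simp
  have hgc : Continuous g := cutoff.continuous.mul (by fun_prop)
  have hends : -Real.pi + 2 * Real.pi = Real.pi := by ring
  have hG : Continuous (AddCircle.liftIco (2 * Real.pi) (-Real.pi) g) := by
    refine AddCircle.liftIco_continuous ?_ hgc.continuousOn
    simp only [hg]
    rw [hends, hzero, hzero, zero_mul, zero_mul]
    · rw [abs_of_pos (by linarith)]; linarith
    · rw [abs_neg, abs_of_pos (by linarith)]; linarith
  set G : C(AddCircle (2 * Real.pi), ℂ) := ⟨_, hG⟩ with hGdef
  have hcoeff : ∀ k : ℤ, _root_.fourierCoeff G k = cutoffHat (k - ν) := by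
    intro k
    rw [fourierCoeff_eq_intervalIntegral _ _ (-Real.pi), cutoffHat, one_div]
    congr 1
    rw [hends]
    have e1 : ∫ t : ℝ, Complex.exp (-(Complex.I * (k - ν : ℝ) * t)) * cutoff t
        = ∫ t in (-Real.pi)..Real.pi, Complex.exp (-(Complex.I * (k - ν : ℝ) * t)) * cutoff t := by
      rw [intervalIntegral.integral_of_le (by linarith)]
      refine (setIntegral_eq_integral_of_forall_compl_eq_zero fun t ht => ?_).symm
      rw [hzero t, mul_zero]
      by_contra! h
      rw [abs_lt] at h
      exact ht ⟨by linarith, by linarith⟩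
    rw [e1]
    refine intervalIntegral.integral_congr_Ioo_of_le (by linarith) fun x hx => ?_
    have hx' : x ∈ Ico (-Real.pi) (-Real.pi + 2 * Real.pi) := by
      rw [hends]; exact Ioo_subset_Ico_self hx
    simp only [hGdef, ContinuousMap.coe_mk, smul_eq_mul]
    rw [AddCircle.liftIco_coe_apply hx', fourier_coe_apply, hg]
    dsimp only
    rw [mul_left_comm, ← Complex.exp_add, mul_comm]
    congr 2
    have : (Real.pi : ℂ) ≠ 0 := by exact_mod_cast Real.pi_ne_zero
    push_cast
    field_simp
    ring
  have hsum : Summable (_root_.fourierCoeff G) := by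
    refine Summable.of_norm ?_
    simpa only [hcoeff] using summable_cutoffHat ν
  have key := has_pointwise_sum_fourier_series_of_summable hsum (t : AddCircle (2 * Real.pi))
  have ht' : t ∈ Ico (-Real.pi) (-Real.pi + 2 * Real.pi) := by
    rw [abs_le] at ht
    constructor <;> linarith
  have hval : G (t : AddCircle (2 * Real.pi)) = Complex.exp (Complex.I * ν * t) := by
    simp only [hGdef, ContinuousMap.coe_mk]
    rw [AddCircle.liftIco_coe_apply ht', hg]
    dsimp only
    rw [cutoff_apply, cutoffBump.one_of_mem_closedBall (by simpa [cutoffBump] using ht)]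
    simp
  rw [hval] at key
  convert key using 2 with k
  rw [hcoeff, fourier_coe_apply, smul_eq_mul]
  congr 2
  have : (Real.pi : ℂ) ≠ 0 := by exact_mod_cast Real.pi_ne_zero
  push_cast
  field_simp

/-! ## The Duhamel formulation on the frequency side -/

/-- The temporal frequencies are half-integers. -/
def lam (l : ℤ) : ℝ := l + 1 / 2

/-- This is the purpose of the shift by 1/2: no temporal frequency vanishes, so integration in time
is division by iλ. The shift is compatible with the cubic term, since λ₁ - λ₂ + λ₃ is again a
half-integer; the offset therefore cancels in `phase`. -/
theorem lam_ne_zero (l : ℤ) : lam l ≠ 0 := by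
  unfold lam
  intro h
  have : (2 * l + 1 : ℝ) = 0 := by linarith
  have : (2 * l + 1 : ℤ) = 0 := by exact_mod_cast this
  omega

/-- The temporal weight. -/
def lamW (l : ℤ) : ℝ≥0∞ := ‖lam l‖ₑ

theorem lamW_ne_zero (l : ℤ) : lamW l ≠ 0 := by simpa [lamW] using lam_ne_zero l

theorem lamW_ne_top (l : ℤ) : lamW l ≠ ⊤ := by simp [lamW]

theorem natAbs_succ_le_four_mul_abs_lam (l : ℤ) : ((l.natAbs + 1 : ℕ) : ℝ) ≤ 4 * |lam l| := by
  have h5 : ((l.natAbs : ℕ) : ℝ) = |(l : ℝ)| := by rw [Nat.cast_natAbs]; simp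
  push_cast
  rw [h5]
  unfold lam
  rcases le_or_gt 0 l with h | h
  · have : (0 : ℝ) ≤ l := by exact_mod_cast h
    rw [abs_of_nonneg this, abs_of_nonneg (by linarith)]
    linarith
  · have : (l : ℝ) ≤ -1 := by exact_mod_cast (by omega : l ≤ -1)
    rw [abs_of_neg (by linarith), abs_of_neg (by linarith)]
    linarith

theorem natAbs_succ_le_four_mul_lamW (l : ℤ) : ((l.natAbs + 1 : ℕ) : ℝ≥0∞) ≤ 4 * lamW l := by
  have := ENNReal.ofReal_le_ofReal (natAbs_succ_le_four_mul_abs_lam l)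
  rw [ENNReal.ofReal_natCast, ENNReal.ofReal_mul (by norm_num), ← Real.norm_eq_abs,
    ofReal_norm] at this
  simpa [lamW] using this

theorem tsum_lamW_ne_top {Q : ℝ} (hQ : 1 < Q) : ∑' l, lamW l ^ (-Q) ≠ ⊤ := by
  have h1 := tsum_pw_natAbs_succ_ne_top hQ
  have h4 : (4 : ℝ≥0∞) ^ Q ≠ ⊤ := ENNReal.rpow_ne_top_of_nonneg (by linarith) (by simp)
  refine ne_top_of_le_ne_top (b := 4 ^ Q * ∑' a : ℤ, pw Q (a.natAbs + 1)) (by finiteness) ?_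
  rw [← ENNReal.tsum_mul_left]
  refine ENNReal.tsum_le_tsum fun l => ?_
  have h2 := ENNReal.rpow_le_rpow (natAbs_succ_le_four_mul_lamW l) (by linarith : 0 ≤ Q)
  rw [ENNReal.mul_rpow_of_nonneg _ _ (by linarith : 0 ≤ Q)] at h2
  unfold pw
  rw [ENNReal.rpow_neg, ENNReal.rpow_neg, ENNReal.inv_le_iff_inv_le,
    ENNReal.mul_inv (by simp) (by simp), inv_inv, mul_comm, ← div_eq_mul_inv]
  exact ENNReal.div_le_of_le_mul ((h2.trans_eq (mul_comm _ _)))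

/-- The norm `‖v(n) λ_l A(n, l)‖_{ℓ^p}`. -/
def xn (p : ℝ≥0∞) (v : ℤ × ℤ → ℝ≥0∞) (A : Freq → ℂ) : ℝ≥0∞ :=
  lpn p fun z => v z.1 * lamW z.2 * ‖A z‖ₑ

/-- The cubic convolution, at time scale `1 / M`. -/
def cubicConv (M : ℕ) (A B C : Freq → ℂ) (z : Freq) : ℂ :=
  ∑' j : TriIdx, cutoffHat (phase M z.2 j) *
    (A (slot₁ z.1 j) * (starRingEnd ℂ) (B (slot₂ z.1 j)) * C (slot₃ z.1 j))

/-- The time integral `∫₀ᵗ`, cut off in time. -/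
def duhamel (F : Freq → ℂ) (z : Freq) : ℂ :=
  F z / (Complex.I * lam z.2) - cutoffHat (lam z.2) * ∑' m : ℤ, F (z.1, m) / (Complex.I * lam m)

/-- The Picard map. -/
def picard (M : ℕ) (a : ℤ × ℤ → ℂ) (A : Freq → ℂ) (z : Freq) : ℂ :=
  cutoffHat (lam z.2) * a z.1 + Complex.I / M * duhamel (cubicConv M A A A) z

theorem tsum_enorm_cubicConv_le {c : ℝ≥0∞} (hc : ∀ ξ, ‖cutoffHat ξ‖ₑ ≤ c * decay ξ)
    (M : ℕ) (A B C : Freq → ℂ) (z : Freq) :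
    ∑' j : TriIdx, ‖cutoffHat (phase M z.2 j) *
      (A (slot₁ z.1 j) * (starRingEnd ℂ) (B (slot₂ z.1 j)) * C (slot₃ z.1 j))‖ₑ ≤
      c * triMaj M (fun z => ‖A z‖ₑ) (fun z => ‖B z‖ₑ) (fun z => ‖C z‖ₑ) z := by
  unfold triMaj
  rw [← ENNReal.tsum_mul_left]
  refine ENNReal.tsum_le_tsum fun j => ?_
  rw [enorm_mul, enorm_mul, enorm_mul]
  have e : ‖(starRingEnd ℂ) (B (slot₂ z.1 j))‖ₑ = ‖B (slot₂ z.1 j)‖ₑ := by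
    rw [← ofReal_norm, ← ofReal_norm, RCLike.norm_conj]
  rw [e]
  exact (mul_le_mul_left (hc _) _).trans_eq (mul_assoc _ _ _)

/-- Quadratic decay of the transform leaves 1/|λ|, which lies in ℓ^p because p > 1. -/
theorem exists_lpn_cutoff {p : ℝ≥0∞} (hp1 : 1 < p) (hp : p ≠ ⊤) :
    lpn p (fun l : ℤ => lamW l * ‖cutoffHat (lam l)‖ₑ) ≠ ⊤ := by
  obtain ⟨c, hc, h⟩ := exists_cutoffHat_enorm_le
  have hP : 1 < p.toReal := by
    simpa using (ENNReal.toReal_lt_toReal (by simp) hp).2 hp1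
  have h1 := tsum_lamW_ne_top hP
  have hc' : c ^ p.toReal ≠ ⊤ := ENNReal.rpow_ne_top_of_nonneg (by linarith) hc
  rw [lpn_eq (by positivity) hp]
  refine ENNReal.rpow_ne_top_of_nonneg (by positivity) ?_
  refine ne_top_of_le_ne_top (b := c ^ p.toReal * ∑' l, lamW l ^ (-p.toReal)) (by finiteness) ?_
  rw [← ENNReal.tsum_mul_left]
  refine ENNReal.tsum_le_tsum fun l => ?_
  have h2 : lamW l * ‖cutoffHat (lam l)‖ₑ ≤ c * (lamW l)⁻¹ := by
    have h3 : decay (lam l) ≤ (lamW l)⁻¹ * (lamW l)⁻¹ := by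
      unfold decay lamW
      have hl : 0 < |lam l| := abs_pos.2 (lam_ne_zero l)
      rw [← ofReal_norm, Real.norm_eq_abs, ← ENNReal.ofReal_inv_of_pos hl,
        ← ENNReal.ofReal_mul (by positivity)]
      refine ENNReal.ofReal_le_ofReal ?_
      rw [one_div, ← mul_inv, abs_mul_abs_self]
      have := mul_self_pos.2 (lam_ne_zero l)
      gcongr
      nlinarith
    calc lamW l * ‖cutoffHat (lam l)‖ₑ ≤ lamW l * (c * ((lamW l)⁻¹ * (lamW l)⁻¹)) := by
          gcongr
          exact (h _).trans (mul_le_mul_right h3 _)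
      _ = (lamW l * (lamW l)⁻¹) * (c * (lamW l)⁻¹) := by ring
      _ = _ := by rw [ENNReal.mul_inv_cancel (lamW_ne_zero l) (lamW_ne_top l), one_mul]
  refine (ENNReal.rpow_le_rpow h2 (by linarith)).trans (le_of_eq ?_)
  rw [ENNReal.mul_rpow_of_nonneg _ _ (by linarith), ← ENNReal.rpow_neg_one, ← ENNReal.rpow_mul,
    neg_one_mul]

theorem lpn_tensor {p : ℝ≥0∞} (hp0 : p ≠ 0) (hp : p ≠ ⊤) (f : ℤ × ℤ → ℝ≥0∞) (g : ℤ → ℝ≥0∞) :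
    lpn p (fun z : Freq => f z.1 * g z.2) = lpn p f * lpn p g := by
  have hP := ENNReal.toReal_pos hp0 hp
  simp only [lpn_eq hp0 hp, ENNReal.mul_rpow_of_nonneg _ _ hP.le]
  rw [ENNReal.tsum_prod']
  simp_rw [ENNReal.tsum_mul_left, ENNReal.tsum_mul_right]
  rw [ENNReal.mul_rpow_of_nonneg _ _ (by positivity)]

theorem xn_data {p : ℝ≥0∞} (hp0 : p ≠ 0) (hp : p ≠ ⊤) (v : ℤ × ℤ → ℝ≥0∞) (a : ℤ × ℤ → ℂ) :
    xn p v (fun z => cutoffHat (lam z.2) * a z.1) =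
      lpn p (fun l : ℤ => lamW l * ‖cutoffHat (lam l)‖ₑ) * lpn p (fun n => v n * ‖a n‖ₑ) := by
  rw [mul_comm, ← lpn_tensor hp0 hp]
  unfold xn
  congr 1
  ext z
  rw [enorm_mul]
  ring

/-- Hölder's inequality in the temporal frequency. -/
theorem tsum_div_lamW_le {p : ℝ≥0∞} {Q : ℝ} (hPQ : p.toReal.HolderConjugate Q)
    (F : ℤ → ℝ≥0∞) :
    ∑' m, F m / lamW m ≤ (∑' m, F m ^ p.toReal) ^ (1 / p.toReal)
      * (∑' l, lamW l ^ (-Q)) ^ (1 / Q) := by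
  refine le_trans (le_of_eq ?_) ((tsum_mul_le_Lp_mul_Lq F (fun l => (lamW l)⁻¹) hPQ).trans
    (le_of_eq ?_))
  · simp_rw [div_eq_mul_inv]
  · congr 3
    ext l
    rw [← ENNReal.rpow_neg_one, ← ENNReal.rpow_mul, neg_one_mul]

theorem lpn_fiber {p : ℝ≥0∞} (hp0 : p ≠ 0) (hp : p ≠ ⊤) (F : Freq → ℝ≥0∞) :
    lpn p (fun n : ℤ × ℤ => (∑' m, F (n, m) ^ p.toReal) ^ (1 / p.toReal)) = lpn p F := by
  have hP := ENNReal.toReal_pos hp0 hp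
  rw [lpn_eq hp0 hp, lpn_eq hp0 hp]
  conv_rhs => rw [ENNReal.tsum_prod']
  simp_rw [← ENNReal.rpow_mul, one_div_mul_cancel hP.ne', ENNReal.rpow_one]

theorem enorm_duhamel_le (F : Freq → ℂ) (z : Freq) :
    ‖duhamel F z‖ₑ ≤ ‖F z‖ₑ / lamW z.2 + ‖cutoffHat (lam z.2)‖ₑ * ∑' m, ‖F (z.1, m)‖ₑ / lamW m := by
  have e : ∀ (w : ℂ) (m : ℤ), ‖w / (Complex.I * lam m)‖ₑ = ‖w‖ₑ / lamW m := by
    intro w m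
    have h0 := lam_ne_zero m
    rw [div_eq_mul_inv, enorm_mul, enorm_inv (by simp [h0]), enorm_mul, lamW, div_eq_mul_inv]
    simp [← ofReal_norm]
  unfold duhamel
  refine (enorm_sub_le).trans ?_
  rw [e, enorm_mul]
  gcongr
  refine enorm_tsum_le_tsum_enorm.trans ?_
  simp_rw [e]
  exact le_rfl

/-- Division by iλ cancels the temporal weight in the first term. The second term subtracts the
value of the antiderivative at t = 0, multiplied by a representation of the constant 1; that value
is bounded by Hölder, using 1/λ ∈ ℓ^Q. -/
theorem xn_duhamel_le {p : ℝ≥0∞} (hp1 : 1 ≤ p) (hp : p ≠ ⊤) {Q : ℝ}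
    (hPQ : p.toReal.HolderConjugate Q) (v : ℤ × ℤ → ℝ≥0∞) (F : Freq → ℂ) :
    xn p v (duhamel F) ≤ (1 + lpn p (fun l : ℤ => lamW l * ‖cutoffHat (lam l)‖ₑ) *
      (∑' l, lamW l ^ (-Q)) ^ (1 / Q)) * lpn p (fun z => v z.1 * ‖F z‖ₑ) := by
  have hp0 : p ≠ 0 := (zero_lt_one.trans_le hp1).ne'
  have hP := ENNReal.toReal_pos hp0 hp
  set S := (∑' l, lamW l ^ (-Q)) ^ (1 / Q)
  calc xn p v (duhamel F) ≤ lpn p (fun z => v z.1 * ‖F z‖ₑ +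
        S * ((∑' m, (v z.1 * ‖F (z.1, m)‖ₑ) ^ p.toReal) ^ (1 / p.toReal) *
          (lamW z.2 * ‖cutoffHat (lam z.2)‖ₑ))) := by
        refine lpn_mono fun z => ?_
        calc _ ≤ v z.1 * lamW z.2 * _ := mul_le_mul_right (enorm_duhamel_le F z) _
          _ = v z.1 * ‖F z‖ₑ * (lamW z.2 * (lamW z.2)⁻¹) + (lamW z.2 * ‖cutoffHat (lam z.2)‖ₑ) *
                ∑' m, v z.1 * ‖F (z.1, m)‖ₑ / lamW m := by
              simp_rw [mul_div_assoc]
              rw [ENNReal.tsum_mul_left, div_eq_mul_inv]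
              ring
          _ ≤ v z.1 * ‖F z‖ₑ + (lamW z.2 * ‖cutoffHat (lam z.2)‖ₑ) *
                ((∑' m, (v z.1 * ‖F (z.1, m)‖ₑ) ^ p.toReal) ^ (1 / p.toReal) * S) := by
              rw [ENNReal.mul_inv_cancel (lamW_ne_zero _) (lamW_ne_top _), mul_one]
              gcongr
              exact tsum_div_lamW_le hPQ _
          _ = _ := by ring
    _ ≤ _ := (lpn_add_le hp1 _ _)
    _ = _ := by
        rw [lpn_const_mul hp0 hp, lpn_tensor hp0 hp
          (fun n => (∑' m, (v n * ‖F (n, m)‖ₑ) ^ p.toReal) ^ (1 / p.toReal))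
          (fun l => lamW l * ‖cutoffHat (lam l)‖ₑ),
          lpn_fiber hp0 hp (fun z => v z.1 * ‖F z‖ₑ)]
        ring

/-- A weight submultiplicative along interactions can be distributed over the three factors at no
cost. All estimates thus hold with γ inserted and with constants independent of γ, which is what
preserves smoothness up to the common time. -/
theorem mul_triMaj_le (M : ℕ) (γ : ℤ × ℤ → ℝ≥0∞)
    (hγ : ∀ n m k, γ n ≤ γ (n - m) * γ (n - m - k) * γ (n - k)) (F G H : Freq → ℝ≥0∞) (z : Freq) :
    γ z.1 * triMaj M F G H z ≤ triMaj M (fun z => γ z.1 * F z) (fun z => γ z.1 * G z)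
      (fun z => γ z.1 * H z) z := by
  unfold triMaj
  rw [← ENNReal.tsum_mul_left]
  refine ENNReal.tsum_le_tsum fun j => ?_
  calc _ = γ z.1 * (decay (phase M z.2 j) *
        (F (slot₁ z.1 j) * G (slot₂ z.1 j) * H (slot₃ z.1 j))) := rfl
    _ ≤ (γ (z.1 - j.2.1) * γ (z.1 - j.2.1 - j.2.2) * γ (z.1 - j.2.2)) * _ :=
        mul_le_mul_left (hγ _ _ _) _
    _ = _ := by
        simp only [slot₁, slot₂, slot₃]
        ring

/-- The weight `⟨n⟩^s`. -/
def brW (s : ℝ) (n : ℤ × ℤ) : ℝ≥0∞ := ENNReal.ofReal (japaneseBracket n ^ s)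

/-! ### Comparison of ⟨n⟩ with 1 + |n|. -/

theorem one_le_japaneseBracket (n : ℤ × ℤ) : 1 ≤ japaneseBracket n := by
  unfold japaneseBracket
  rw [Real.one_le_sqrt]
  nlinarith [sq_nonneg (n.1 : ℝ), sq_nonneg (n.2 : ℝ)]

theorem brW_eq (s : ℝ) (n : ℤ × ℤ) : brW s n = ENNReal.ofReal (japaneseBracket n) ^ s := by
  rw [brW, ENNReal.ofReal_rpow_of_pos (zero_lt_one.trans_le (one_le_japaneseBracket n))]

theorem brW_ne_zero (s : ℝ) (n : ℤ × ℤ) : brW s n ≠ 0 := by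
  have := Real.rpow_pos_of_pos (zero_lt_one.trans_le (one_le_japaneseBracket n)) s
  simpa [brW] using this

theorem brW_ne_top (s : ℝ) (n : ℤ × ℤ) : brW s n ≠ ⊤ := by simp [brW]

theorem cast_sz (n : ℤ × ℤ) : (sz n : ℝ) = max |(n.1 : ℝ)| |(n.2 : ℝ)| := by
  unfold sz
  rw [Nat.cast_max, Nat.cast_natAbs, Nat.cast_natAbs]
  simp

theorem sz_succ_le_two_mul_japaneseBracket (n : ℤ × ℤ) :
    ((sz n + 1 : ℕ) : ℝ) ≤ 2 * japaneseBracket n := by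
  have h1 := one_le_japaneseBracket n
  have h2 : (sz n : ℝ) ≤ japaneseBracket n := by
    rw [cast_sz]
    refine max_le ?_ ?_ <;> rw [← Real.sqrt_sq_eq_abs] <;> refine Real.sqrt_le_sqrt ?_ <;>
      nlinarith [sq_nonneg (n.1 : ℝ), sq_nonneg (n.2 : ℝ)]
  push_cast
  linarith

theorem japaneseBracket_le_two_mul_sz_succ (n : ℤ × ℤ) :
    japaneseBracket n ≤ 2 * ((sz n + 1 : ℕ) : ℝ) := by
  push_cast
  have h0 : (0 : ℝ) ≤ sz n := Nat.cast_nonneg _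
  unfold japaneseBracket
  rw [Real.sqrt_le_left (by positivity)]
  have h1 : |(n.1 : ℝ)| ≤ sz n := by rw [cast_sz]; exact le_max_left _ _
  have h2 : |(n.2 : ℝ)| ≤ sz n := by rw [cast_sz]; exact le_max_right _ _
  have h3 := sq_le_sq' (by linarith [abs_nonneg (n.1 : ℝ)]) h1
  have h4 := sq_le_sq' (by linarith [abs_nonneg (n.2 : ℝ)]) h2
  rw [sq_abs] at h3 h4
  nlinarith

theorem brW_rpow_le (s : ℝ) {Q : ℝ} (h : 0 ≤ s * Q) (n : ℤ × ℤ) :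
    brW s n ^ (-Q) ≤ 2 ^ (s * Q) * wt (s * Q) n := by
  have h2 : ((sz n + 1 : ℕ) : ℝ≥0∞) ≤ 2 * ENNReal.ofReal (japaneseBracket n) := by
    have := ENNReal.ofReal_le_ofReal (sz_succ_le_two_mul_japaneseBracket n)
    rw [ENNReal.ofReal_natCast, ENNReal.ofReal_mul (by norm_num)] at this
    simpa using this
  have h4 : (2 : ℝ≥0∞) ^ (s * Q) ≠ ⊤ := ENNReal.rpow_ne_top_of_nonneg h (by simp)
  have h3 := ENNReal.rpow_le_rpow h2 h
  rw [ENNReal.mul_rpow_of_nonneg _ _ h] at h3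
  rw [brW_eq, ← ENNReal.rpow_mul, mul_neg]
  unfold wt pw
  rw [ENNReal.rpow_neg, ENNReal.rpow_neg, ENNReal.inv_le_iff_inv_le,
    ENNReal.mul_inv (by simp) (by simp), inv_inv, mul_comm, ← div_eq_mul_inv]
  exact ENNReal.div_le_of_le_mul ((h3.trans_eq (mul_comm _ _)))

theorem wt_le_brW_rpow (s : ℝ) {Q : ℝ} (h : 0 ≤ s * Q) (n : ℤ × ℤ) :
    wt (s * Q) n ≤ 2 ^ (s * Q) * brW s n ^ (-Q) := by
  have h2 : ENNReal.ofReal (japaneseBracket n) ≤ 2 * ((sz n + 1 : ℕ) : ℝ≥0∞) := by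
    have := ENNReal.ofReal_le_ofReal (japaneseBracket_le_two_mul_sz_succ n)
    rw [ENNReal.ofReal_mul (by norm_num), ENNReal.ofReal_natCast] at this
    simpa using this
  have h4 : (2 : ℝ≥0∞) ^ (s * Q) ≠ ⊤ := ENNReal.rpow_ne_top_of_nonneg h (by simp)
  have h3 := ENNReal.rpow_le_rpow h2 h
  rw [ENNReal.mul_rpow_of_nonneg _ _ h] at h3
  rw [brW_eq, ← ENNReal.rpow_mul, mul_neg]
  unfold wt pw
  rw [ENNReal.rpow_neg, ENNReal.rpow_neg, ENNReal.inv_le_iff_inv_le,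
    ENNReal.mul_inv (by simp) (by simp), inv_inv, mul_comm, ← div_eq_mul_inv]
  exact ENNReal.div_le_of_le_mul ((h3.trans_eq (mul_comm _ _)))

theorem exists_level_set_brW {s Q : ℝ} (h : 1 < s * Q) :
    ∃ D : ℝ≥0∞, D ≠ ⊤ ∧ ∀ (n : ℤ × ℤ) (μ : ℤ), ∑' m, ∑' k, (if hyp m k = μ then
      brW s (n - m) ^ (-Q) * brW s (n - m - k) ^ (-Q) * brW s (n - k) ^ (-Q) else 0)
        ≤ D * brW s n ^ (-Q) := by
  obtain ⟨C, hC, hls⟩ := exists_tsum_level_set_le h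
  set c : ℝ≥0∞ := 2 ^ (s * Q) with hc
  have h0 : 0 ≤ s * Q := by linarith
  have hc' : c ≠ ⊤ := ENNReal.rpow_ne_top_of_nonneg h0 (by simp)
  refine ⟨c ^ 3 * C * c, by finiteness, fun n μ => ?_⟩
  calc _ ≤ ∑' m, ∑' k, c ^ 3 * (if hyp m k = μ then
        wt (s * Q) (n - m) * wt (s * Q) (n - m - k) * wt (s * Q) (n - k) else 0) := by
        refine ENNReal.tsum_le_tsum fun m => ENNReal.tsum_le_tsum fun k => ?_
        split_ifs
        · calc _ ≤ (c * wt (s * Q) (n - m)) * (c * wt (s * Q) (n - m - k)) *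
                (c * wt (s * Q) (n - k)) := by gcongr <;> exact brW_rpow_le s h0 _
            _ = _ := by ring
        · simp
    _ ≤ c ^ 3 * (C * (c * brW s n ^ (-Q))) := by
        simp_rw [ENNReal.tsum_mul_left]
        gcongr
        exact (hls n μ).trans (mul_le_mul_right (wt_le_brW_rpow s h0 n) _)
    _ = _ := by ring

/-! ## Solving the Duhamel equation -/

theorem le_lpn {ι : Type*} [MeasurableSpace ι] [MeasurableSingletonClass ι] {p : ℝ≥0∞}
    (h0 : p ≠ 0) (h : p ≠ ⊤) (F : ι → ℝ≥0∞) (z : ι) : F z ≤ lpn p F := by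
  have hP := ENNReal.toReal_pos h0 h
  rw [← ENNReal.rpow_le_rpow_iff hP, lpn_rpow h0 h]
  exact ENNReal.le_tsum (f := fun z => F z ^ p.toReal) z

/-- Fatou's lemma for counting measure, proved on finite partial sums. -/
theorem lpn_le_of_tendsto {ι : Type*} [MeasurableSpace ι] [MeasurableSingletonClass ι]
    {p : ℝ≥0∞} (h0 : p ≠ 0) (h : p ≠ ⊤) {F : ℕ → ι → ℝ≥0∞} {G : ι → ℝ≥0∞} {r : ℝ≥0∞}
    (hF : ∀ k, lpn p (F k) ≤ r) (hlim : ∀ z, Tendsto (fun k => F k z) atTop (𝓝 (G z))) :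
    lpn p G ≤ r := by
  have hP := ENNReal.toReal_pos h0 h
  rw [← ENNReal.rpow_le_rpow_iff hP, lpn_rpow h0 h, ENNReal.tsum_eq_iSup_sum]
  refine iSup_le fun S => ?_
  refine le_of_tendsto' (tendsto_finsetSum S fun z _ =>
    (ENNReal.continuous_rpow_const.tendsto _).comp (hlim z)) fun k => ?_
  calc _ ≤ ∑' z, F k z ^ p.toReal := ENNReal.sum_le_tsum S
    _ = lpn p (F k) ^ p.toReal := (lpn_rpow h0 h _).symm
    _ ≤ _ := ENNReal.rpow_le_rpow (hF k) hP.le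

theorem xn_add_le {p : ℝ≥0∞} (hp : 1 ≤ p) (v : ℤ × ℤ → ℝ≥0∞) (A B : Freq → ℂ) :
    xn p v (A + B) ≤ xn p v A + xn p v B := by
  refine le_trans (lpn_mono fun z => ?_) (lpn_add_le hp _ _)
  rw [← mul_add]
  gcongr
  exact enorm_add_le _ _

theorem xn_neg (p : ℝ≥0∞) (v : ℤ × ℤ → ℝ≥0∞) (A : Freq → ℂ) : xn p v (-A) = xn p v A := by
  simp [xn]

theorem xn_zero (p : ℝ≥0∞) (v : ℤ × ℤ → ℝ≥0∞) : xn p v 0 = 0 := by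
  simp [xn, lpn]

theorem xn_sub_comm (p : ℝ≥0∞) (v : ℤ × ℤ → ℝ≥0∞) (A B : Freq → ℂ) :
    xn p v (A - B) = xn p v (B - A) := by rw [← xn_neg, neg_sub]

theorem xn_sub_le {p : ℝ≥0∞} (hp : 1 ≤ p) (v : ℤ × ℤ → ℝ≥0∞) (A B C : Freq → ℂ) :
    xn p v (A - C) ≤ xn p v (A - B) + xn p v (B - C) := by
  rw [← sub_add_sub_cancel A B C]
  exact xn_add_le hp v _ _

theorem enorm_le_xn {p : ℝ≥0∞} (h0 : p ≠ 0) (h : p ≠ ⊤) (v : ℤ × ℤ → ℝ≥0∞) (A : Freq → ℂ)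
    (z : Freq) : v z.1 * lamW z.2 * ‖A z‖ₑ ≤ xn p v A :=
  le_lpn h0 h (fun z : Freq => v z.1 * lamW z.2 * ‖A z‖ₑ) z

/-- The standing assumptions on the exponents: `Q` is conjugate to `p ∈ (1, ∞)` and `s Q > 1`. -/
structure Exponents (p : ℝ≥0∞) (s Q : ℝ) : Prop where
  one_lt : 1 < p
  ne_top : p ≠ ⊤
  conj : p.toReal.HolderConjugate Q
  lt_mul : 1 < s * Q

theorem Exponents.one_le {p : ℝ≥0∞} {s Q : ℝ} (E : Exponents p s Q) : 1 ≤ p := E.one_lt.le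

theorem Exponents.ne_zero {p : ℝ≥0∞} {s Q : ℝ} (E : Exponents p s Q) : p ≠ 0 :=
  (zero_lt_one.trans E.one_lt).ne'

theorem Exponents.one_lt_conj {p : ℝ≥0∞} {s Q : ℝ} (E : Exponents p s Q) : 1 < Q := by
  have := E.conj.symm.sub_one_pos
  linarith

/-- Isolates the dependence on M: of the constants in the trilinear estimate, only the kernel sum
over the levels depends on M, and it enters with power 1/Q. -/
theorem exists_lpn_triMaj {p : ℝ≥0∞} {s Q : ℝ} (E : Exponents p s Q) :
    ∃ C : ℝ≥0∞, C ≠ ⊤ ∧ ∀ (M : ℕ), M ≠ 0 → ∀ F G H : Freq → ℝ≥0∞,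
      lpn p (fun z => brW s z.1 * triMaj M F G H z) ≤ C * (M : ℝ≥0∞) ^ (1 / Q) *
        (lpn p (fun z => brW s z.1 * lamW z.2 * F z) * lpn p (fun z => brW s z.1 * lamW z.2 * G z)
          * lpn p (fun z => brW s z.1 * lamW z.2 * H z)) := by
  obtain ⟨B, hB, hB'⟩ := exists_tsum_decay_le
  obtain ⟨D, hD, hD'⟩ := exists_level_set_brW E.lt_mul
  have hS := tsum_lamW_ne_top (E.one_lt_conj)
  have hQ := E.conj.symm.pos
  have hP := E.conj.pos
  refine ⟨((∑' l, lamW l ^ (-Q)) ^ 3 * (B * D)) ^ (1 / Q) * B ^ (1 / p.toReal), ?_,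
    fun M hM F G H => ?_⟩
  · refine ENNReal.mul_ne_top (ENNReal.rpow_ne_top_of_nonneg (by positivity) (by finiteness))
      (ENNReal.rpow_ne_top_of_nonneg (by positivity) hB)
  · refine (lpn_triMaj_le E.ne_zero E.ne_top E.conj hB' M hM (brW s) (brW_ne_zero s)
      (brW_ne_top s) lamW lamW_ne_zero lamW_ne_top D hD' F G H).trans (le_of_eq ?_)
    congr 1
    rw [mul_right_comm _ _ ((M : ℝ≥0∞) ^ _),
      ← ENNReal.mul_rpow_of_nonneg _ (M : ℝ≥0∞) (by positivity)]
    congr 2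
    ring

/-- The cubic convolution followed by the time integral. -/
def triDuhamel (M : ℕ) (A B C : Freq → ℂ) (z : Freq) : ℂ :=
  Complex.I / M * duhamel (cubicConv M A B C) z

theorem picard_eq (M : ℕ) (a : ℤ × ℤ → ℂ) (A : Freq → ℂ) :
    picard M a A = (fun z => cutoffHat (lam z.2) * a z.1) + triDuhamel M A A A := rfl

/-- A weight `γ` on `ℤ²` that is submultiplicative along cubic interactions. -/
def TriSubmult (γ : ℤ × ℤ → ℝ≥0∞) : Prop :=
  ∀ n m k, γ n ≤ γ (n - m) * γ (n - m - k) * γ (n - k)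

theorem exists_lpn_cubicConv {p : ℝ≥0∞} {s Q : ℝ} (E : Exponents p s Q) :
    ∃ C : ℝ≥0∞, C ≠ ⊤ ∧ ∀ (M : ℕ), M ≠ 0 → ∀ γ, TriSubmult γ → ∀ A B D : Freq → ℂ,
      lpn p (fun z : Freq => γ z.1 * brW s z.1 * (∑' j : TriIdx, ‖cutoffHat (phase M z.2 j) *
        (A (slot₁ z.1 j) * (starRingEnd ℂ) (B (slot₂ z.1 j)) * D (slot₃ z.1 j))‖ₑ)) ≤
      C * (M : ℝ≥0∞) ^ (1 / Q) * (xn p (fun n => γ n * brW s n) A *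
        xn p (fun n => γ n * brW s n) B * xn p (fun n => γ n * brW s n) D) := by
  obtain ⟨C, hC, h⟩ := exists_lpn_triMaj E
  obtain ⟨c, hc, hcut⟩ := exists_cutoffHat_enorm_le
  refine ⟨c * C, by finiteness, fun M hM γ hγ A B D => ?_⟩
  calc _ ≤ lpn p (fun z => c * (brW s z.1 * triMaj M (fun z => γ z.1 * ‖A z‖ₑ)
        (fun z => γ z.1 * ‖B z‖ₑ) (fun z => γ z.1 * ‖D z‖ₑ) z)) := by
        refine lpn_mono fun z => ?_
        calc _ ≤ γ z.1 * brW s z.1 * (c * triMaj M (fun z => ‖A z‖ₑ) (fun z => ‖B z‖ₑ)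
                (fun z => ‖D z‖ₑ) z) := by
              gcongr
              exact tsum_enorm_cubicConv_le hcut M A B D z
          _ = c * (brW s z.1 * (γ z.1 * triMaj M (fun z => ‖A z‖ₑ) (fun z => ‖B z‖ₑ)
                (fun z => ‖D z‖ₑ) z)) := by ring
          _ ≤ _ := by
              gcongr
              exact mul_triMaj_le M γ hγ _ _ _ z
    _ ≤ _ := by
        rw [lpn_const_mul E.ne_zero E.ne_top, mul_assoc c C, mul_assoc c]
        gcongr
        refine (h M hM _ _ _).trans (le_of_eq ?_)
        unfold xn
        congr 4 <;>
        · ext z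
          ring

theorem summable_cubicConv {p : ℝ≥0∞} {s Q : ℝ} (E : Exponents p s Q) {M : ℕ} (hM : M ≠ 0)
    {A B D : Freq → ℂ} (hA : xn p (brW s) A ≠ ⊤) (hB : xn p (brW s) B ≠ ⊤)
    (hD : xn p (brW s) D ≠ ⊤) (z : Freq) :
    Summable fun j : TriIdx => cutoffHat (phase M z.2 j) *
        (A (slot₁ z.1 j) * (starRingEnd ℂ) (B (slot₂ z.1 j)) * D (slot₃ z.1 j)) := by
  obtain ⟨C, hC, h⟩ := exists_lpn_cubicConv E
  have hQ := E.conj.symm.pos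
  have h1 := h M hM 1 (fun _ _ _ => by simp) A B D
  simp only [Pi.one_apply, one_mul] at h1
  refine Summable.of_enorm fun htop => ?_
  have h2 := (le_lpn E.ne_zero E.ne_top _ z).trans h1
  rw [htop, ENNReal.mul_top (brW_ne_zero _ _), top_le_iff] at h2
  have h3 : (M : ℝ≥0∞) ^ (1 / Q) ≠ ⊤ := ENNReal.rpow_ne_top_of_nonneg (by positivity) (by simp)
  exact absurd h2 (ENNReal.mul_ne_top (ENNReal.mul_ne_top hC h3)
    (ENNReal.mul_ne_top (ENNReal.mul_ne_top hA hB) hD))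

theorem summable_div_lam {p : ℝ≥0∞} {s Q : ℝ} (E : Exponents p s Q)
    {F : Freq → ℂ} (hF : lpn p (fun z => brW s z.1 * ‖F z‖ₑ) ≠ ⊤) (n : ℤ × ℤ) :
    Summable fun m => F (n, m) / (Complex.I * lam m) := by
  refine Summable.of_enorm fun htop => ?_
  have h1 := tsum_div_lamW_le E.conj (fun m => brW s n * ‖F (n, m)‖ₑ)
  have h2 : (∑' m, (brW s n * ‖F (n, m)‖ₑ) ^ p.toReal) ^ (1 / p.toReal) ≠ ⊤ := by
    refine ne_top_of_le_ne_top hF ?_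
    rw [← lpn_fiber E.ne_zero E.ne_top]
    exact le_lpn E.ne_zero E.ne_top (fun n : ℤ × ℤ =>
      (∑' m, (brW s n * ‖F (n, m)‖ₑ) ^ p.toReal) ^ (1 / p.toReal)) n
  have h3 : (∑' l, lamW l ^ (-Q)) ^ (1 / Q) ≠ ⊤ := by
    have := E.conj.symm.pos
    exact ENNReal.rpow_ne_top_of_nonneg (by positivity)
      (tsum_lamW_ne_top (E.one_lt_conj))
  have h4 := ne_top_of_le_ne_top (ENNReal.mul_ne_top h2 h3) h1
  simp_rw [mul_div_assoc] at h4
  rw [ENNReal.tsum_mul_left] at h4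
  refine h4 ?_
  have e : ∀ m, ‖F (n, m) / (Complex.I * lam m)‖ₑ = ‖F (n, m)‖ₑ / lamW m := fun m => by
    have h0 := lam_ne_zero m
    rw [div_eq_mul_inv, enorm_mul, enorm_inv (by simp [h0]), enorm_mul, lamW, div_eq_mul_inv]
    simp [← ofReal_norm]
  simp_rw [e] at htop
  rw [htop, ENNReal.mul_top (brW_ne_zero _ _)]

theorem duhamel_add {F G : Freq → ℂ} {z : Freq}
    (hF : Summable fun m => F (z.1, m) / (Complex.I * lam m))
    (hG : Summable fun m => G (z.1, m) / (Complex.I * lam m)) :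
    duhamel (F + G) z = duhamel F z + duhamel G z := by
  unfold duhamel
  simp only [Pi.add_apply, add_div]
  rw [hF.tsum_add hG]
  ring

/-- The prefactor 1/M of the slowed-down equation meets the loss M^{1/Q}; since 1/Q - 1 = -1/p, a
negative power of M survives. The constant is the same for every submultiplicative weight. -/
theorem exists_xn_triDuhamel {p : ℝ≥0∞} {s Q : ℝ} (E : Exponents p s Q) :
    ∃ C : ℝ≥0∞, C ≠ ⊤ ∧ ∀ (M : ℕ), M ≠ 0 → ∀ γ, TriSubmult γ → ∀ A B D : Freq → ℂ,
      xn p (fun n => γ n * brW s n) (triDuhamel M A B D) ≤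
      C * (M : ℝ≥0∞) ^ (-(1 / p.toReal)) * (xn p (fun n => γ n * brW s n) A *
        xn p (fun n => γ n * brW s n) B * xn p (fun n => γ n * brW s n) D) := by
  obtain ⟨C, hC, h⟩ := exists_lpn_cubicConv E
  have hκ := exists_lpn_cutoff E.one_lt E.ne_top
  have hS := tsum_lamW_ne_top (E.one_lt_conj)
  have hQ := E.conj.symm.pos
  have hS' : (∑' l, lamW l ^ (-Q)) ^ (1 / Q) ≠ ⊤ :=
    ENNReal.rpow_ne_top_of_nonneg (by positivity) hS
  refine ⟨(1 + lpn p (fun l : ℤ => lamW l * ‖cutoffHat (lam l)‖ₑ) *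
      (∑' l, lamW l ^ (-Q)) ^ (1 / Q)) * C, by finiteness, fun M hM γ hγ A B D => ?_⟩
  have hM0 : (M : ℝ≥0∞) ≠ 0 := by simpa using hM
  have e1 : xn p (fun n => γ n * brW s n) (triDuhamel M A B D)
      = (M : ℝ≥0∞)⁻¹ * xn p (fun n => γ n * brW s n) (duhamel (cubicConv M A B D)) := by
    unfold xn
    rw [← lpn_const_mul E.ne_zero E.ne_top]
    congr 1
    ext z
    have : ‖Complex.I / (M : ℂ)‖ₑ = (M : ℝ≥0∞)⁻¹ := by
      rw [div_eq_mul_inv, enorm_mul, enorm_inv (by simpa using hM)]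
      simp [← ofReal_norm]
    rw [triDuhamel, enorm_mul, this]
    ring
  have e2 : (M : ℝ≥0∞) ^ (-(1 / p.toReal)) = (M : ℝ≥0∞)⁻¹ * (M : ℝ≥0∞) ^ (1 / Q) := by
    rw [← ENNReal.rpow_neg_one, ← ENNReal.rpow_add _ _ hM0 (by simp)]
    congr 1
    have := E.conj.inv_add_inv_eq_one
    rw [one_div, one_div]
    linarith
  rw [e1, e2]
  calc _ ≤ (M : ℝ≥0∞)⁻¹ * (_ * _) :=
        mul_le_mul_right (xn_duhamel_le E.one_le E.ne_top E.conj _ _) _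
    _ ≤ (M : ℝ≥0∞)⁻¹ * (_ * (C * (M : ℝ≥0∞) ^ (1 / Q) * (xn p (fun n => γ n * brW s n) A *
        xn p (fun n => γ n * brW s n) B * xn p (fun n => γ n * brW s n) D))) := by
        refine mul_le_mul_right (mul_le_mul_right (le_trans (lpn_mono fun z => ?_)
          (h M hM γ hγ A B D)) _) _
        exact mul_le_mul_right enorm_tsum_le_tsum_enorm _
    _ = _ := by ring

theorem lpn_cubicConv_ne_top {p : ℝ≥0∞} {s Q : ℝ} (E : Exponents p s Q) {M : ℕ} (hM : M ≠ 0)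
    {A B D : Freq → ℂ} (hA : xn p (brW s) A ≠ ⊤) (hB : xn p (brW s) B ≠ ⊤)
    (hD : xn p (brW s) D ≠ ⊤) :
    lpn p (fun z => brW s z.1 * ‖cubicConv M A B D z‖ₑ) ≠ ⊤ := by
  obtain ⟨C, hC, h⟩ := exists_lpn_cubicConv E
  have hQ := E.conj.symm.pos
  have h1 := h M hM 1 (fun _ _ _ => by simp) A B D
  simp only [Pi.one_apply, one_mul] at h1
  have h3 : (M : ℝ≥0∞) ^ (1 / Q) ≠ ⊤ := ENNReal.rpow_ne_top_of_nonneg (by positivity) (by simp)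
  refine ne_top_of_le_ne_top (ENNReal.mul_ne_top (ENNReal.mul_ne_top hC h3)
    (ENNReal.mul_ne_top (ENNReal.mul_ne_top hA hB) hD)) (le_trans (lpn_mono fun z => ?_) h1)
  exact mul_le_mul_right enorm_tsum_le_tsum_enorm _

/-- Telescoping of a trilinear expression. Finiteness of the norms is needed for the absolute
convergence that allows the infinite sums to be split. -/
theorem triDuhamel_sub {p : ℝ≥0∞} {s Q : ℝ} (E : Exponents p s Q) {M : ℕ} (hM : M ≠ 0)
    {A B : Freq → ℂ} (hA : xn p (brW s) A ≠ ⊤) (hB : xn p (brW s) B ≠ ⊤) :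
    triDuhamel M A A A - triDuhamel M B B B =
      triDuhamel M (A - B) A A + triDuhamel M B (A - B) A + triDuhamel M B B (A - B) := by
  have hAB : xn p (brW s) (A - B) ≠ ⊤ := by
    refine ne_top_of_le_ne_top (ENNReal.add_ne_top.2 ⟨hA, hB⟩) ?_
    rw [sub_eq_add_neg]
    exact (xn_add_le E.one_le _ _ _).trans_eq (by rw [xn_neg])
  have key : cubicConv M A A A = (cubicConv M (A - B) A A + cubicConv M B (A - B) A
      + cubicConv M B B (A - B)) + cubicConv M B B B := by
    ext z
    simp only [Pi.add_apply, cubicConv]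
    rw [← (summable_cubicConv E hM hAB hA hA z).tsum_add (summable_cubicConv E hM hB hAB hA z),
      ← ((summable_cubicConv E hM hAB hA hA z).add (summable_cubicConv E hM hB hAB hA z)).tsum_add
        (summable_cubicConv E hM hB hB hAB z),
      ← (((summable_cubicConv E hM hAB hA hA z).add (summable_cubicConv E hM hB hAB hA z)).add
        (summable_cubicConv E hM hB hB hAB z)).tsum_add (summable_cubicConv E hM hB hB hB z)]
    refine tsum_congr fun j => ?_
    simp only [Pi.sub_apply, map_sub]
    ring
  have sm : ∀ {X Y Z : Freq → ℂ}, xn p (brW s) X ≠ ⊤ → xn p (brW s) Y ≠ ⊤ →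
      xn p (brW s) Z ≠ ⊤ → ∀ n, Summable fun m => cubicConv M X Y Z (n, m) / (Complex.I * lam m) :=
    fun hX hY hZ n => summable_div_lam E (lpn_cubicConv_ne_top E hM hX hY hZ) n
  ext z
  have s1 := sm hAB hA hA z.1
  have s2 := sm hB hAB hA z.1
  have s3 := sm hB hB hAB z.1
  have s12 : Summable fun m => (cubicConv M (A - B) A A + cubicConv M B (A - B) A) (z.1, m)
      / (Complex.I * lam m) := by simpa only [Pi.add_apply, add_div] using s1.add s2
  have s123 : Summable fun m => (cubicConv M (A - B) A A + cubicConv M B (A - B) A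
      + cubicConv M B B (A - B)) (z.1, m) / (Complex.I * lam m) := by
    simpa only [Pi.add_apply, add_div] using s12.add s3
  simp only [Pi.sub_apply, Pi.add_apply, triDuhamel]
  rw [key, duhamel_add s123 (sm hB hB hB z.1), duhamel_add s12 s3, duhamel_add s1 s2]
  ring

/-! ## The fixed point -/

theorem picard_sub_picard (M : ℕ) (a b : ℤ × ℤ → ℂ) (A B : Freq → ℂ) :
    picard M a A - picard M b B = (fun z : Freq => cutoffHat (lam z.2) * (a - b) z.1)
      + (triDuhamel M A A A - triDuhamel M B B B) := by
  rw [picard_eq, picard_eq]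
  ext z
  simp only [Pi.sub_apply, Pi.add_apply]
  ring

/-- The cubic term is a contraction on the ball of radius `r`, in every weighted norm it acts
on. -/
structure SmallCubic (p : ℝ≥0∞) (s : ℝ) (M : ℕ) (r : ℝ≥0) : Prop where
  le_half : ∀ γ, TriSubmult γ → ∀ A : Freq → ℂ, xn p (fun n => γ n * brW s n) A ≤ r →
    xn p (fun n => γ n * brW s n) (triDuhamel M A A A) ≤ r / 2
  lipschitz : ∀ A B : Freq → ℂ, xn p (brW s) A ≤ r → xn p (brW s) B ≤ r →
    xn p (brW s) (triDuhamel M A A A - triDuhamel M B B B) ≤ 2⁻¹ * xn p (brW s) (A - B)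

/-- M depends on the radius r but not on the auxiliary weight γ; the existence time is therefore the
same at all levels of regularity. -/
theorem exists_smallCubic {p : ℝ≥0∞} {s Q : ℝ} (E : Exponents p s Q) (r : ℝ≥0) :
    ∃ M : ℕ, M ≠ 0 ∧ SmallCubic p s M r := by
  obtain ⟨C, hC, h⟩ := exists_xn_triDuhamel E
  have hP := E.conj.pos
  have hlim : Tendsto (fun M : ℕ => 3 * (r : ℝ≥0∞) ^ 2 * (C * (M : ℝ≥0∞) ^ (-(1 / p.toReal))))
      atTop (𝓝 0) := by
    have h1 : Tendsto (fun M : ℕ => ((M : ℝ≥0∞)⁻¹) ^ (1 / p.toReal)) atTop (𝓝 0) := by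
      have := (ENNReal.continuous_rpow_const (y := 1 / p.toReal)).tendsto 0 |>.comp
        ENNReal.tendsto_inv_nat_nhds_zero
      rwa [ENNReal.zero_rpow_of_pos (by positivity)] at this
    have h2 := ENNReal.Tendsto.const_mul (a := 3 * (r : ℝ≥0∞) ^ 2)
      (ENNReal.Tendsto.const_mul (a := C) h1 (Or.inr hC)) (Or.inr (by finiteness))
    simpa [ENNReal.rpow_neg, ENNReal.inv_rpow] using h2
  -- The requirement 3r²CM^{-1/p} ≤ 1/2 is the contraction condition, the 3 counting the telescoped
  -- terms; the self-map bound needs only r²CM^{-1/p} ≤ 1/2.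
  obtain ⟨M, hM', hM⟩ := ((hlim.eventually_le_const (u := (2 : ℝ≥0∞)⁻¹) (by simp)).and
    (eventually_ne_atTop 0)).exists
  set ε := C * (M : ℝ≥0∞) ^ (-(1 / p.toReal)) with hε
  refine ⟨M, hM, fun γ hγ A hA => ?_, fun A B hA hB => ?_⟩
  · calc _ ≤ ε * (r * r * r) := (h M hM γ hγ A A A).trans (by gcongr)
      _ = r ^ 2 * ε * r := by ring
      _ ≤ 2⁻¹ * r := by
          gcongr
          refine le_trans ?_ hM'
          rw [mul_assoc]
          exact le_mul_of_one_le_left (by simp) (by norm_num)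
      _ = r / 2 := by rw [mul_comm, div_eq_mul_inv]
  · have h1 : ∀ X Y Z, xn p (brW s) (triDuhamel M X Y Z)
        ≤ ε * (xn p (brW s) X * xn p (brW s) Y * xn p (brW s) Z) := fun X Y Z => by
      simpa only [Pi.one_apply, one_mul] using h M hM 1 (fun _ _ _ => by simp) X Y Z
    have hA' := ne_top_of_le_ne_top ENNReal.coe_ne_top hA
    have hB' := ne_top_of_le_ne_top ENNReal.coe_ne_top hB
    rw [triDuhamel_sub E hM hA' hB']
    set D := xn p (brW s) (A - B)
    calc _ ≤ ε * (D * r * r) + ε * (r * D * r) + ε * (r * r * D) := by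
          refine (xn_add_le E.one_le _ _ _).trans (add_le_add
            ((xn_add_le E.one_le _ _ _).trans (add_le_add ?_ ?_)) ?_)
          · exact (h1 _ _ _).trans (by gcongr)
          · exact (h1 _ _ _).trans (by gcongr)
          · exact (h1 _ _ _).trans (by gcongr)
      _ = 3 * r ^ 2 * ε * D := by ring
      _ ≤ _ := by gcongr

/-- The Picard iterates. -/
def picardIter (M : ℕ) (a : ℤ × ℤ → ℂ) : ℕ → Freq → ℂ
  | 0 => 0
  | k + 1 => picard M a (picardIter M a k)

/-- The pointwise limit of the Picard iterates. -/
def picardSol (M : ℕ) (a : ℤ × ℤ → ℂ) (z : Freq) : ℂ :=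
  limUnder atTop fun k => picardIter M a k z

/-- The norm of the linear part of the Picard map. -/
def dataConst (p : ℝ≥0∞) : ℝ≥0∞ := lpn p fun l : ℤ => lamW l * ‖cutoffHat (lam l)‖ₑ

section FixedPoint

variable {p : ℝ≥0∞} {s Q : ℝ} {M : ℕ} {r : ℝ≥0}

theorem xn_picard_le (E : Exponents p s Q) (S : SmallCubic p s M r) {γ : ℤ × ℤ → ℝ≥0∞}
    (hγ : TriSubmult γ) {a : ℤ × ℤ → ℂ}
    (ha : dataConst p * lpn p (fun n => γ n * brW s n * ‖a n‖ₑ) ≤ r / 2) {A : Freq → ℂ}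
    (hA : xn p (fun n => γ n * brW s n) A ≤ r) :
    xn p (fun n => γ n * brW s n) (picard M a A) ≤ r := by
  rw [picard_eq]
  refine (xn_add_le E.one_le _ _ _).trans ?_
  rw [xn_data E.ne_zero E.ne_top]
  calc _ ≤ (r : ℝ≥0∞) / 2 + r / 2 := add_le_add ha (S.le_half γ hγ A hA)
    _ = r := ENNReal.add_halves _

theorem xn_picardIter_le (E : Exponents p s Q) (S : SmallCubic p s M r) {γ : ℤ × ℤ → ℝ≥0∞}
    (hγ : TriSubmult γ) {a : ℤ × ℤ → ℂ}
    (ha : dataConst p * lpn p (fun n => γ n * brW s n * ‖a n‖ₑ) ≤ r / 2) (k : ℕ) :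
    xn p (fun n => γ n * brW s n) (picardIter M a k) ≤ r := by
  induction k with
  | zero => simp [picardIter, xn_zero]
  | succ k ih => exact xn_picard_le E S hγ ha ih

theorem xn_picardIter_le' (E : Exponents p s Q) (S : SmallCubic p s M r) {a : ℤ × ℤ → ℂ}
    (ha : dataConst p * lpn p (fun n => brW s n * ‖a n‖ₑ) ≤ r / 2) (k : ℕ) :
    xn p (brW s) (picardIter M a k) ≤ r := by
  have := xn_picardIter_le E S (γ := 1) (fun _ _ _ => by simp) (a := a) (by simpa using ha) k
  simpa using this

theorem xn_picardIter_sub_le (E : Exponents p s Q) (S : SmallCubic p s M r) {a : ℤ × ℤ → ℂ}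
    (ha : dataConst p * lpn p (fun n => brW s n * ‖a n‖ₑ) ≤ r / 2) (k j : ℕ) :
    xn p (brW s) (picardIter M a (k + j) - picardIter M a k) ≤ r * 2⁻¹ ^ k := by
  induction k with
  | zero => simpa [picardIter] using xn_picardIter_le' E S ha j
  | succ k ih =>
    rw [add_right_comm, picardIter, picardIter, picard_sub_picard]
    have : (fun z : Freq => cutoffHat (lam z.2) * (a - a) z.1) = 0 := by
      ext
      simp
    rw [this, zero_add]
    calc _ ≤ 2⁻¹ * ((r : ℝ≥0∞) * 2⁻¹ ^ k) := (S.lipschitz _ _ (xn_picardIter_le' E S ha _)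
          (xn_picardIter_le' E S ha _)).trans (by gcongr)
      _ = (r : ℝ≥0∞) * 2⁻¹ ^ (k + 1) := by rw [pow_succ]; ring

theorem tendsto_picardIter (E : Exponents p s Q) (S : SmallCubic p s M r) {a : ℤ × ℤ → ℂ}
    (ha : dataConst p * lpn p (fun n => brW s n * ‖a n‖ₑ) ≤ r / 2) (z : Freq) :
    Tendsto (fun k => picardIter M a k z) atTop (𝓝 (picardSol M a z)) := by
  set W := brW s z.1 * lamW z.2 with hW
  have hW0 : W ≠ 0 := mul_ne_zero (brW_ne_zero _ _) (lamW_ne_zero _)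
  have hWt : W ≠ ⊤ := ENNReal.mul_ne_top (brW_ne_top _ _) (lamW_ne_top _)
  refine (cauchySeq_of_edist_le_geometric (2⁻¹ : ℝ≥0∞) (W⁻¹ * r) (by norm_num)
    (ENNReal.mul_ne_top (ENNReal.inv_ne_top.2 hW0) ENNReal.coe_ne_top) fun k => ?_).tendsto_limUnder
  rw [edist_comm, edist_eq_enorm_sub, mul_assoc, ← ENNReal.mul_le_iff_le_inv hW0 hWt]
  exact (enorm_le_xn E.ne_zero E.ne_top _ _ z).trans (xn_picardIter_sub_le E S ha k 1)

/-- The solution is built in the unweighted norm only. Its iterates also stay bounded in the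
γ-weighted norm, and Fatou passes this bound to the limit; no convergence in the stronger norm is
needed. -/
theorem xn_picardSol_le (E : Exponents p s Q) (S : SmallCubic p s M r) {a : ℤ × ℤ → ℂ}
    (ha : dataConst p * lpn p (fun n => brW s n * ‖a n‖ₑ) ≤ r / 2)  {γ : ℤ × ℤ → ℝ≥0∞}
    (hγ : TriSubmult γ) (hγt : ∀ n, γ n ≠ ⊤)
    (haγ : dataConst p * lpn p (fun n => γ n * brW s n * ‖a n‖ₑ) ≤ r / 2) :
    xn p (fun n => γ n * brW s n) (picardSol M a) ≤ r := by
  refine lpn_le_of_tendsto E.ne_zero E.ne_top (xn_picardIter_le E S hγ haγ) fun z => ?_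
  refine ENNReal.Tendsto.const_mul (tendsto_picardIter E S ha z).enorm (Or.inr ?_)
  exact ENNReal.mul_ne_top (ENNReal.mul_ne_top (hγt _) (brW_ne_top _ _)) (lamW_ne_top _)

theorem xn_picardSol_le' (E : Exponents p s Q) (S : SmallCubic p s M r) {a : ℤ × ℤ → ℂ}
    (ha : dataConst p * lpn p (fun n => brW s n * ‖a n‖ₑ) ≤ r / 2) :
    xn p (brW s) (picardSol M a) ≤ r := by
  have := xn_picardSol_le E S ha (γ := 1) (fun _ _ _ => by simp) (by simp) (by simpa using ha)
  simpa using this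

theorem xn_picardSol_sub_picardIter_le (E : Exponents p s Q) (S : SmallCubic p s M r)
    {a : ℤ × ℤ → ℂ} (ha : dataConst p * lpn p (fun n => brW s n * ‖a n‖ₑ) ≤ r / 2) (k : ℕ) :
    xn p (brW s) (picardSol M a - picardIter M a k) ≤ r * 2⁻¹ ^ k := by
  have e : (r : ℝ≥0∞) * 2⁻¹ ^ k = ((r * 2⁻¹ ^ k : ℝ≥0) : ℝ≥0∞) := by
    simp [ENNReal.coe_inv, ENNReal.inv_pow]
  rw [e]
  refine lpn_le_of_tendsto E.ne_zero E.ne_top (F := fun j z => brW s z.1 * lamW z.2 *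
    ‖(picardIter M a (k + j) - picardIter M a k) z‖ₑ) (fun j => ?_) fun z => ?_
  · rw [← e]
    exact xn_picardIter_sub_le E S ha k j
  · refine ENNReal.Tendsto.const_mul (Tendsto.enorm ?_) (Or.inr
      (ENNReal.mul_ne_top (brW_ne_top _ _) (lamW_ne_top _)))
    refine Tendsto.sub_const ?_ _
    have := (tendsto_add_atTop_iff_nat k).2 (tendsto_picardIter E S ha z)
    simpa only [add_comm k] using this

/-- The iterates converge geometrically and the Picard map is Lipschitz on the ball, so the defect
has norm 0; the weights are nonzero, which gives equality at every frequency. -/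
theorem picardSol_eq (E : Exponents p s Q) (S : SmallCubic p s M r) {a : ℤ × ℤ → ℂ}
    (ha : dataConst p * lpn p (fun n => brW s n * ‖a n‖ₑ) ≤ r / 2) :
    picardSol M a = picard M a (picardSol M a) := by
  have h0 : xn p (brW s) (picardSol M a - picard M a (picardSol M a)) = 0 := by
    have hlim : Tendsto (fun k : ℕ => (2 * r : ℝ≥0∞) * 2⁻¹ ^ k) atTop (𝓝 0) := by
      simpa using ENNReal.Tendsto.const_mul (a := (2 * r : ℝ≥0∞))
        (ENNReal.tendsto_pow_atTop_nhds_zero_of_lt_one (r := 2⁻¹) (by norm_num))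
        (Or.inr (by finiteness))
    refine le_antisymm (ge_of_tendsto' hlim fun k => ?_) zero_le
    calc _ ≤ xn p (brW s) (picardSol M a - picardIter M a (k + 1))
          + xn p (brW s) (picard M a (picardIter M a k) - picard M a (picardSol M a)) :=
            xn_sub_le E.one_le _ _ _ _
      _ ≤ r * 2⁻¹ ^ (k + 1) + 2⁻¹ * (r * 2⁻¹ ^ k) := by
          refine add_le_add (xn_picardSol_sub_picardIter_le E S ha _) ?_
          rw [picard_sub_picard]
          have : (fun z : Freq => cutoffHat (lam z.2) * (a - a) z.1) = 0 := by
            ext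
            simp
          rw [this, zero_add]
          refine (S.lipschitz _ _ (xn_picardIter_le' E S ha _) (xn_picardSol_le' E S ha)).trans ?_
          rw [xn_sub_comm]
          gcongr
          exact xn_picardSol_sub_picardIter_le E S ha _
      _ = (2⁻¹ * 2) * (r * 2⁻¹ ^ k) := by ring
      _ ≤ _ := by
          rw [ENNReal.inv_mul_cancel two_ne_zero (by simp), one_mul]
          gcongr
          exact le_mul_of_one_le_left (by simp) (by norm_num)
  ext z
  have h1 := (enorm_le_xn E.ne_zero E.ne_top (brW s)
    (picardSol M a - picard M a (picardSol M a)) z).trans h0.le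
  have h2 : ‖(picardSol M a - picard M a (picardSol M a)) z‖ₑ = 0 := by
    simpa [brW_ne_zero, lamW_ne_zero] using h1
  rw [enorm_eq_zero, Pi.sub_apply, sub_eq_zero] at h2
  exact h2

theorem xn_picardSol_sub_le (E : Exponents p s Q) (S : SmallCubic p s M r) {a b : ℤ × ℤ → ℂ}
    (ha : dataConst p * lpn p (fun n => brW s n * ‖a n‖ₑ) ≤ r / 2)
    (hb : dataConst p * lpn p (fun n => brW s n * ‖b n‖ₑ) ≤ r / 2) :
    xn p (brW s) (picardSol M a - picardSol M b)
      ≤ 2 * dataConst p * lpn p (fun n => brW s n * ‖(a - b) n‖ₑ) := by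
  set D := xn p (brW s) (picardSol M a - picardSol M b) with hD
  -- Finiteness of D is what permits absorbing the term D/2 into the left-hand side.
  have hDt : D ≠ ⊤ := by
    refine ne_top_of_le_ne_top (b := (r : ℝ≥0∞) + r) (by finiteness) ?_
    have := xn_sub_le E.one_le (brW s) (picardSol M a) 0 (picardSol M b)
    rw [sub_zero, zero_sub, xn_neg] at this
    exact this.trans (add_le_add (xn_picardSol_le' E S ha) (xn_picardSol_le' E S hb))
  have h1 : D ≤ dataConst p * lpn p (fun n => brW s n * ‖(a - b) n‖ₑ) + 2⁻¹ * D := by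
    conv_lhs => rw [hD, picardSol_eq E S ha, picardSol_eq E S hb, picard_sub_picard]
    refine (xn_add_le E.one_le _ _ _).trans (add_le_add ?_ ?_)
    · rw [xn_data E.ne_zero E.ne_top]
      rfl
    · exact S.lipschitz _ _ (xn_picardSol_le' E S ha) (xn_picardSol_le' E S hb)
  have h2 : 2⁻¹ * D ≤ dataConst p * lpn p (fun n => brW s n * ‖(a - b) n‖ₑ) := by
    have h3 : 2⁻¹ * D + 2⁻¹ * D = D := by
      rw [← add_mul, ENNReal.inv_two_add_inv_two, one_mul]
    have h4 : 2⁻¹ * D ≠ ⊤ := ENNReal.mul_ne_top (by simp) hDt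
    refine (ENNReal.add_le_add_iff_right h4).1 ?_
    rwa [h3]
  calc D = 2 * (2⁻¹ * D) := by
        rw [← mul_assoc, ENNReal.mul_inv_cancel two_ne_zero (by simp), one_mul]
    _ ≤ 2 * (dataConst p * lpn p fun n => brW s n * ‖(a - b) n‖ₑ) := by gcongr
    _ = _ := (mul_assoc _ _ _).symm

end FixedPoint

/-! ## Fourier series on the torus -/

theorem summable_sz_pow : Summable fun n : ℤ × ℤ => (((sz n + 1 : ℕ) : ℝ) ^ 3)⁻¹ := by
  have h := tsum_wt_ne_top (τ := 3) (by norm_num)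
  have e : (fun n : ℤ × ℤ => (((sz n + 1 : ℕ) : ℝ) ^ 3)⁻¹) = fun n => (wt 3 n).toReal := by
    ext n
    rw [wt, pw, ← ENNReal.toReal_rpow, Real.rpow_neg (by positivity)]
    norm_num
    norm_cast
  rw [e]
  exact ENNReal.summable_toReal h

theorem natAbs_fst_le_sz (n : ℤ × ℤ) : |(n.1 : ℝ)| ≤ sz n := by
  rw [cast_sz]
  exact le_max_left _ _

theorem natAbs_snd_le_sz (n : ℤ × ℤ) : |(n.2 : ℝ)| ≤ sz n := by
  rw [cast_sz]
  exact le_max_right _ _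

/-- Vanishing Fourier coefficients are summable, so the Fourier series represents the continuous
function pointwise. -/
theorem eq_zero_of_intervalIntegral_exp_eq_zero {g : ℝ → ℂ} (hg : Continuous g)
    (hper : Function.Periodic g (2 * Real.pi))
    (h : ∀ n : ℤ, ∫ x in 0..2 * Real.pi, Complex.exp (Complex.I * ((n * x : ℝ) : ℂ)) * g x = 0)
    (x : ℝ) : g x = 0 := by
  have : Fact (0 < 2 * Real.pi) := ⟨Real.two_pi_pos⟩
  set G : C(AddCircle (2 * Real.pi), ℂ) := ⟨hper.lift, continuous_coinduced_dom.2 hg⟩ with hG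
  have hc : _root_.fourierCoeff G = 0 := by
    ext n
    rw [_root_.fourierCoeff_eq_intervalIntegral _ n 0, zero_add]
    have e : (fun y : ℝ => (fourier (-n) (y : AddCircle (2 * Real.pi)) : ℂ) • G y)
        = fun y : ℝ => Complex.exp (Complex.I * (((-n : ℤ) * y : ℝ) : ℂ)) * g y := by
      ext y
      have h1 : G y = g y := rfl
      rw [fourier_coe_apply, h1, smul_eq_mul]
      congr 2
      have := Real.pi_ne_zero
      push_cast
      field_simp
    rw [e, h (-n)]
    simp
  have h2 := has_pointwise_sum_fourier_series_of_summable (f := G)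
    (by rw [hc]; exact summable_zero) (x : AddCircle (2 * Real.pi))
  rw [hc] at h2
  simp only [Pi.zero_apply, zero_smul] at h2
  exact h2.unique hasSum_zero

/-! ### Integration and differentiation on the torus. -/

theorem torusIntegral_eq {f : ℝ × ℝ → ℂ} (hf : Continuous f) :
    torusIntegral f = (((2 * Real.pi) ^ 2)⁻¹ : ℝ) •
      ∫ x in 0..2 * Real.pi, ∫ y in 0..2 * Real.pi, f (x, y) := by
  have h := Real.two_pi_pos.le
  have h1 := setIntegral_prod (μ := (volume : Measure ℝ)) (ν := (volume : Measure ℝ)) f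
    (integrableOn_torusBox hf)
  rw [torusIntegral, torusBox, Measure.volume_eq_prod, h1, intervalIntegral.integral_of_le h,
    integral_Icc_eq_integral_Ioc]
  simp_rw [intervalIntegral.integral_of_le h, integral_Icc_eq_integral_Ioc]

theorem torusIntegral_swap (f : ℝ × ℝ → ℂ) :
    torusIntegral f = torusIntegral fun x => f (x.2, x.1) := by
  unfold torusIntegral
  congr 1
  have h1 := setIntegral_prod_swap (μ := (volume : Measure ℝ)) (ν := (volume : Measure ℝ))
    (Icc 0 (2 * Real.pi)) (Icc 0 (2 * Real.pi)) f
  rw [torusBox, Measure.volume_eq_prod, ← h1]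
  rfl

theorem torusIntegral_const_mul (c : ℂ) (f : ℝ × ℝ → ℂ) :
    torusIntegral (fun x => c * f x) = c * torusIntegral f := by
  unfold torusIntegral
  rw [integral_const_mul, mul_smul_comm]

theorem torusIntegral_add {f g : ℝ × ℝ → ℂ} (hf : Continuous f) (hg : Continuous g) :
    torusIntegral (fun x => f x + g x) = torusIntegral f + torusIntegral g := by
  unfold torusIntegral
  rw [integral_add (integrableOn_torusBox hf) (integrableOn_torusBox hg), smul_add]

theorem torusIntegral_sub {f g : ℝ × ℝ → ℂ} (hf : Continuous f) (hg : Continuous g) :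
    torusIntegral (fun x => f x - g x) = torusIntegral f - torusIntegral g := by
  unfold torusIntegral
  rw [integral_sub (integrableOn_torusBox hf) (integrableOn_torusBox hg), smul_sub]

theorem torusIntegral_one : torusIntegral (fun _ => 1) = 1 := by
  rw [torusIntegral_eq continuous_const]
  have := Real.pi_ne_zero
  simp only [intervalIntegral.integral_const, sub_zero, smul_smul]
  rw [Complex.real_smul, mul_one]
  norm_cast
  field_simp

theorem norm_torusIntegral_le {f : ℝ × ℝ → ℂ} {M : ℝ} (h : ∀ x, ‖f x‖ ≤ M) :
    ‖torusIntegral f‖ ≤ M := by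
  have hv : volume.real torusBox = (2 * Real.pi) ^ 2 := by
    rw [torusBox, Measure.volume_eq_prod, measureReal_prod_prod]
    simp [Real.two_pi_pos.le]
    ring
  have key := norm_setIntegral_le_of_norm_le_const (μ := volume) (s := torusBox) (f := f) (C := M)
    (isCompact_Icc.prod isCompact_Icc : IsCompact torusBox).measure_lt_top (fun x _ => h x)
  have hp := Real.two_pi_pos
  rw [torusIntegral, norm_smul, Real.norm_of_nonneg (by positivity)]
  rw [hv] at key
  calc _ ≤ ((2 * Real.pi) ^ 2)⁻¹ * (M * (2 * Real.pi) ^ 2) := by gcongr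
    _ = M := by field_simp

/-- The directional derivative of a smooth function on the torus. -/
def pd (v : ℝ × ℝ) (f : SmoothTorus) : SmoothTorus :=
  ⟨fun x => fderiv ℝ f.1 x v, by
    constructor
    · exact (f.2.1.fderiv_right (m := ∞) (by simp)).clm_apply contDiff_const
    · intro x
      have h1 : f.1 = fun y => f.1 (y + (2 * Real.pi, 0)) := by
        ext y
        rw [← (f.2.2 y).1]
        simp [Prod.add_def]
      have h2 : f.1 = fun y => f.1 (y + (0, 2 * Real.pi)) := by
        ext y
        rw [← (f.2.2 y).2]
        simp [Prod.add_def]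
      constructor
      · have := congrArg (fun g => fderiv ℝ g x v) h1
        simp only [fderiv_comp_add_right] at this
        simpa [Prod.add_def] using this.symm
      · have := congrArg (fun g => fderiv ℝ g x v) h2
        simp only [fderiv_comp_add_right] at this
        simpa [Prod.add_def] using this.symm⟩

theorem pd_apply (v : ℝ × ℝ) (f : SmoothTorus) (x : ℝ × ℝ) : (pd v f).1 x = fderiv ℝ f.1 x v := rfl

theorem diffT (f : SmoothTorus) : Differentiable ℝ f.1 :=
  f.2.1.differentiable (by simp)

theorem contT (f : SmoothTorus) : Continuous f.1 := f.2.1.continuous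

theorem norm_iteratedFDeriv_pd_le (v : ℝ × ℝ) (f : SmoothTorus) (k : ℕ) (x : ℝ × ℝ) :
    ‖iteratedFDeriv ℝ k (pd v f).1 x‖ ≤ ‖v‖ * ‖iteratedFDeriv ℝ (k + 1) f.1 x‖ := by
  rw [← norm_iteratedFDeriv_fderiv]
  exact norm_iteratedFDeriv_clm_apply_const (N := ∞)
    (f.2.1.fderiv_right (m := ∞) (by simp)).contDiffAt (by exact_mod_cast le_top)

theorem hasDerivAt_fst (f : SmoothTorus) (x y : ℝ) :
    HasDerivAt (fun t => f.1 (t, y)) ((pd (1, 0) f).1 (x, y)) x := by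
  have h := (diffT f (x, y)).hasFDerivAt.comp_hasDerivAt x
    ((hasDerivAt_id x).prodMk (hasDerivAt_const x y))
  exact h

theorem hasDerivAt_snd (f : SmoothTorus) (x y : ℝ) :
    HasDerivAt (fun t => f.1 (x, t)) ((pd (0, 1) f).1 (x, y)) y := by
  have h := (diffT f (x, y)).hasFDerivAt.comp_hasDerivAt y
    ((hasDerivAt_const y x).prodMk (hasDerivAt_id y))
  exact h

theorem torusIntegral_pd_fst (f : SmoothTorus) : torusIntegral (pd (1, 0) f).1 = 0 := by
  rw [torusIntegral_swap,
    torusIntegral_eq (f := fun x => (pd (1, 0) f).1 (x.2, x.1))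
      ((contT (pd (1, 0) f)).comp (by fun_prop))]
  have : ∀ y, ∫ x in 0..2 * Real.pi, (pd (1, 0) f).1 (x, y) = 0 := fun y => by
    rw [intervalIntegral.integral_eq_sub_of_hasDerivAt (fun x _ => hasDerivAt_fst f x y)
      (((contT (pd (1, 0) f)).comp (by fun_prop)).intervalIntegrable _ _)]
    have := (f.2.2 (0, y)).1
    simp only [zero_add] at this
    rw [this, sub_self]
  simp [this]

theorem torusIntegral_pd_snd (f : SmoothTorus) : torusIntegral (pd (0, 1) f).1 = 0 := by
  rw [torusIntegral_eq (contT (pd (0, 1) f))]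
  have : ∀ x, ∫ y in 0..2 * Real.pi, (pd (0, 1) f).1 (x, y) = 0 := fun x => by
    rw [intervalIntegral.integral_eq_sub_of_hasDerivAt (fun y _ => hasDerivAt_snd f x y)
      (((contT (pd (0, 1) f)).comp (by fun_prop)).intervalIntegrable _ _)]
    have := (f.2.2 (x, 0)).2
    simp only [zero_add] at this
    rw [this, sub_self]
  simp [this]

theorem pd_eq (v : ℝ × ℝ) (f : SmoothTorus) (x : ℝ × ℝ) :
    (pd v f).1 x = v.1 * (pd (1, 0) f).1 x + v.2 * (pd (0, 1) f).1 x := by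
  simp only [pd_apply]
  conv_lhs => rw [show v = v.1 • ((1, 0) : ℝ × ℝ) + v.2 • ((0, 1) : ℝ × ℝ) by simp]
  rw [map_add, map_smul, map_smul, Complex.real_smul, Complex.real_smul]

theorem torusIntegral_pd (v : ℝ × ℝ) (f : SmoothTorus) : torusIntegral (pd v f).1 = 0 := by
  have e : (pd v f).1 = fun x => (v.1 : ℂ) * (pd (1, 0) f).1 x + v.2 * (pd (0, 1) f).1 x := by
    ext x
    exact pd_eq v f x
  have c : ∀ (c : ℂ) (g : SmoothTorus), Continuous fun x => c * g.1 x := fun c g =>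
    continuous_const.mul (contT g)
  rw [e, torusIntegral_add (c _ _) (c _ _), torusIntegral_const_mul, torusIntegral_const_mul,
    torusIntegral_pd_fst, torusIntegral_pd_snd]
  simp

/-- The product of smooth functions on the torus. -/
def mulT (f g : SmoothTorus) : SmoothTorus :=
  ⟨fun x => f.1 x * g.1 x, f.2.1.mul g.2.1, fun x => by
    simp only
    rw [(f.2.2 x).1, (f.2.2 x).2, (g.2.2 x).1, (g.2.2 x).2]
    exact ⟨rfl, rfl⟩⟩

/-- The complex conjugate of a smooth function on the torus. -/
def conjT (f : SmoothTorus) : SmoothTorus :=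
  ⟨fun x => (starRingEnd ℂ) (f.1 x), (Complex.conjCLE.contDiff (n := ∞)).comp f.2.1, fun x => by
    simp only
    rw [(f.2.2 x).1, (f.2.2 x).2]
    exact ⟨rfl, rfl⟩⟩

theorem continuous_mulT (f g : SmoothTorus) : Continuous fun x => f.1 x * g.1 x :=
  (contT f).mul (contT g)

theorem pd_mulT (v : ℝ × ℝ) (f g : SmoothTorus) (x : ℝ × ℝ) :
    (pd v (mulT f g)).1 x = f.1 x * (pd v g).1 x + (pd v f).1 x * g.1 x := by
  have : (mulT f g).1 = f.1 * g.1 := rfl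
  rw [pd_apply, this, fderiv_mul (diffT f x) (diffT g x)]
  simp only [_root_.add_apply, _root_.smul_apply, smul_eq_mul, pd_apply]
  ring

theorem torusIntegral_pd_mul (v : ℝ × ℝ) (f g : SmoothTorus) :
    torusIntegral (fun x => (pd v f).1 x * g.1 x) = -torusIntegral fun x => f.1 x * (pd v g).1 x := by
  have h := torusIntegral_pd v (mulT f g)
  have e : (pd v (mulT f g)).1 = fun x => f.1 x * (pd v g).1 x + (pd v f).1 x * g.1 x := by
    ext x
    exact pd_mulT v f g x
  rw [e, torusIntegral_add (continuous_mulT _ _) (continuous_mulT _ _)] at h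
  linear_combination h

theorem box_eq (f : SmoothTorus) (x : ℝ × ℝ) :
    box f.1 x = (pd (1, 0) (pd (1, 0) f)).1 x - (pd (0, 1) (pd (0, 1) f)).1 x := by
  unfold box
  simp only [iteratedDeriv_succ, iteratedDeriv_zero]
  have e1 : deriv (fun y => f.1 (y, x.2)) = fun y => (pd (1, 0) f).1 (y, x.2) :=
    funext fun y => (hasDerivAt_fst f y x.2).deriv
  have e2 : deriv (fun y => f.1 (x.1, y)) = fun y => (pd (0, 1) f).1 (x.1, y) :=
    funext fun y => (hasDerivAt_snd f x.1 y).deriv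
  rw [e1, e2, (hasDerivAt_fst (pd (1, 0) f) x.1 x.2).deriv,
    (hasDerivAt_snd (pd (0, 1) f) x.1 x.2).deriv]

/-- The hyperbolic Laplacian as an operator on smooth functions on the torus. -/
def boxT (f : SmoothTorus) : SmoothTorus := pd (1, 0) (pd (1, 0) f) - pd (0, 1) (pd (0, 1) f)

theorem boxT_apply (f : SmoothTorus) (x : ℝ × ℝ) : (boxT f).1 x = box f.1 x := (box_eq f x).symm

theorem torusIntegral_box_mul (f g : SmoothTorus) :
    torusIntegral (fun x => box f.1 x * g.1 x) = torusIntegral fun x => f.1 x * box g.1 x := by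
  simp only [box_eq, sub_mul, mul_sub]
  rw [torusIntegral_sub (continuous_mulT _ _) (continuous_mulT _ _),
    torusIntegral_sub (continuous_mulT _ _) (continuous_mulT _ _),
    torusIntegral_pd_mul, torusIntegral_pd_mul, torusIntegral_pd_mul, torusIntegral_pd_mul,
    neg_neg, neg_neg]

/-! ## Fourier coefficients of smooth functions and of distributions -/

theorem expMode_apply (n : ℤ × ℤ) (x : ℝ × ℝ) :
    (expMode n).1 x = Complex.exp (Complex.I * ((n.1 * x.1 + n.2 * x.2 : ℝ) : ℂ)) := rfl

theorem norm_expMode (n : ℤ × ℤ) (x : ℝ × ℝ) : ‖(expMode n).1 x‖ = 1 := by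
  rw [expMode_apply, mul_comm, Complex.norm_exp_ofReal_mul_I]

theorem expMode_mul (n m : ℤ × ℤ) (x : ℝ × ℝ) :
    (expMode n).1 x * (expMode m).1 x = (expMode (n + m)).1 x := by
  simp only [expMode_apply, ← Complex.exp_add]
  congr 1
  push_cast [Prod.fst_add, Prod.snd_add]
  ring

theorem expMode_zero (x : ℝ × ℝ) : (expMode 0).1 x = 1 := by simp [expMode_apply]

theorem conj_expMode (n : ℤ × ℤ) (x : ℝ × ℝ) :
    (starRingEnd ℂ) ((expMode n).1 x) = (expMode (-n)).1 x := by
  rw [expMode_apply, expMode_apply, ← Complex.exp_conj]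
  congr 1
  simp only [map_mul, Complex.conj_I, Complex.conj_ofReal, Prod.fst_neg, Prod.snd_neg]
  push_cast
  ring

theorem pd_expMode (v : ℝ × ℝ) (n : ℤ × ℤ) (x : ℝ × ℝ) :
    (pd v (expMode n)).1 x = Complex.I * (n.1 * v.1 + n.2 * v.2) * (expMode n).1 x := by
  have h1 : HasDerivAt (fun t => (expMode n).1 (t, x.2))
      (Complex.I * n.1 * (expMode n).1 x) x.1 := by
    simp only [expMode_apply]
    have := (((((hasDerivAt_id x.1).const_mul (n.1 : ℝ)).add_const (n.2 * x.2)).ofReal_comp).const_mul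
      Complex.I).cexp
    convert! this using 1
    simp only [id]
    push_cast
    ring
  have h2 : HasDerivAt (fun t => (expMode n).1 (x.1, t))
      (Complex.I * n.2 * (expMode n).1 x) x.2 := by
    simp only [expMode_apply]
    have := (((((hasDerivAt_id x.2).const_mul (n.2 : ℝ)).const_add (n.1 * x.1)).ofReal_comp).const_mul
      Complex.I).cexp
    convert! this using 1
    simp only [id]
    push_cast
    ring
  rw [pd_eq, (hasDerivAt_fst (expMode n) x.1 x.2).unique h1,
    (hasDerivAt_snd (expMode n) x.1 x.2).unique h2]
  ring

/-- The Fourier coefficient of a smooth function. -/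
def fcoef (f : SmoothTorus) (n : ℤ × ℤ) : ℂ := (toDistribution (expMode (-n))).1 f

theorem fcoef_eq (f : SmoothTorus) (n : ℤ × ℤ) :
    fcoef f n = torusIntegral fun x => (expMode (-n)).1 x * f.1 x := rfl

theorem fcoef_eq' (f : SmoothTorus) (n : ℤ × ℤ) :
    fcoef f n = torusIntegral fun x => f.1 x * (expMode (-n)).1 x := by
  rw [fcoef_eq]
  simp only [mul_comm]

theorem fourierCoeff_toDistribution (f : SmoothTorus) (n : ℤ × ℤ) :
    fourierCoeff (toDistribution f) n = fcoef f n := (fcoef_eq' f n).symm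

theorem fcoef_pd (v : ℝ × ℝ) (f : SmoothTorus) (n : ℤ × ℤ) :
    fcoef (pd v f) n = Complex.I * (n.1 * v.1 + n.2 * v.2) * fcoef f n := by
  rw [fcoef_eq', torusIntegral_pd_mul, fcoef_eq']
  simp only [pd_expMode]
  rw [← torusIntegral_const_mul, ← neg_one_mul, ← torusIntegral_const_mul]
  congr 1
  ext x
  simp only [Prod.fst_neg, Prod.snd_neg]
  push_cast
  ring

theorem fcoef_pd_iterate (v : ℝ × ℝ) (f : SmoothTorus) (n : ℤ × ℤ) (k : ℕ) :
    fcoef ((pd v)^[k] f) n = (Complex.I * (n.1 * v.1 + n.2 * v.2)) ^ k * fcoef f n := by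
  induction k generalizing f with
  | zero => simp
  | succ k ih =>
    rw [Function.iterate_succ_apply, ih, fcoef_pd]
    ring

theorem norm_fcoef_le {f : SmoothTorus} {M : ℝ} (h : ∀ x, ‖f.1 x‖ ≤ M) (n : ℤ × ℤ) :
    ‖fcoef f n‖ ≤ M := by
  rw [fcoef_eq]
  refine norm_torusIntegral_le fun x => ?_
  rw [norm_mul, norm_expMode, one_mul]
  exact h x

theorem norm_iteratedFDeriv_pd_iterate_le {v : ℝ × ℝ} (hv : ‖v‖ ≤ 1) (f : SmoothTorus) (k j : ℕ)
    (x : ℝ × ℝ) :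
    ‖iteratedFDeriv ℝ j ((pd v)^[k] f).1 x‖ ≤ ‖iteratedFDeriv ℝ (j + k) f.1 x‖ := by
  induction k generalizing f with
  | zero => simp
  | succ k ih =>
    rw [Function.iterate_succ_apply]
    refine (ih _).trans ((norm_iteratedFDeriv_pd_le v f _ x).trans ?_)
    rw [← add_assoc]
    exact mul_le_of_le_one_left (norm_nonneg _) hv

/-- Differentiating k times along the coordinate axis where |n_i| is largest multiplies the
coefficient by a factor of modulus |n|^k. -/
theorem sz_pow_mul_norm_fcoef_le {f : SmoothTorus} {M : ℝ} {k : ℕ}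
    (h : ∀ x, ‖iteratedFDeriv ℝ k f.1 x‖ ≤ M) (n : ℤ × ℤ) : (sz n : ℝ) ^ k * ‖fcoef f n‖ ≤ M := by
  have key : ∀ v : ℝ × ℝ, ‖v‖ ≤ 1 → |n.1 * v.1 + n.2 * v.2| ^ k * ‖fcoef f n‖ ≤ M := by
    intro v hv
    have h1 := norm_fcoef_le (f := (pd v)^[k] f) (M := M) (fun x => by
      have := norm_iteratedFDeriv_pd_iterate_le hv f k 0 x
      rw [norm_iteratedFDeriv_zero, zero_add] at this
      exact this.trans (h x)) n
    rw [fcoef_pd_iterate, norm_mul, norm_pow, norm_mul, Complex.norm_I, one_mul] at h1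
    convert h1 using 3
    rw [← Real.norm_eq_abs, ← Complex.norm_real]
    push_cast
    rfl
  rw [cast_sz]
  rcases max_choice |(n.1 : ℝ)| |(n.2 : ℝ)| with e | e <;> rw [e]
  · simpa using key (1, 0) (by simp)
  · simpa using key (0, 1) (by simp)

/-- For n ≠ 0 one has |n| + 1 ≤ 2|n|, whence 2^k; at n = 0 the undifferentiated bound is used. -/
theorem norm_fcoef_decay {f : SmoothTorus} {M : ℝ} {k : ℕ}
    (h : ∀ j ≤ k, ∀ x, ‖iteratedFDeriv ℝ j f.1 x‖ ≤ M) (n : ℤ × ℤ) :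
    ((sz n + 1 : ℕ) : ℝ) ^ k * ‖fcoef f n‖ ≤ 2 ^ k * M := by
  have h0 := sz_pow_mul_norm_fcoef_le (h 0 (Nat.zero_le _)) n
  have h1 := sz_pow_mul_norm_fcoef_le (h k le_rfl) n
  rcases Nat.eq_zero_or_pos (sz n) with h2 | h2
  · rw [h2]
    simp only [pow_zero, one_mul] at h0
    have : (1 : ℝ) ≤ 2 ^ k := one_le_pow₀ (by norm_num)
    have := (norm_nonneg _).trans h0
    simp only [zero_add, Nat.cast_one, one_pow, one_mul]
    nlinarith
  · have : ((sz n + 1 : ℕ) : ℝ) ≤ 2 * sz n := by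
      push_cast
      have : (1 : ℝ) ≤ sz n := by exact_mod_cast h2
      linarith
    calc _ ≤ (2 * (sz n : ℝ)) ^ k * ‖fcoef f n‖ := by gcongr
      _ = 2 ^ k * ((sz n : ℝ) ^ k * ‖fcoef f n‖) := by rw [mul_pow]; ring
      _ ≤ _ := by gcongr

theorem exists_mem_torusBox {E : Type*} {g : ℝ × ℝ → E}
    (h : ∀ x : ℝ × ℝ, g (x.1 + 2 * Real.pi, x.2) = g x ∧ g (x.1, x.2 + 2 * Real.pi) = g x)
    (x : ℝ × ℝ) : ∃ y ∈ torusBox, g x = g y := by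
  have p1 : ∀ b, Function.Periodic (fun a => g (a, b)) (2 * Real.pi) := fun b a => (h (a, b)).1
  have p2 : ∀ a, Function.Periodic (fun b => g (a, b)) (2 * Real.pi) := fun a b => (h (a, b)).2
  obtain ⟨a, ha, h1⟩ := (p1 x.2).exists_mem_Ico₀ Real.two_pi_pos x.1
  obtain ⟨b, hb, h2⟩ := (p2 a).exists_mem_Ico₀ Real.two_pi_pos x.2
  exact ⟨(a, b), ⟨Ico_subset_Icc_self ha, Ico_subset_Icc_self hb⟩, h1.trans h2⟩

theorem exists_norm_iteratedFDeriv_le (f : SmoothTorus) (k : ℕ) :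
    ∃ M, ∀ j ≤ k, ∀ x, ‖iteratedFDeriv ℝ j f.1 x‖ ≤ M := by
  have h1 : ∀ j, ∃ M, ∀ x, ‖iteratedFDeriv ℝ j f.1 x‖ ≤ M := fun j => by
    obtain ⟨M, hM⟩ := (isCompact_Icc.prod isCompact_Icc :
      IsCompact torusBox).exists_bound_of_continuousOn
      (f.2.1.continuous_iteratedFDeriv (m := j) (by exact_mod_cast le_top)).continuousOn
    refine ⟨M, fun x => ?_⟩
    obtain ⟨y, hy, e⟩ := exists_mem_torusBox (g := iteratedFDeriv ℝ j f.1) (fun x => by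
      have e1 : f.1 = fun y => f.1 (y + (2 * Real.pi, 0)) := by
        ext y
        rw [← (f.2.2 y).1]
        simp [Prod.add_def]
      have e2 : f.1 = fun y => f.1 (y + (0, 2 * Real.pi)) := by
        ext y
        rw [← (f.2.2 y).2]
        simp [Prod.add_def]
      constructor
      · have := congrArg (fun g => iteratedFDeriv ℝ j g x) e1
        simp only [iteratedFDeriv_comp_add_right] at this
        simpa [Prod.add_def] using this.symm
      · have := congrArg (fun g => iteratedFDeriv ℝ j g x) e2
        simp only [iteratedFDeriv_comp_add_right] at this
        simpa [Prod.add_def] using this.symm) x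
    rw [e]
    exact hM y hy
  choose B hB using h1
  refine ⟨∑ j ∈ Finset.range (k + 1), B j, fun j hj x => (hB j x).trans ?_⟩
  exact Finset.single_le_sum (f := B) (fun i _ => (norm_nonneg _).trans (hB i 0))
    (Finset.mem_range.2 (by omega))

theorem summable_pow_mul_fcoef (f : SmoothTorus) (k : ℕ) :
    Summable fun n => ((sz n + 1 : ℕ) : ℝ) ^ k * ‖fcoef f n‖ := by
  obtain ⟨M, hM⟩ := exists_norm_iteratedFDeriv_le f (k + 3)
  refine Summable.of_nonneg_of_le (fun n => by positivity) (fun n => ?_)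
    (summable_sz_pow.mul_left (2 ^ (k + 3) * M))
  have h := norm_fcoef_decay hM n
  have h0 : (0 : ℝ) < ((sz n + 1 : ℕ) : ℝ) ^ 3 := by positivity
  rw [← div_eq_mul_inv, le_div_iff₀ h0]
  calc _ = ((sz n + 1 : ℕ) : ℝ) ^ (k + 3) * ‖fcoef f n‖ := by ring
    _ ≤ _ := h

theorem summable_fcoef (f : SmoothTorus) : Summable fun n => ‖fcoef f n‖ := by
  simpa using summable_pow_mul_fcoef f 0

theorem tsum_norm_fcoef_le {f : SmoothTorus} {M : ℝ}
    (h : ∀ j ≤ 3, ∀ x, ‖iteratedFDeriv ℝ j f.1 x‖ ≤ M) :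
    ∑' n, ‖fcoef f n‖ ≤ 8 * (∑' n : ℤ × ℤ, (((sz n + 1 : ℕ) : ℝ) ^ 3)⁻¹) * M := by
  rw [mul_right_comm, ← tsum_mul_left]
  refine (summable_fcoef f).tsum_le_tsum (fun n => ?_) (summable_sz_pow.mul_left _)
  have h1 := norm_fcoef_decay h n
  have h0 : (0 : ℝ) < ((sz n + 1 : ℕ) : ℝ) ^ 3 := by positivity
  rw [← div_eq_mul_inv, le_div_iff₀ h0, mul_comm]
  norm_num at h1 ⊢
  exact h1

theorem torusIntegral_expMode (n : ℤ × ℤ) :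
    torusIntegral (expMode n).1 = if n = 0 then 1 else 0 := by
  split_ifs with h
  · subst h
    rw [← torusIntegral_one]
    congr 1
    ext x
    exact expMode_zero x
  · have key : ∀ v : ℝ × ℝ, (Complex.I * (n.1 * v.1 + n.2 * v.2)) * torusIntegral (expMode n).1 = 0 :=
      fun v => by
        rw [← torusIntegral_const_mul, ← torusIntegral_pd v (expMode n)]
        congr 1
        ext x
        exact (pd_expMode v n x).symm
    by_cases h1 : n.1 = 0
    · have h2 : n.2 ≠ 0 := fun h2 => h (Prod.ext h1 h2)
      simpa [h2] using key (0, 1)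
    · simpa [h1] using key (1, 0)

theorem fcoef_expMode (n m : ℤ × ℤ) : fcoef (expMode n) m = if n = m then 1 else 0 := by
  rw [fcoef_eq']
  simp only [expMode_mul]
  have : (fun x => (expMode (n + -m)).1 x) = (expMode (n + -m)).1 := rfl
  rw [this, torusIntegral_expMode]
  simp only [add_neg_eq_zero]

theorem norm_iteratedFDeriv_expMode_le (n : ℤ × ℤ) (k : ℕ) (x : ℝ × ℝ) :
    ‖iteratedFDeriv ℝ k (expMode n).1 x‖ ≤ (2 * sz n : ℝ) ^ k := by
  -- The exponential is a one-variable exponential composed with the linear form L, so each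
  -- derivative contributes at most one factor ‖L‖ ≤ 2|n|.
  set g : ℝ → ℂ := fun θ => Complex.exp (Complex.I * θ) with hg
  set L : ℝ × ℝ →L[ℝ] ℝ := (n.1 : ℝ) • ContinuousLinearMap.fst ℝ ℝ ℝ
    + (n.2 : ℝ) • ContinuousLinearMap.snd ℝ ℝ ℝ with hL
  have e : (expMode n).1 = g ∘ L := by
    ext y
    simp [expMode_apply, hg, hL]
  have hgs : ContDiff ℝ ∞ g := (contDiff_const.mul Complex.ofRealCLM.contDiff).cexp
  have hd : ∀ j, iteratedDeriv j g = fun θ => Complex.I ^ j * g θ := fun j => by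
    induction j with
    | zero => simp
    | succ j ih =>
      rw [iteratedDeriv_succ, ih]
      ext θ
      have h1 : HasDerivAt g (Complex.I * g θ) θ := by
        have := (((hasDerivAt_id θ).ofReal_comp).const_mul Complex.I).cexp
        convert! this using 1
        simp [hg, mul_comm]
      rw [(h1.const_mul _).deriv]
      ring
  have hLn : ‖L‖ ≤ 2 * sz n := by
    refine L.opNorm_le_bound (by positivity) fun y => ?_
    simp only [hL, _root_.add_apply, _root_.smul_apply, ContinuousLinearMap.coe_fst',
      ContinuousLinearMap.coe_snd', smul_eq_mul]
    have a1 := natAbs_fst_le_sz n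
    have a2 := natAbs_snd_le_sz n
    have b1 := norm_fst_le y
    have b2 := norm_snd_le y
    rw [Real.norm_eq_abs] at b1 b2
    calc ‖(n.1 : ℝ) * y.1 + n.2 * y.2‖ ≤ |(n.1 : ℝ)| * |y.1| + |(n.2 : ℝ)| * |y.2| := by
          rw [← abs_mul, ← abs_mul]
          exact abs_add_le _ _
      _ ≤ sz n * ‖y‖ + sz n * ‖y‖ := by gcongr
      _ = _ := by ring
  rw [e, ContinuousLinearMap.iteratedFDeriv_comp_right L hgs x (i := k) (by exact_mod_cast le_top)]
  refine (ContinuousMultilinearMap.norm_compContinuousLinearMap_le _ _).trans ?_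
  rw [norm_iteratedFDeriv_eq_norm_iteratedDeriv, hd]
  have : ‖g (L x)‖ = 1 := by
    rw [hg]
    simp only
    rw [mul_comm, Complex.norm_exp_ofReal_mul_I]
  simp only [norm_mul, norm_pow, Complex.norm_I, one_pow, this, one_mul, Finset.prod_const,
    Finset.card_univ, Fintype.card_fin]
  gcongr

/-- The one-dimensional statement is used twice: first for the partial Fourier coefficients in the
second variable, viewed as functions of the first, then for the function in the second variable. -/
theorem eq_zero_of_torusIntegral_expMode_eq_zero {h : ℝ × ℝ → ℂ} (hc : Continuous h)
    (hp : IsPeriodic h) (h0 : ∀ n, torusIntegral (fun x => (expMode n).1 x * h x) = 0)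
    (x : ℝ × ℝ) : h x = 0 := by
  have hpi := Real.two_pi_pos
  have step : ∀ (n2 : ℤ) (a : ℝ),
      ∫ y in 0..2 * Real.pi, Complex.exp (Complex.I * ((n2 * y : ℝ) : ℂ)) * h (a, y) = 0 := by
    intro n2
    refine eq_zero_of_intervalIntegral_exp_eq_zero ?_ ?_ fun n1 => ?_
    · exact intervalIntegral.continuous_parametric_intervalIntegral_of_continuous'
        (f := fun a y => Complex.exp (Complex.I * ((n2 * y : ℝ) : ℂ)) * h (a, y))
        (by simp only [Function.uncurry_def]; fun_prop) _ _
    · intro a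
      simp only
      congr 1
      ext y
      rw [(hp (a, y)).1]
    · have h1 := h0 (n1, n2)
      have hm : Continuous fun x => (expMode (n1, n2)).1 x * h x := (contT _).mul hc
      rw [torusIntegral_eq hm, smul_eq_zero] at h1
      have h2 := h1.resolve_left (by positivity)
      rw [← h2]
      congr 1
      ext a
      rw [← intervalIntegral.integral_const_mul]
      congr 1
      ext y
      rw [expMode_apply, ← mul_assoc, ← Complex.exp_add]
      congr 2
      push_cast
      ring
  have := eq_zero_of_intervalIntegral_exp_eq_zero (g := fun y => h (x.1, y)) (by fun_prop)
    (fun y => (hp (x.1, y)).2) (fun n => step n x.1) x.2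
  exact this

theorem torusIntegral_expMode_mul_tsum {c : ℤ × ℤ → ℂ} (hc : Summable fun n => ‖c n‖) (m : ℤ × ℤ) :
    torusIntegral (fun x => (expMode m).1 x * ∑' n, c n * (expMode n).1 x) = c (-m) := by
  have h2 : HasSum (fun n => torusIntegral fun x => (expMode m).1 x * (c n * (expMode n).1 x))
      (torusIntegral fun x => (expMode m).1 x * ∑' n, c n * (expMode n).1 x) := by
    unfold torusIntegral
    refine HasSum.const_smul _ ?_
    simp_rw [← tsum_mul_left]
    refine hasSum_integral_of_summable_integral_norm (fun n => integrableOn_torusBox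
      ((contT _).mul (continuous_const.mul (contT _)))) ?_
    simp only [norm_mul, norm_expMode, one_mul, mul_one, integral_const]
    exact hc.const_smul _
  have h3 : (fun n => torusIntegral fun x => (expMode m).1 x * (c n * (expMode n).1 x))
      = fun n => if n = -m then c (-m) else 0 := by
    ext n
    have : (fun x => (expMode m).1 x * (c n * (expMode n).1 x))
        = fun x => c n * (expMode (m + n)).1 x := by
      ext x
      rw [← expMode_mul]
      ring
    rw [this, torusIntegral_const_mul, torusIntegral_expMode]
    by_cases hn : n = -m
    · simp [hn]
    · rw [if_neg hn, if_neg, mul_zero]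
      intro h
      exact hn (eq_neg_of_add_eq_zero_right h)
  rw [h3] at h2
  exact h2.unique (hasSum_ite_eq (-m) (c (-m)))

/-- The absolutely convergent series defines a continuous periodic function with the same Fourier
coefficients as f, and the difference vanishes by uniqueness. -/
theorem hasSum_fcoef_mul_expMode (f : SmoothTorus) (x : ℝ × ℝ) :
    HasSum (fun n => fcoef f n * (expMode n).1 x) (f.1 x) := by
  have hs : ∀ x, Summable fun n => fcoef f n * (expMode n).1 x := fun x =>
    Summable.of_norm (by simpa [norm_expMode] using summable_fcoef f)
  set g : ℝ × ℝ → ℂ := fun x => ∑' n, fcoef f n * (expMode n).1 x with hg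
  have hgc : Continuous g := continuous_tsum (fun n => continuous_const.mul (contT (expMode n)))
    (summable_fcoef f) fun n x => by rw [norm_mul, norm_expMode, mul_one]
  have hgp : IsPeriodic g := fun x => by
    simp only [hg, ((expMode _).2.2 x).1, ((expMode _).2.2 x).2, and_self]
  have key : ∀ y, f.1 y - g y = 0 := by
    refine eq_zero_of_torusIntegral_expMode_eq_zero ((contT f).sub hgc) (fun x => ?_) fun m => ?_
    · rw [(f.2.2 x).1, (f.2.2 x).2, (hgp x).1, (hgp x).2]
      exact ⟨rfl, rfl⟩
    · simp only [mul_sub]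
      have hm : Continuous fun x => (expMode m).1 x * g x := (contT _).mul hgc
      rw [torusIntegral_sub (continuous_mulT _ _) hm]
      have h1 : torusIntegral (fun x => (expMode m).1 x * f.1 x) = fcoef f (-m) := by
        rw [fcoef_eq, neg_neg]
      rw [h1, torusIntegral_expMode_mul_tsum (summable_fcoef f), sub_self]
  have := (hs x).hasSum
  rwa [show ∑' n, fcoef f n * (expMode n).1 x = f.1 x from (sub_eq_zero.1 (key x)).symm] at this

/-- Convergence of the Fourier series in every C^N norm, with a tail bound independent of x and of
the finite set's shape. This is the form in which the continuity of a distribution can be applied.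
-/
theorem norm_iteratedFDeriv_sub_partial_le (f : SmoothTorus) (F : Finset (ℤ × ℤ)) {k N : ℕ}
    (hk : k ≤ N) (x : ℝ × ℝ) :
    ‖iteratedFDeriv ℝ k (f - ∑ n ∈ F, fcoef f n • expMode n : SmoothTorus).1 x‖ ≤
      ∑' n : {n // n ∉ F}, 2 ^ N * (((sz n.1 + 1 : ℕ) : ℝ) ^ N * ‖fcoef f n.1‖) := by
  have e : (f - ∑ n ∈ F, fcoef f n • expMode n : SmoothTorus).1
      = fun y => ∑' n : {n // n ∉ F}, fcoef f n.1 * (expMode n.1).1 y := by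
    ext y
    have h1 : (f - ∑ n ∈ F, fcoef f n • expMode n : SmoothTorus).1 y
        = f.1 y - ∑ n ∈ F, fcoef f n * (expMode n).1 y := by
      simp [Finset.sum_apply]
    have h2 := (hasSum_fcoef_mul_expMode f y).summable.sum_add_tsum_subtype_compl F
    rw [h1, ← (hasSum_fcoef_mul_expMode f y).tsum_eq, ← h2, add_sub_cancel_left]
  have hb : ∀ (j : ℕ) (n : {n // n ∉ F}) (y : ℝ × ℝ),
      ‖iteratedFDeriv ℝ j (fun y => fcoef f n.1 * (expMode n.1).1 y) y‖ ≤
        2 ^ j * (((sz n.1 + 1 : ℕ) : ℝ) ^ j * ‖fcoef f n.1‖) := fun j n y => by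
    have e1 : (fun y => fcoef f n.1 * (expMode n.1).1 y) = fcoef f n.1 • (expMode n.1).1 := rfl
    rw [e1, iteratedFDeriv_const_smul_apply
      ((expMode n.1).2.1.of_le (by exact_mod_cast le_top)).contDiffAt, norm_smul]
    calc _ ≤ ‖fcoef f n.1‖ * (2 * sz n.1 : ℝ) ^ j := by
          gcongr
          exact norm_iteratedFDeriv_expMode_le _ _ _
      _ ≤ ‖fcoef f n.1‖ * (2 * ((sz n.1 + 1 : ℕ) : ℝ)) ^ j := by
          gcongr
          omega
      _ = _ := by rw [mul_pow]; ring
  have hs : ∀ j : ℕ, Summable fun n : {n // n ∉ F} =>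
      2 ^ j * (((sz n.1 + 1 : ℕ) : ℝ) ^ j * ‖fcoef f n.1‖) := fun j =>
    ((summable_pow_mul_fcoef f j).mul_left _).comp_injective Subtype.val_injective
  rw [e, iteratedFDeriv_tsum_apply (N := (⊤ : ℕ∞)) (v := fun j (n : {n // n ∉ F}) =>
      2 ^ j * (((sz n.1 + 1 : ℕ) : ℝ) ^ j * ‖fcoef f n.1‖))
    (fun n => contDiff_const.mul (expMode n.1).2.1) (fun j _ => hs j) (fun j n y _ => hb j n y)
    (by exact_mod_cast le_top)]
  refine tsum_of_norm_bounded (hs N).hasSum fun n => (hb k n x).trans ?_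
  have h1 : (1 : ℝ) ≤ ((sz n.1 + 1 : ℕ) : ℝ) := by
    push_cast
    linarith [(Nat.cast_nonneg (sz n.1) : (0 : ℝ) ≤ _)]
  gcongr
  · norm_num

/-- A distribution is bounded by finitely many derivatives and the Fourier series of f converges in
the corresponding norm, so the distribution may be applied termwise. It is thus determined by its
Fourier coefficients. -/
theorem torusDistribution_hasSum (L : TorusDistribution) (f : SmoothTorus) :
    HasSum (fun n => fcoef f n * fourierCoeff L (-n)) (L.1 f) := by
  obtain ⟨C, N, h⟩ := L.2
  unfold HasSum
  have hlim : Tendsto (fun F : Finset (ℤ × ℤ) => |C| * ∑' n : {n // n ∉ F},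
      2 ^ N * (((sz n.1 + 1 : ℕ) : ℝ) ^ N * ‖fcoef f n.1‖)) (atTop) (𝓝 0) := by
    simpa using (tendsto_tsum_compl_atTop_zero fun n : ℤ × ℤ =>
      2 ^ N * (((sz n + 1 : ℕ) : ℝ) ^ N * ‖fcoef f n‖)).const_mul |C|
  rw [SummationFilter.unconditional_filter, tendsto_iff_norm_sub_tendsto_zero]
  refine squeeze_zero (fun _ => norm_nonneg _) (fun F => ?_) hlim
  have h1 := h (f - ∑ n ∈ F, fcoef f n • expMode n) _ fun k hk x =>
    norm_iteratedFDeriv_sub_partial_le f F hk x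
  rw [map_sub, map_sum] at h1
  simp only [map_smul, smul_eq_mul] at h1
  rw [norm_sub_rev]
  simp only [fourierCoeff, neg_neg]
  refine h1.trans (mul_le_mul_of_nonneg_right (le_abs_self C) (tsum_nonneg fun n => by positivity))

theorem torusDistribution_ext {L L' : TorusDistribution} (h : ∀ n, fourierCoeff L n = fourierCoeff L' n) :
    L = L' := by
  refine Subtype.ext (LinearMap.ext fun f => ?_)
  refine (torusDistribution_hasSum L f).unique ?_
  simp only [h]
  exact torusDistribution_hasSum L' f

/-- Bounded Fourier coefficients give a distribution of order at most 3, because three derivatives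
make the coefficients of the test function summable over ℤ². -/
theorem norm_torusDistribution_le {L : TorusDistribution} {B : ℝ} (hL : ∀ n, ‖fourierCoeff L n‖ ≤ B)
    {f : SmoothTorus} {M : ℝ} (h : ∀ j ≤ 3, ∀ x, ‖iteratedFDeriv ℝ j f.1 x‖ ≤ M) :
    ‖L.1 f‖ ≤ B * (8 * (∑' n : ℤ × ℤ, (((sz n + 1 : ℕ) : ℝ) ^ 3)⁻¹) * M) := by
  have hB : 0 ≤ B := (norm_nonneg _).trans (hL 0)
  rw [← (torusDistribution_hasSum L f).tsum_eq]
  calc _ ≤ ∑' n, B * ‖fcoef f n‖ := by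
        refine tsum_of_norm_bounded ((summable_fcoef f).mul_left B).hasSum fun n => ?_
        rw [norm_mul, mul_comm]
        gcongr
        exact hL _
    _ = B * ∑' n, ‖fcoef f n‖ := tsum_mul_left
    _ ≤ _ := by
        gcongr
        exact tsum_norm_fcoef_le h

/-- The distribution with given bounded Fourier coefficients. -/
def ofCoeff (c : ℤ × ℤ → ℂ) (B : ℝ) (hc : ∀ n, ‖c n‖ ≤ B) : TorusDistribution :=
  have hs : ∀ f, Summable fun n => fcoef f n * c (-n) := fun f => by
    refine Summable.of_norm_bounded ((summable_fcoef f).mul_right B) fun n => ?_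
    rw [norm_mul]
    gcongr
    exact hc _
  ⟨{  toFun := fun f => ∑' n, fcoef f n * c (-n)
      map_add' := fun f g => by
        rw [← (hs f).tsum_add (hs g)]
        simp only [fcoef, map_add, add_mul]
      map_smul' := fun a f => by
        simp only [fcoef, map_smul, smul_eq_mul, RingHom.id_apply, mul_assoc]
        rw [tsum_mul_left] },
    by
      refine ⟨B * (8 * ∑' n : ℤ × ℤ, (((sz n + 1 : ℕ) : ℝ) ^ 3)⁻¹), 3, fun f M hM => ?_⟩
      have hB : 0 ≤ B := (norm_nonneg _).trans (hc 0)
      calc ‖∑' n, fcoef f n * c (-n)‖ ≤ ∑' n, ‖fcoef f n‖ * B := by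
            refine tsum_of_norm_bounded ((summable_fcoef f).mul_right B).hasSum fun n => ?_
            rw [norm_mul]
            gcongr
            exact hc _
        _ = B * ∑' n, ‖fcoef f n‖ := by rw [tsum_mul_right, mul_comm]
        _ ≤ B * (8 * (∑' n : ℤ × ℤ, (((sz n + 1 : ℕ) : ℝ) ^ 3)⁻¹) * M) := by
            gcongr
            exact tsum_norm_fcoef_le hM
        _ = _ := by ring⟩

theorem fourierCoeff_ofCoeff (c : ℤ × ℤ → ℂ) (B : ℝ) (hc : ∀ n, ‖c n‖ ≤ B) (n : ℤ × ℤ) :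
    fourierCoeff (ofCoeff c B hc) n = c n := by
  have : fourierCoeff (ofCoeff c B hc) n = ∑' m, fcoef (expMode (-n)) m * c (-m) := rfl
  rw [this, tsum_eq_single (-n)]
  · simp [fcoef_expMode]
  · intro m hm
    rw [fcoef_expMode, if_neg (Ne.symm hm), zero_mul]

theorem fourierCoeff_sub (L L' : TorusDistribution) (n : ℤ × ℤ) :
    fourierCoeff (L - L') n = fourierCoeff L n - fourierCoeff L' n := rfl

theorem flNorm_eq (s : ℝ) (p : ℝ≥0∞) (L : TorusDistribution) :
    flNorm s p L = lpn p fun n => brW s n * ‖fourierCoeff L n‖ₑ := by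
  rw [flNorm, lpn, ← eLpNorm_enorm]
  congr 1
  ext n
  have := Real.rpow_nonneg (zero_le_one.trans (one_le_japaneseBracket n)) s
  rw [weightedCoeff, enorm_mul, brW, ← ofReal_norm (Complex.ofReal _), Complex.norm_real,
    Real.norm_of_nonneg this]

/-! ## From space-time frequencies to functions of time -/

/-- Dominated convergence for counting measure, applied to p-th powers. -/
theorem tendsto_lpn_zero {ι X : Type*} [Countable ι] [MeasurableSpace ι]
    [MeasurableSingletonClass ι] {p : ℝ≥0∞} (h0 : p ≠ 0) (h : p ≠ ⊤) {l : Filter X}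
    [l.IsCountablyGenerated] {F : X → ι → ℝ≥0∞} {G : ι → ℝ≥0∞} (hG : lpn p G ≠ ⊤)
    (hF : ∀ x i, F x i ≤ G i) (hlim : ∀ i, Tendsto (fun x => F x i) l (𝓝 0)) :
    Tendsto (fun x => lpn p (F x)) l (𝓝 0) := by
  have hP := ENNReal.toReal_pos h0 h
  have h1 : Tendsto (fun x => ∫⁻ i, F x i ^ p.toReal ∂Measure.count) l
      (𝓝 (∫⁻ _, 0 ∂(Measure.count : Measure ι))) := by
    refine tendsto_lintegral_filter_of_dominated_convergence (fun i => G i ^ p.toReal)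
      (Eventually.of_forall fun x => .of_discrete)
      (Eventually.of_forall fun x => Eventually.of_forall fun i => ?_) ?_
      (Eventually.of_forall fun i => ?_)
    · exact ENNReal.rpow_le_rpow (hF x i) hP.le
    · rw [lintegral_count, ← lpn_rpow h0 h]
      exact ENNReal.rpow_ne_top_of_nonneg hP.le hG
    · have := (ENNReal.continuous_rpow_const (y := p.toReal)).tendsto 0 |>.comp (hlim i)
      rwa [ENNReal.zero_rpow_of_pos hP] at this
  simp only [lintegral_zero] at h1
  have h2 := (ENNReal.continuous_rpow_const (y := 1 / p.toReal)).tendsto 0 |>.comp h1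
  rw [ENNReal.zero_rpow_of_pos (by positivity)] at h2
  refine h2.congr fun x => ?_
  simp only [Function.comp_apply]
  rw [lintegral_count, lpn_eq h0 h]

/-- The sum of the moduli over the temporal frequencies. -/
def amp (A : Freq → ℂ) (n : ℤ × ℤ) : ℝ≥0∞ := ∑' l : ℤ, ‖A (n, l)‖ₑ

/-- The function of time with temporal frequencies `A (n, ·)`. -/
def timeFun (A : Freq → ℂ) (t : ℝ) (n : ℤ × ℤ) : ℂ :=
  ∑' l : ℤ, A (n, l) * Complex.exp (Complex.I * (lam l * t : ℝ))

theorem norm_exp_I_mul (x : ℝ) : ‖Complex.exp (Complex.I * x)‖ = 1 := by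
  rw [mul_comm, Complex.norm_exp_ofReal_mul_I]

theorem enorm_exp_I_mul (x : ℝ) : ‖Complex.exp (Complex.I * x)‖ₑ = 1 := by
  rw [← ofReal_norm, norm_exp_I_mul, ENNReal.ofReal_one]

theorem enorm_timeFun_le (A : Freq → ℂ) (t : ℝ) (n : ℤ × ℤ) : ‖timeFun A t n‖ₑ ≤ amp A n := by
  refine enorm_tsum_le_tsum_enorm.trans (le_of_eq (tsum_congr fun l => ?_))
  rw [enorm_mul, enorm_exp_I_mul, mul_one]

theorem summable_norm_of_amp {A : Freq → ℂ} {n : ℤ × ℤ} (h : amp A n ≠ ⊤) :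
    Summable fun l => ‖A (n, l)‖ := by
  have := ENNReal.summable_toReal h
  simpa using this

theorem summable_timeFun {A : Freq → ℂ} {n : ℤ × ℤ} (h : amp A n ≠ ⊤) (t : ℝ) :
    Summable fun l : ℤ => A (n, l) * Complex.exp (Complex.I * (lam l * t : ℝ)) := by
  refine Summable.of_norm ((summable_norm_of_amp h).congr fun l => ?_)
  rw [norm_mul, norm_exp_I_mul, mul_one]

theorem timeFun_sub {A B : Freq → ℂ} {n : ℤ × ℤ} (hA : amp A n ≠ ⊤) (hB : amp B n ≠ ⊤) (t : ℝ) :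
    timeFun A t n - timeFun B t n = timeFun (A - B) t n := by
  unfold timeFun
  rw [← (summable_timeFun hA t).tsum_sub (summable_timeFun hB t)]
  simp only [Pi.sub_apply, sub_mul]

theorem continuous_timeFun {A : Freq → ℂ} {n : ℤ × ℤ} (h : amp A n ≠ ⊤) :
    Continuous fun t => timeFun A t n := by
  refine continuous_tsum (fun l => ?_) (summable_norm_of_amp h) fun l t => ?_
  · fun_prop
  · rw [norm_mul, norm_exp_I_mul, mul_one]

/-- The embedding into continuous functions of time: since 1/λ ∈ ℓ^Q, Hölder bounds the ℓ¹ norm in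
the temporal frequency by the weighted ℓ^p norm, for each n separately. -/
theorem exists_lpn_amp_le {p : ℝ≥0∞} {s Q : ℝ} (E : Exponents p s Q) :
    ∃ C : ℝ≥0∞, C ≠ ⊤ ∧ ∀ (v : ℤ × ℤ → ℝ≥0∞) (A : Freq → ℂ),
      lpn p (fun n => v n * amp A n) ≤ C * xn p v A := by
  have hQ := E.conj.symm.pos
  refine ⟨(∑' l, lamW l ^ (-Q)) ^ (1 / Q), ENNReal.rpow_ne_top_of_nonneg (by positivity)
    (tsum_lamW_ne_top E.one_lt_conj), fun v A => ?_⟩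
  rw [xn, ← lpn_fiber E.ne_zero E.ne_top, ← lpn_const_mul E.ne_zero E.ne_top]
  refine lpn_mono fun n => ?_
  refine le_trans (le_of_eq ?_) ((tsum_div_lamW_le E.conj
    (fun m => v n * lamW m * ‖A (n, m)‖ₑ)).trans_eq (mul_comm _ _))
  rw [amp, ← ENNReal.tsum_mul_left]
  refine tsum_congr fun m => ?_
  rw [mul_right_comm, mul_div_assoc, ENNReal.div_self (lamW_ne_zero m) (lamW_ne_top m), mul_one]

theorem Exponents.s_nonneg {p : ℝ≥0∞} {s Q : ℝ} (E : Exponents p s Q) : 0 ≤ s := by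
  have h1 := E.lt_mul
  have h2 := E.one_lt_conj
  by_contra h
  push Not at h
  nlinarith

theorem one_le_brW {s : ℝ} (hs : 0 ≤ s) (n : ℤ × ℤ) : 1 ≤ brW s n := by
  rw [brW, ENNReal.one_le_ofReal]
  exact Real.one_le_rpow (one_le_japaneseBracket n) hs

theorem amp_ne_top {p : ℝ≥0∞} {s Q : ℝ} (E : Exponents p s Q) {A : Freq → ℂ}
    (hA : xn p (brW s) A ≠ ⊤) (n : ℤ × ℤ) : amp A n ≠ ⊤ := by
  obtain ⟨C, hC, h⟩ := exists_lpn_amp_le E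
  have h1 := ne_top_of_le_ne_top (ENNReal.mul_ne_top hC hA)
    ((le_lpn E.ne_zero E.ne_top (fun n => brW s n * amp A n) n).trans (h _ _))
  exact fun h2 => h1 (by rw [h2, ENNReal.mul_top (brW_ne_zero s n)])

/-- The symbol of `-□`. -/
def symb (n : ℤ × ℤ) : ℝ := (n.1 : ℝ) ^ 2 - (n.2 : ℝ) ^ 2

/-- The Fourier coefficients, at time `t`, of the solution with space-time frequencies `A`. -/
def evol (M : ℕ) (A : Freq → ℂ) (t : ℝ) (n : ℤ × ℤ) : ℂ :=
  Complex.exp (Complex.I * (-(symb n) * t : ℝ)) * timeFun A (M * t) n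

theorem enorm_evol_le (M : ℕ) (A : Freq → ℂ) (t : ℝ) (n : ℤ × ℤ) :
    ‖evol M A t n‖ₑ ≤ amp A n := by
  rw [evol, enorm_mul, enorm_exp_I_mul, one_mul]
  exact enorm_timeFun_le A _ n

theorem evol_sub (M : ℕ) {A B : Freq → ℂ} {n : ℤ × ℤ} (hA : amp A n ≠ ⊤) (hB : amp B n ≠ ⊤)
    (t : ℝ) : evol M A t n - evol M B t n = evol M (A - B) t n := by
  rw [evol, evol, evol, ← timeFun_sub hA hB, mul_sub]

theorem continuous_evol (M : ℕ) {A : Freq → ℂ} {n : ℤ × ℤ} (h : amp A n ≠ ⊤) :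
    Continuous fun t => evol M A t n := by
  have := (continuous_timeFun h).comp (continuous_const_mul (M : ℝ))
  exact Continuous.mul (by fun_prop) this

theorem norm_le_of_lpn {p : ℝ≥0∞} {s : ℝ} (h0 : p ≠ 0) (h : p ≠ ⊤) (hs : 0 ≤ s) {c : ℤ × ℤ → ℂ}
    (hc : lpn p (fun n => brW s n * ‖c n‖ₑ) ≠ ⊤) (n : ℤ × ℤ) :
    ‖c n‖ ≤ (lpn p fun n => brW s n * ‖c n‖ₑ).toReal := by
  have h1 := le_lpn h0 h (fun n => brW s n * ‖c n‖ₑ) n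
  have h2 : ‖c n‖ₑ ≤ lpn p fun n => brW s n * ‖c n‖ₑ :=
    (le_mul_of_one_le_left zero_le (one_le_brW hs n)).trans h1
  rw [← toReal_enorm]
  exact ENNReal.toReal_mono hc h2

/-- The element of `ℱL^{s,p}` with given Fourier coefficients. -/
def flOfCoeff {p : ℝ≥0∞} {s Q : ℝ} (E : Exponents p s Q) (c : ℤ × ℤ → ℂ)
    (hc : lpn p (fun n => brW s n * ‖c n‖ₑ) ≠ ⊤) : FL s p :=
  ⟨ofCoeff c _ (norm_le_of_lpn E.ne_zero E.ne_top E.s_nonneg hc), by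
    have : flNorm s p (ofCoeff c _ (norm_le_of_lpn E.ne_zero E.ne_top E.s_nonneg hc)) < ⊤ := by
      rw [flNorm_eq]
      simp only [fourierCoeff_ofCoeff]
      exact lt_top_iff_ne_top.2 hc
    exact this⟩

theorem fourierCoeff_flOfCoeff {p : ℝ≥0∞} {s Q : ℝ} (E : Exponents p s Q) (c : ℤ × ℤ → ℂ)
    (hc : lpn p (fun n => brW s n * ‖c n‖ₑ) ≠ ⊤) (n : ℤ × ℤ) :
    fourierCoeff (flOfCoeff E c hc).1 n = c n :=
  fourierCoeff_ofCoeff c _ (norm_le_of_lpn E.ne_zero E.ne_top E.s_nonneg hc) n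

theorem lpn_evol_ne_top {p : ℝ≥0∞} {s Q : ℝ} (E : Exponents p s Q) (M : ℕ) {A : Freq → ℂ}
    (hA : xn p (brW s) A ≠ ⊤) (t : ℝ) : lpn p (fun n => brW s n * ‖evol M A t n‖ₑ) ≠ ⊤ := by
  obtain ⟨C, hC, h⟩ := exists_lpn_amp_le E
  refine ne_top_of_le_ne_top (ENNReal.mul_ne_top hC hA) (le_trans (lpn_mono fun n => ?_) (h _ _))
  gcongr
  exact enorm_evol_le M A t n

/-- The curve in `ℱL^{s,p}` with space-time frequencies `A`. -/
def evolFL {p : ℝ≥0∞} {s Q : ℝ} [Fact (1 ≤ p)] (E : Exponents p s Q) (M : ℕ) (T : ℝ) (A : Freq → ℂ)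
    (hA : xn p (brW s) A ≠ ⊤) : C(Icc (0 : ℝ) T, FL s p) where
  toFun t := flOfCoeff E (evol M A t) (lpn_evol_ne_top E M hA t)
  continuous_toFun := by
    obtain ⟨C, hC, h⟩ := exists_lpn_amp_le E
    refine continuous_iff_continuousAt.2 fun t₀ => ?_
    rw [ContinuousAt, tendsto_iff_edist_tendsto_0]
    have e : ∀ t : Icc (0 : ℝ) T, edist (flOfCoeff E (evol M A t) (lpn_evol_ne_top E M hA t))
        (flOfCoeff E (evol M A t₀) (lpn_evol_ne_top E M hA t₀)) =
        lpn p fun n => brW s n * ‖evol M A t n - evol M A t₀ n‖ₑ := fun t => by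
      change flNorm s p _ = _
      rw [flNorm_eq]
      simp only [fourierCoeff_sub, fourierCoeff_flOfCoeff]
    simp_rw [e]
    -- Continuity in time by dominated convergence: each Fourier coefficient is continuous, and
    -- differences are bounded by twice the time-independent amplitude.
    refine tendsto_lpn_zero E.ne_zero E.ne_top (G := fun n => 2 * (brW s n * amp A n)) ?_
      (fun t n => ?_) fun n => ?_
    · rw [lpn_const_mul E.ne_zero E.ne_top]
      exact ENNReal.mul_ne_top (by simp) (ne_top_of_le_ne_top (ENNReal.mul_ne_top hC hA) (h _ _))
    · calc _ ≤ brW s n * (amp A n + amp A n) := by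
            gcongr
            exact enorm_sub_le.trans (add_le_add (enorm_evol_le M A t n) (enorm_evol_le M A t₀ n))
        _ = _ := by ring
    · have h1 : Tendsto (fun t : Icc (0 : ℝ) T => evol M A t n - evol M A t₀ n) (𝓝 t₀) (𝓝 0) := by
        rw [← sub_self (evol M A t₀ n)]
        exact (((continuous_evol M (amp_ne_top E hA n)).comp continuous_subtype_val).tendsto
          t₀).sub_const _
      have h2 := ENNReal.Tendsto.const_mul (a := brW s n) h1.enorm (Or.inr (brW_ne_top s n))
      simpa using h2

theorem fourierCoeff_evolFL {p : ℝ≥0∞} {s Q : ℝ} [Fact (1 ≤ p)] (E : Exponents p s Q) (M : ℕ)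
    (T : ℝ) (A : Freq → ℂ) (hA : xn p (brW s) A ≠ ⊤) (t : Icc (0 : ℝ) T) (n : ℤ × ℤ) :
    fourierCoeff (evolFL E M T A hA t).1 n = evol M A t n :=
  fourierCoeff_flOfCoeff E _ (lpn_evol_ne_top E M hA t) n

theorem flNorm_sub_le_of_evol {p : ℝ≥0∞} {s Q : ℝ} (E : Exponents p s Q) {C : ℝ≥0∞}
    (hC : ∀ (v : ℤ × ℤ → ℝ≥0∞) (A : Freq → ℂ), lpn p (fun n => v n * amp A n) ≤ C * xn p v A)
    {M : ℕ} {A B : Freq → ℂ} (hA : xn p (brW s) A ≠ ⊤) (hB : xn p (brW s) B ≠ ⊤)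
    {f g : TorusDistribution} {t : ℝ} (hf : ∀ n, fourierCoeff f n = evol M A t n)
    (hg : ∀ n, fourierCoeff g n = evol M B t n) :
    flNorm s p (f - g) ≤ C * xn p (brW s) (A - B) := by
  rw [flNorm_eq]
  refine le_trans (lpn_mono fun n => ?_) (hC _ _)
  rw [fourierCoeff_sub, hf, hg, evol_sub M (amp_ne_top E hA n) (amp_ne_top E hB n)]
  gcongr
  exact enorm_evol_le _ _ _ _

/-! ## The equation in Fourier variables -/

/-- The Fourier coefficients of `u v̄ w` in terms of those of `u`, `v`, `w`. -/
def conv3 (f g h : ℤ × ℤ → ℂ) (n : ℤ × ℤ) : ℂ :=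
  ∑' q : (ℤ × ℤ) × (ℤ × ℤ), f (n - q.1) * (starRingEnd ℂ) (g (n - q.1 - q.2)) * h (n - q.2)

theorem tsum_conv_le (F G H : ℤ × ℤ → ℝ≥0∞) (n : ℤ × ℤ) :
    ∑' q : (ℤ × ℤ) × (ℤ × ℤ), F (n - q.1) * G (n - q.1 - q.2) * H (n - q.2)
      ≤ (∑' m, F m) * (∑' m, G m) * ∑' m, H m := by
  have e : ∀ X : ℤ × ℤ → ℝ≥0∞, ∑' m, X (n - m) = ∑' m, X m := fun X =>
    (Equiv.subLeft n).tsum_eq X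
  calc _ ≤ ∑' q : (ℤ × ℤ) × (ℤ × ℤ), F (n - q.1) * (∑' m, G m) * H (n - q.2) := by
        refine ENNReal.tsum_le_tsum fun q => ?_
        gcongr
        exact ENNReal.le_tsum _
    _ = _ := by
        conv_lhs => rw [ENNReal.tsum_prod']
        simp_rw [ENNReal.tsum_mul_left, ENNReal.tsum_mul_right, e]

/-- The temporal frequency produced by an interaction. -/
def freqShift (M : ℕ) (j : TriIdx) : ℝ := (j.1.1 - j.1.2.1 + j.1.2.2 : ℤ) + 2 * hyp j.2.1 j.2.2 / M

theorem phase_eq (M : ℕ) (l : ℤ) (j : TriIdx) : phase M l j = l - freqShift M j := by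
  rw [phase, freqShift]
  ring

/-- The expansion of e^{iνt} multiplied by e^{it/2}, so that half-integer frequencies appear on both
sides. -/
theorem hasSum_cutoffHat_mul_exp_lam (ν : ℝ) {t : ℝ} (ht : |t| ≤ 2) :
    HasSum (fun l : ℤ => cutoffHat (l - ν) * Complex.exp (Complex.I * (lam l * t : ℝ)))
      (Complex.exp (Complex.I * ((ν + 1 / 2) * t : ℝ))) := by
  have h := (hasSum_cutoffHat ν t ht).mul_right (Complex.exp (Complex.I * (t / 2 : ℝ)))
  convert! h using 1
  · ext l
    rw [mul_assoc, ← Complex.exp_add]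
    congr 2
    rw [lam]
    push_cast
    ring
  · rw [← Complex.exp_add]
    congr 1
    push_cast
    ring

theorem hasSum_cutoffHat_lam {t : ℝ} (ht : |t| ≤ 2) :
    HasSum (fun l : ℤ => cutoffHat (lam l) * Complex.exp (Complex.I * (lam l * t : ℝ))) 1 := by
  have h := hasSum_cutoffHat_mul_exp_lam (-(1 / 2)) ht
  simpa [lam] using h

theorem exists_tsum_cutoffHat_le :
    ∃ K : ℝ≥0∞, K ≠ ⊤ ∧ ∀ ν : ℝ, ∑' l : ℤ, ‖cutoffHat (l - ν)‖ₑ ≤ K := by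
  obtain ⟨c, hc, h⟩ := exists_cutoffHat_enorm_le
  obtain ⟨B, hB, h'⟩ := exists_tsum_decay_le
  refine ⟨c * B, by finiteness, fun ν => ?_⟩
  calc _ ≤ ∑' l : ℤ, c * decay (l - ν) := ENNReal.tsum_le_tsum fun l => h _
    _ = c * ∑' l : ℤ, decay (l - ν) := ENNReal.tsum_mul_left
    _ ≤ _ := by
        gcongr
        exact h' ν

/-- The product of the amplitudes in an interaction. -/
def triProd (A : Freq → ℂ) (n : ℤ × ℤ) (j : TriIdx) : ℂ :=
  A (slot₁ n j) * (starRingEnd ℂ) (A (slot₂ n j)) * A (slot₃ n j)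

section Smooth

variable {A : Freq → ℂ}

theorem tsum_triProd_ne_top (hA : ∑' n, amp A n ≠ ⊤) (n : ℤ × ℤ) :
    ∑' j, ‖triProd A n j‖ₑ ≠ ⊤ := by
  refine ne_top_of_le_ne_top (ENNReal.mul_ne_top (ENNReal.mul_ne_top hA hA) hA)
    (le_trans (le_of_eq ?_) (tsum_conv_le (amp A) (amp A) (amp A) n))
  conv_lhs => rw [ENNReal.tsum_prod', ENNReal.tsum_comm]
  refine tsum_congr fun q => ?_
  conv_lhs => rw [ENNReal.tsum_prod']
  have : ∀ (a b c : ℤ), ‖triProd A n ((a, b, c), q)‖ₑ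
      = ‖A (n - q.1, a)‖ₑ * ‖A (n - q.1 - q.2, b)‖ₑ * ‖A (n - q.2, c)‖ₑ := fun a b c => by
    simp [triProd, slot₁, slot₂, slot₃, enorm_mul]
  have h2 : ∀ a : ℤ, ∑' bc : ℤ × ℤ, ‖triProd A n ((a, bc), q)‖ₑ
      = ‖A (n - q.1, a)‖ₑ * amp A (n - q.1 - q.2) * amp A (n - q.2) := fun a => by
    rw [ENNReal.tsum_prod']
    simp only [this]
    simp_rw [ENNReal.tsum_mul_left, ENNReal.tsum_mul_right, ENNReal.tsum_mul_left]
    rfl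
  simp_rw [h2, ENNReal.tsum_mul_right]
  rfl

theorem summable_triProd (hA : ∑' n, amp A n ≠ ⊤) (n : ℤ × ℤ) :
    Summable fun j => ‖triProd A n j‖ := by
  simpa using ENNReal.summable_toReal (tsum_triProd_ne_top hA n)

theorem summable_cutoffHat_mul_triProd (hA : ∑' n, amp A n ≠ ⊤) (M : ℕ) (n : ℤ × ℤ) :
    Summable fun x : TriIdx × ℤ => ‖cutoffHat (phase M x.2 x.1) * triProd A n x.1‖ := by
  obtain ⟨K, hK, h⟩ := exists_tsum_cutoffHat_le
  have h1 : ∑' x : TriIdx × ℤ, ‖cutoffHat (phase M x.2 x.1) * triProd A n x.1‖ₑ ≠ ⊤ := by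
    conv_lhs => rw [ENNReal.tsum_prod']
    refine ne_top_of_le_ne_top (ENNReal.mul_ne_top hK (tsum_triProd_ne_top hA n)) ?_
    rw [← ENNReal.tsum_mul_left]
    refine ENNReal.tsum_le_tsum fun j => ?_
    simp only [enorm_mul, phase_eq]
    rw [ENNReal.tsum_mul_right]
    gcongr
    exact h _
  simpa using ENNReal.summable_toReal h1

theorem summable_cubicConv_time (hA : ∑' n, amp A n ≠ ⊤) (M : ℕ) (n : ℤ × ℤ) :
    Summable fun l : ℤ => ‖cubicConv M A A A (n, l)‖ := by
  have h := (summable_cutoffHat_mul_triProd hA M n).prod_symm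
  refine Summable.of_nonneg_of_le (fun _ => norm_nonneg _) (fun l => ?_) h.prod
  exact norm_tsum_le_tsum_norm (h.prod_factor l)

theorem freqShift_exp (M : ℕ) (n : ℤ × ℤ) (j : TriIdx) (t : ℝ) :
    triProd A n j * Complex.exp (Complex.I * ((freqShift M j + 1 / 2) * t : ℝ)) =
      Complex.exp (Complex.I * (2 * hyp j.2.1 j.2.2 / M * t : ℝ)) *
      ((A (slot₁ n j) * Complex.exp (Complex.I * (lam j.1.1 * t : ℝ))) *
        (starRingEnd ℂ) (A (slot₂ n j) * Complex.exp (Complex.I * (lam j.1.2.1 * t : ℝ))) *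
        (A (slot₃ n j) * Complex.exp (Complex.I * (lam j.1.2.2 * t : ℝ)))) := by
  have e : Complex.exp (Complex.I * ((freqShift M j + 1 / 2) * t : ℝ)) =
      Complex.exp (Complex.I * (2 * hyp j.2.1 j.2.2 / M * t : ℝ)) *
      (Complex.exp (Complex.I * (lam j.1.1 * t : ℝ)) *
        Complex.exp (-(Complex.I * (lam j.1.2.1 * t : ℝ))) *
        Complex.exp (Complex.I * (lam j.1.2.2 * t : ℝ))) := by
    simp only [← Complex.exp_add]
    congr 1
    rw [freqShift, lam, lam, lam]
    push_cast
    ring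
  rw [e, map_mul, ← Complex.exp_conj, map_mul, Complex.conj_I, Complex.conj_ofReal, triProd, neg_mul]
  ring

/-- For |t| ≤ 2 the cutoff is invisible: summing the kernel over the output frequency restores the
exact oscillation at the combined frequency. Absolute summability of the amplitudes over all of ℤ²,
available for smooth data, justifies the interchange, and the three temporal sums then factor. -/
theorem tsum_cubicConv_exp (hA : ∑' n, amp A n ≠ ⊤) (M : ℕ) (n : ℤ × ℤ) {t : ℝ} (ht : |t| ≤ 2) :
    ∑' l : ℤ, cubicConv M A A A (n, l) * Complex.exp (Complex.I * (lam l * t : ℝ)) =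
      ∑' q : (ℤ × ℤ) × (ℤ × ℤ), Complex.exp (Complex.I * (2 * hyp q.1 q.2 / M * t : ℝ)) *
        (timeFun A t (n - q.1) * (starRingEnd ℂ) (timeFun A t (n - q.1 - q.2))
          * timeFun A t (n - q.2)) := by
  have ha : ∀ n, amp A n ≠ ⊤ := fun n => ENNReal.ne_top_of_tsum_ne_top hA n
  have h1 : Summable fun x : TriIdx × ℤ => cutoffHat (phase M x.2 x.1) * triProd A n x.1 *
      Complex.exp (Complex.I * (lam x.2 * t : ℝ)) := by
    refine Summable.of_norm ((summable_cutoffHat_mul_triProd hA M n).congr fun x => ?_)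
    rw [norm_mul _ (Complex.exp _), norm_exp_I_mul, mul_one]
  have h2 : ∑' l : ℤ, cubicConv M A A A (n, l) * Complex.exp (Complex.I * (lam l * t : ℝ)) =
      ∑' l : ℤ, ∑' j : TriIdx, cutoffHat (phase M l j) * triProd A n j *
        Complex.exp (Complex.I * (lam l * t : ℝ)) :=
    tsum_congr fun l => tsum_mul_right.symm
  have h3 : ∀ j : TriIdx, ∑' l : ℤ, cutoffHat (phase M l j) * triProd A n j *
      Complex.exp (Complex.I * (lam l * t : ℝ))
      = triProd A n j * Complex.exp (Complex.I * ((freqShift M j + 1 / 2) * t : ℝ)) := fun j => by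
    rw [← ((hasSum_cutoffHat_mul_exp_lam (freqShift M j) ht).mul_left (triProd A n j)).tsum_eq]
    refine tsum_congr fun l => ?_
    rw [phase_eq]
    ring
  have hsj : Summable fun j : TriIdx =>
      triProd A n j * Complex.exp (Complex.I * ((freqShift M j + 1 / 2) * t : ℝ)) := by
    refine Summable.of_norm ((summable_triProd hA n).congr fun j => ?_)
    rw [norm_mul, norm_exp_I_mul, mul_one]
  rw [h2, h1.tsum_comm (f := fun (j : TriIdx) (l : ℤ) => cutoffHat (phase M l j) * triProd A n j *
    Complex.exp (Complex.I * (lam l * t : ℝ)))]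
  simp_rw [h3]
  rw [← (Equiv.prodComm ((ℤ × ℤ) × (ℤ × ℤ)) (ℤ × ℤ × ℤ)).tsum_eq]
  have hsw : Summable fun x : ((ℤ × ℤ) × (ℤ × ℤ)) × (ℤ × ℤ × ℤ) => triProd A n (x.2, x.1) *
      Complex.exp (Complex.I * ((freqShift M (x.2, x.1) + 1 / 2) * t : ℝ)) :=
    hsj.comp_injective (Equiv.prodComm ((ℤ × ℤ) × (ℤ × ℤ)) (ℤ × ℤ × ℤ)).injective
  refine hsw.tsum_prod.trans (tsum_congr fun q => ?_)
  set f₁ := fun a : ℤ => A (n - q.1, a) * Complex.exp (Complex.I * (lam a * t : ℝ))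
  set f₂ := fun b : ℤ => (starRingEnd ℂ) (A (n - q.1 - q.2, b) *
    Complex.exp (Complex.I * (lam b * t : ℝ)))
  set f₃ := fun c : ℤ => A (n - q.2, c) * Complex.exp (Complex.I * (lam c * t : ℝ))
  have s₁ : Summable fun a => ‖f₁ a‖ := (summable_timeFun (ha _) t).norm
  have s₂ : Summable fun a => ‖f₂ a‖ := by
    simpa [f₂] using (summable_timeFun (ha (n - q.1 - q.2)) t).norm
  have s₃ : Summable fun a => ‖f₃ a‖ := (summable_timeFun (ha _) t).norm
  have e2 : (starRingEnd ℂ) (timeFun A t (n - q.1 - q.2)) = ∑' b, f₂ b := by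
    rw [timeFun, Complex.conj_tsum]
  rw [e2]
  change _ = _ * ((∑' a, f₁ a) * (∑' b, f₂ b) * (∑' c, f₃ c))
  rw [mul_assoc (∑' a, f₁ a), tsum_mul_tsum_of_summable_norm s₂ s₃,
    tsum_mul_tsum_of_summable_norm s₁ (s₂.mul_norm s₃), ← tsum_mul_left]
  refine tsum_congr fun x => ?_
  rw [freqShift_exp]
  simp only [f₁, f₂, f₃, slot₁, slot₂, slot₃]
  ring

/-- For |t| ≤ 2 the coefficients `cutoffHat (lam l)` synthesize the constant 1, so the fixed point
equation reads a(n) + (i/M) Σ F_l (e^{iλ_l t} - 1)/(iλ_l). This is differentiated termwise, the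
derivative series being dominated by Σ|F_l|. -/
theorem hasDerivAt_timeFun {a : ℤ × ℤ → ℂ} {M : ℕ} (hA : ∑' n, amp A n ≠ ⊤)
    (hfix : A = picard M a A) (n : ℤ × ℤ) {t : ℝ} (ht : |t| < 2) :
    HasDerivAt (fun t => timeFun A t n) (Complex.I / M * ∑' l : ℤ, cubicConv M A A A (n, l) *
      Complex.exp (Complex.I * (lam l * t : ℝ))) t ∧ timeFun A 0 n = a n := by
  set F := fun l : ℤ => cubicConv M A A A (n, l) with hF
  have hFs : Summable fun l => ‖F l‖ := summable_cubicConv_time hA M n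
  have hlam : ∀ l, (1 : ℝ) / 2 ≤ |lam l| := fun l => by
    have := natAbs_succ_le_four_mul_abs_lam l
    rcases abs_cases (lam l) with h | h <;> rw [h.1] <;> unfold lam at * <;>
    · rcases le_or_gt 0 l with h0 | h0
      · have : (0 : ℝ) ≤ l := by exact_mod_cast h0
        linarith
      · have : (l : ℝ) ≤ -1 := by exact_mod_cast (by omega : l ≤ -1)
        linarith
  have hGs : Summable fun l => F l / (Complex.I * lam l) := by
    refine Summable.of_norm_bounded (hFs.mul_left 2) fun l => ?_
    rw [norm_div, norm_mul, Complex.norm_I, one_mul, Complex.norm_real, Real.norm_eq_abs,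
      div_le_iff₀ (by linarith [hlam l])]
    nlinarith [norm_nonneg (F l), hlam l]
  have hGse : ∀ t : ℝ, Summable fun l =>
      F l / (Complex.I * lam l) * Complex.exp (Complex.I * (lam l * t : ℝ)) := fun t => by
    refine Summable.of_norm (hGs.norm.congr fun l => ?_)
    rw [norm_mul _ (Complex.exp _), norm_exp_I_mul, mul_one]
  have key : ∀ t : ℝ, |t| ≤ 2 → timeFun A t n = a n + Complex.I / M *
      ∑' l, (F l / (Complex.I * lam l) * Complex.exp (Complex.I * (lam l * t : ℝ))
        - F l / (Complex.I * lam l)) := by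
    intro t ht
    rw [(hGse t).tsum_sub hGs]
    have h1 := hasSum_cutoffHat_lam ht
    have h2 := (h1.mul_right (a n)).add ((((hGse t).hasSum).sub
      (h1.mul_right (∑' m : ℤ, F m / (Complex.I * lam m)))).mul_left (Complex.I / M))
    rw [one_mul, one_mul] at h2
    rw [timeFun, ← h2.tsum_eq]
    refine tsum_congr fun l => ?_
    have h3 : A (n, l) = cutoffHat (lam l) * a n + Complex.I / M * (F l / (Complex.I * lam l)
        - cutoffHat (lam l) * ∑' m : ℤ, F m / (Complex.I * lam m)) := by
      conv_lhs => rw [hfix]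
      rfl
    rw [h3]
    ring
  refine ⟨?_, by simpa using key 0 (by norm_num)⟩
  have hd := hasDerivAt_tsum (u := fun l => ‖F l‖)
    (g := fun l t => F l / (Complex.I * lam l) * Complex.exp (Complex.I * (lam l * t : ℝ))
        - F l / (Complex.I * lam l))
    (g' := fun l t => F l * Complex.exp (Complex.I * (lam l * t : ℝ))) (y₀ := t) hFs
    (fun l t => ?_) (fun l t => ?_) ((hGse t).sub hGs) t
  · refine ((hd.const_mul (Complex.I / M)).const_add (a n)).congr_of_eventuallyEq ?_
    have : ∀ᶠ y in 𝓝 t, |y| < 2 := continuous_abs.continuousAt.eventually_lt_const ht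
    filter_upwards [this] with y hy using key y hy.le
  · have h0 : (lam l : ℂ) ≠ 0 := by exact_mod_cast lam_ne_zero l
    have := (((((hasDerivAt_id t).const_mul (lam l)).ofReal_comp).const_mul
      Complex.I).cexp.const_mul (F l / (Complex.I * lam l))).sub_const (F l / (Complex.I * lam l))
    convert! this using 1
    simp only [id]
    field_simp
  · rw [norm_mul, norm_exp_I_mul, mul_one]

/-- The resonance identity. The phase of a cubic interaction depends only on hyp(m,k), which is why
the arithmetic is organized by its level sets. -/
theorem symb_add (n m k : ℤ × ℤ) :
    symb (n - m) - symb (n - m - k) + symb (n - k) = symb n - 2 * hyp m k := by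
  simp only [symb, hyp, Prod.fst_sub, Prod.snd_sub]
  push_cast
  ring

/-- Returning from the slowed time Mt to t cancels the factor 1/M, and the resonance identity
absorbs the oscillating factors into the linear phases of the three frequencies. -/
theorem hasDerivAt_evol {a : ℤ × ℤ → ℂ} {M : ℕ} (hM : M ≠ 0) (hA : ∑' n, amp A n ≠ ⊤)
    (hfix : A = picard M a A) (n : ℤ × ℤ) {t : ℝ} (ht : |M * t| < 2) :
    HasDerivAt (fun t => evol M A t n) (-Complex.I * symb n * evol M A t n
      + Complex.I * conv3 (evol M A t) (evol M A t) (evol M A t) n) t := by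
  have hM' : (M : ℂ) ≠ 0 := by exact_mod_cast hM
  have h1 := (hasDerivAt_timeFun hA hfix n ht).1.scomp t ((hasDerivAt_id t).const_mul (M : ℝ))
  have h2 := ((((hasDerivAt_id t).const_mul (-(symb n))).ofReal_comp).const_mul
      Complex.I).cexp
  have h3 := h2.mul h1
  rw [tsum_cubicConv_exp hA M n ht.le] at h3
  convert! h3 using 1
  simp only [id, Function.comp_def]
  congr 1
  · rw [evol]
    push_cast
    ring
  · rw [mul_one, Complex.real_smul, conv3]
    rw [show ∀ X : ℂ, Complex.exp (Complex.I * ((-symb n * t : ℝ) : ℂ)) * (((M : ℝ) : ℂ) *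
      (Complex.I / M * X)) = Complex.I * (Complex.exp (Complex.I * ((-symb n * t : ℝ) : ℂ)) * X) by
        intro X
        push_cast
        field_simp]
    refine congrArg (Complex.I * ·) ?_
    rw [← tsum_mul_left]
    refine tsum_congr fun q => ?_
    simp only [evol, map_mul, ← Complex.exp_conj, Complex.conj_I, Complex.conj_ofReal]
    have e : Complex.exp (Complex.I * (-(symb (n - q.1)) * t : ℝ)) *
        Complex.exp (-Complex.I * (-(symb (n - q.1 - q.2)) * t : ℝ)) *
        Complex.exp (Complex.I * (-(symb (n - q.2)) * t : ℝ)) =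
        Complex.exp (Complex.I * (-(symb n) * t : ℝ)) *
        Complex.exp (Complex.I * (2 * hyp q.1 q.2 / M * (M * t) : ℝ)) := by
      simp only [← Complex.exp_add]
      congr 1
      have := symb_add n q.1 q.2
      have h' : symb n = symb (n - q.1) - symb (n - q.1 - q.2) + symb (n - q.2)
        + 2 * hyp q.1 q.2 := by linarith
      rw [h']
      push_cast
      field_simp
      ring
    linear_combination (timeFun A (M * t) (n - q.1) *
      (starRingEnd ℂ) (timeFun A (M * t) (n - q.1 - q.2)) * timeFun A (M * t) (n - q.2)) * e

theorem evol_zero {a : ℤ × ℤ → ℂ} {M : ℕ} (hA : ∑' n, amp A n ≠ ⊤)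
    (hfix : A = picard M a A) (n : ℤ × ℤ) : evol M A 0 n = a n := by
  rw [evol, mul_zero, mul_zero, (hasDerivAt_timeFun hA hfix n (t := 0) (by norm_num)).2]
  simp

end Smooth

/-! ## Families of Fourier coefficients depending smoothly on time -/

/-- Rapid decay in the frequency, uniformly in time. -/
def RapidOn (J : Set ℝ) (f : ℤ × ℤ → ℝ → ℂ) : Prop :=
  ∀ k : ℕ, ∃ C : ℝ, 0 ≤ C ∧ ∀ n, ∀ t ∈ J, ((sz n + 1 : ℕ) : ℝ) ^ k * ‖f n t‖ ≤ C

/-- The Fourier coefficients of the cubic product of three families. -/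
def famConv (f g h : ℤ × ℤ → ℝ → ℂ) (n : ℤ × ℤ) (t : ℝ) : ℂ :=
  conv3 (fun m => f m t) (fun m => g m t) (fun m => h m t) n

theorem sz_succ_le (n m k : ℤ × ℤ) :
    sz n + 1 ≤ (sz (n - m) + 1) * (sz (n - m - k) + 1) * (sz (n - k) + 1) := by
  have h : n = (n - m) + (-(n - m - k) + (n - k)) := by abel
  have h1 : sz n ≤ sz (n - m) + (sz (n - m - k) + sz (n - k)) := by
    conv_lhs => rw [h]
    refine (sz_add_le _ _).trans (Nat.add_le_add_left ((sz_add_le _ _).trans ?_) _)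
    rw [sz_neg]
  nlinarith [Nat.zero_le (sz (n - m) * sz (n - m - k)), Nat.zero_le (sz (n - m) * sz (n - k)),
    Nat.zero_le (sz (n - m - k) * sz (n - k)),
    Nat.zero_le (sz (n - m) * sz (n - m - k) * sz (n - k))]

section

variable {J : Set ℝ} {f g h : ℤ × ℤ → ℝ → ℂ}

theorem RapidOn.add (hf : RapidOn J f) (hg : RapidOn J g) :
    RapidOn J fun n t => f n t + g n t := fun k => by
  obtain ⟨C, hC, h1⟩ := hf k
  obtain ⟨D, hD, h2⟩ := hg k
  refine ⟨C + D, by positivity, fun n t ht => ?_⟩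
  calc _ ≤ ((sz n + 1 : ℕ) : ℝ) ^ k * (‖f n t‖ + ‖g n t‖) := by
        gcongr
        exact norm_add_le _ _
    _ ≤ C + D := by
        rw [mul_add]
        exact add_le_add (h1 n t ht) (h2 n t ht)

theorem RapidOn.multiplier (hf : RapidOn J f) {c : ℤ × ℤ → ℂ} {N : ℕ} {B : ℝ} (hB : 0 ≤ B)
    (hc : ∀ n, ‖c n‖ ≤ B * ((sz n + 1 : ℕ) : ℝ) ^ N) : RapidOn J fun n t => c n * f n t := fun k => by
  obtain ⟨C, hC, h1⟩ := hf (k + N)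
  refine ⟨B * C, by positivity, fun n t ht => ?_⟩
  rw [norm_mul]
  calc _ ≤ ((sz n + 1 : ℕ) : ℝ) ^ k * (B * ((sz n + 1 : ℕ) : ℝ) ^ N * ‖f n t‖) := by
        gcongr
        exact hc n
    _ = B * (((sz n + 1 : ℕ) : ℝ) ^ (k + N) * ‖f n t‖) := by ring
    _ ≤ _ := by
        gcongr
        exact h1 n t ht

theorem RapidOn.exists_bound (hf : RapidOn J f) :
    ∃ u : ℤ × ℤ → ℝ, Summable u ∧ ∀ n, ∀ t ∈ J, ‖f n t‖ ≤ u n := by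
  obtain ⟨C, hC, h1⟩ := hf 3
  refine ⟨_, summable_sz_pow.mul_left C, fun n t ht => ?_⟩
  have h0 : (0 : ℝ) < ((sz n + 1 : ℕ) : ℝ) ^ 3 := by positivity
  rw [← div_eq_mul_inv, le_div_iff₀ h0, mul_comm]
  exact h1 n t ht

/-- The polynomial weight is distributed over the three factors. The first and third keep three
extra powers for summability in the two differences, and the middle one needs only to be bounded. -/
theorem RapidOn.exists_bound_conv (hf : RapidOn J f) (hg : RapidOn J g) (hh : RapidOn J h) (k : ℕ) :
    ∃ C, 0 ≤ C ∧ ∀ n, ∃ u : (ℤ × ℤ) × (ℤ × ℤ) → ℝ, Summable u ∧ ∑' q, u q = C ∧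
      ∀ q, ∀ t ∈ J, ((sz n + 1 : ℕ) : ℝ) ^ k *
        ‖f (n - q.1) t * (starRingEnd ℂ) (g (n - q.1 - q.2) t) * h (n - q.2) t‖ ≤ u q := by
  obtain ⟨C₁, hC₁, h₁⟩ := hf (k + 3)
  obtain ⟨C₂, hC₂, h₂⟩ := hg k
  obtain ⟨C₃, hC₃, h₃⟩ := hh (k + 3)
  set Z := ∑' n : ℤ × ℤ, (((sz n + 1 : ℕ) : ℝ) ^ 3)⁻¹ with hZ
  have e : ∀ n : ℤ × ℤ, ∑' m : ℤ × ℤ, (((sz (n - m) + 1 : ℕ) : ℝ) ^ 3)⁻¹ = Z := fun n =>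
    (Equiv.subLeft n).tsum_eq fun m : ℤ × ℤ => (((sz m + 1 : ℕ) : ℝ) ^ 3)⁻¹
  have es : ∀ n : ℤ × ℤ, Summable fun m : ℤ × ℤ => (((sz (n - m) + 1 : ℕ) : ℝ) ^ 3)⁻¹ := fun n =>
    (Equiv.subLeft n).summable_iff.2 summable_sz_pow
  have esn : ∀ n : ℤ × ℤ, Summable fun m : ℤ × ℤ => ‖(((sz (n - m) + 1 : ℕ) : ℝ) ^ 3)⁻¹‖ := fun n =>
    (es n).norm
  refine ⟨C₁ * C₂ * C₃ * (Z * Z), ?_, fun n => ⟨fun q => C₁ * C₂ * C₃ *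
    ((((sz (n - q.1) + 1 : ℕ) : ℝ) ^ 3)⁻¹ * (((sz (n - q.2) + 1 : ℕ) : ℝ) ^ 3)⁻¹), ?_, ?_, ?_⟩⟩
  · have : 0 ≤ Z := tsum_nonneg fun n => by positivity
    positivity
  · exact ((summable_mul_of_summable_norm (esn n) (esn n))).mul_left _
  · rw [tsum_mul_left, ← e n]
    conv_rhs => rw [tsum_mul_tsum_of_summable_norm (esn n) (esn n)]
  · intro q t ht
    have h4 : ((sz n + 1 : ℕ) : ℝ) ≤ ((sz (n - q.1) + 1 : ℕ) : ℝ) *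
        ((sz (n - q.1 - q.2) + 1 : ℕ) : ℝ) * ((sz (n - q.2) + 1 : ℕ) : ℝ) := by
      exact_mod_cast sz_succ_le n q.1 q.2
    set a := ((sz (n - q.1) + 1 : ℕ) : ℝ)
    set b := ((sz (n - q.1 - q.2) + 1 : ℕ) : ℝ)
    set c := ((sz (n - q.2) + 1 : ℕ) : ℝ)
    have ha : 0 < a := by positivity
    have hb : 0 < b := by positivity
    have hc : 0 < c := by positivity
    have i1 : a ^ k * ‖f (n - q.1) t‖ ≤ C₁ * (a ^ 3)⁻¹ := by
      rw [← div_eq_mul_inv, le_div_iff₀ (by positivity)]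
      calc _ = a ^ (k + 3) * ‖f (n - q.1) t‖ := by ring
        _ ≤ _ := h₁ _ t ht
    have i3 : c ^ k * ‖h (n - q.2) t‖ ≤ C₃ * (c ^ 3)⁻¹ := by
      rw [← div_eq_mul_inv, le_div_iff₀ (by positivity)]
      calc _ = c ^ (k + 3) * ‖h (n - q.2) t‖ := by ring
        _ ≤ _ := h₃ _ t ht
    rw [norm_mul, norm_mul, RCLike.norm_conj]
    calc _ ≤ (a * b * c) ^ k * (‖f (n - q.1) t‖ * ‖g (n - q.1 - q.2) t‖ * ‖h (n - q.2) t‖) := by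
          gcongr
      _ = (a ^ k * ‖f (n - q.1) t‖) * (b ^ k * ‖g (n - q.1 - q.2) t‖) * (c ^ k * ‖h (n - q.2) t‖) := by
          rw [mul_pow, mul_pow]
          ring
      _ ≤ (C₁ * (a ^ 3)⁻¹) * C₂ * (C₃ * (c ^ 3)⁻¹) := by
          gcongr
          exact h₂ _ t ht
      _ = _ := by ring

theorem RapidOn.conv (hf : RapidOn J f) (hg : RapidOn J g) (hh : RapidOn J h) :
    RapidOn J (famConv f g h) := fun k => by
  obtain ⟨C, hC, H⟩ := hf.exists_bound_conv hg hh k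
  refine ⟨C, hC, fun n t ht => ?_⟩
  obtain ⟨u, hu, huC, hb⟩ := H n
  have hN : ‖((((sz n + 1 : ℕ) : ℝ) ^ k : ℝ) : ℂ)‖ = ((sz n + 1 : ℕ) : ℝ) ^ k := by
    rw [Complex.norm_real, Real.norm_of_nonneg (by positivity)]
  rw [← huC, ← hN, ← norm_mul, famConv, conv3, ← tsum_mul_left]
  refine tsum_of_norm_bounded hu.hasSum fun q => ?_
  rw [norm_mul, hN]
  exact hb q t ht

theorem RapidOn.summable_conv (hf : RapidOn J f) (hg : RapidOn J g) (hh : RapidOn J h)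
    (n : ℤ × ℤ) : ∃ u : (ℤ × ℤ) × (ℤ × ℤ) → ℝ, Summable u ∧ ∀ q, ∀ t ∈ J,
      ‖f (n - q.1) t * (starRingEnd ℂ) (g (n - q.1 - q.2) t) * h (n - q.2) t‖ ≤ u q := by
  obtain ⟨C, _, H⟩ := hf.exists_bound_conv hg hh 0
  obtain ⟨u, hu, _, hb⟩ := H n
  exact ⟨u, hu, fun q t ht => by simpa using hb q t ht⟩

/-- Families of coefficients with `k` time derivatives, all of rapid decay. -/
def SmoothFam (J : Set ℝ) : ℕ → (ℤ × ℤ → ℝ → ℂ) → Prop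
  | 0, f => RapidOn J f ∧ ∀ n, ContinuousOn (f n) J
  | k + 1, f => RapidOn J f ∧ ∃ g, SmoothFam J k g ∧ ∀ n, ∀ t ∈ J, HasDerivAt (f n) (g n t) t

theorem SmoothFam.rapid {k : ℕ} (hf : SmoothFam J k f) : RapidOn J f := by
  cases k with
  | zero => exact hf.1
  | succ k => exact hf.1

theorem SmoothFam.continuousOn {k : ℕ} (hf : SmoothFam J k f) (n : ℤ × ℤ) :
    ContinuousOn (f n) J := by
  cases k with
  | zero => exact hf.2 n
  | succ k =>
    obtain ⟨_, g, _, h⟩ := hf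
    exact fun t ht => (h n t ht).continuousAt.continuousWithinAt

theorem SmoothFam.pred {k : ℕ} (hf : SmoothFam J (k + 1) f) : SmoothFam J k f := by
  induction k generalizing f with
  | zero => exact ⟨hf.rapid, hf.continuousOn⟩
  | succ k ih =>
    obtain ⟨h1, g, h2, h3⟩ := hf
    exact ⟨h1, g, ih h2, h3⟩

theorem SmoothFam.add {k : ℕ} (hf : SmoothFam J k f) (hg : SmoothFam J k g) :
    SmoothFam J k fun n t => f n t + g n t := by
  induction k generalizing f g with
  | zero => exact ⟨hf.rapid.add hg.rapid, fun n => (hf.2 n).add (hg.2 n)⟩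
  | succ k ih =>
    obtain ⟨h1, f', h2, h3⟩ := hf
    obtain ⟨i1, g', i2, i3⟩ := hg
    exact ⟨h1.add i1, _, ih h2 i2, fun n t ht => (h3 n t ht).add (i3 n t ht)⟩

theorem SmoothFam.multiplier {k : ℕ} (hf : SmoothFam J k f) {c : ℤ × ℤ → ℂ} {N : ℕ} {B : ℝ}
    (hB : 0 ≤ B) (hc : ∀ n, ‖c n‖ ≤ B * ((sz n + 1 : ℕ) : ℝ) ^ N) :
    SmoothFam J k fun n t => c n * f n t := by
  induction k generalizing f with
  | zero => exact ⟨hf.rapid.multiplier hB hc, fun n => continuousOn_const.mul (hf.2 n)⟩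
  | succ k ih =>
    obtain ⟨h1, f', h2, h3⟩ := hf
    exact ⟨h1.multiplier hB hc, _, ih h2, fun n t ht => (h3 n t ht).const_mul _⟩

/-- By induction on k with the product rule. Termwise differentiation needs the open, preconnected
time set and a summable majorant of the derivatives, which rapid decay supplies. -/
theorem SmoothFam.conv {k : ℕ} (hJ : IsOpen J) (hJ' : IsPreconnected J) (hf : SmoothFam J k f)
    (hg : SmoothFam J k g) (hh : SmoothFam J k h) : SmoothFam J k (famConv f g h) := by
  induction k generalizing f g h with
  | zero =>
    refine ⟨hf.rapid.conv hg.rapid hh.rapid, fun n => ?_⟩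
    obtain ⟨u, hu, hb⟩ := hf.rapid.summable_conv hg.rapid hh.rapid n
    refine continuousOn_tsum (fun q => ?_) hu fun q t ht => hb q t ht
    exact ((hf.2 _).mul (Complex.continuous_conj.comp_continuousOn (hg.2 _))).mul (hh.2 _)
  | succ k ih =>
    refine ⟨hf.rapid.conv hg.rapid hh.rapid, ?_⟩
    have hf0 := hf.pred
    have hg0 := hg.pred
    have hh0 := hh.pred
    obtain ⟨-, f', f2, f3⟩ := hf
    obtain ⟨-, g', g2, g3⟩ := hg
    obtain ⟨-, h', h2, h3⟩ := hh
    refine ⟨_, ((ih f2 hg0 hh0).add (ih hf0 g2 hh0)).add (ih hf0 hg0 h2), fun n t ht => ?_⟩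
    obtain ⟨u₁, hu₁, hb₁⟩ := f2.rapid.summable_conv hg0.rapid hh0.rapid n
    obtain ⟨u₂, hu₂, hb₂⟩ := hf0.rapid.summable_conv g2.rapid hh0.rapid n
    obtain ⟨u₃, hu₃, hb₃⟩ := hf0.rapid.summable_conv hg0.rapid h2.rapid n
    obtain ⟨u, hu, hb⟩ := hf0.rapid.summable_conv hg0.rapid hh0.rapid n
    have key := hasDerivAt_tsum_of_isPreconnected (u := fun q => u₁ q + u₂ q + u₃ q)
      (g := fun (q : (ℤ × ℤ) × (ℤ × ℤ)) t =>
        f (n - q.1) t * (starRingEnd ℂ) (g (n - q.1 - q.2) t) * h (n - q.2) t)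
      (g' := fun q t => f' (n - q.1) t * (starRingEnd ℂ) (g (n - q.1 - q.2) t) * h (n - q.2) t
        + f (n - q.1) t * (starRingEnd ℂ) (g' (n - q.1 - q.2) t) * h (n - q.2) t
        + f (n - q.1) t * (starRingEnd ℂ) (g (n - q.1 - q.2) t) * h' (n - q.2) t)
      ((hu₁.add hu₂).add hu₃) hJ hJ' (fun q t ht => ?_) (fun q t ht => ?_) ht
      (Summable.of_norm_bounded hu fun q => hb q t ht) ht
    · refine key.congr_deriv ?_
      have s₁ := Summable.of_norm_bounded hu₁ fun q => hb₁ q t ht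
      have s₂ := Summable.of_norm_bounded hu₂ fun q => hb₂ q t ht
      have s₃ := Summable.of_norm_bounded hu₃ fun q => hb₃ q t ht
      rw [(s₁.add s₂).tsum_add s₃, s₁.tsum_add s₂]
      rfl
    · have := ((f3 (n - q.1) t ht).mul (g3 (n - q.1 - q.2) t ht).star).mul (h3 (n - q.2) t ht)
      convert! this using 1
      simp only [starRingEnd_apply, Pi.mul_apply]
      ring
    · exact (norm_add_le _ _).trans (add_le_add ((norm_add_le _ _).trans
        (add_le_add (hb₁ q t ht) (hb₂ q t ht))) (hb₃ q t ht))

/-- The function on space-time with Fourier coefficients `f n t`. -/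
def series (f : ℤ × ℤ → ℝ → ℂ) (q : ℝ × (ℝ × ℝ)) : ℂ := ∑' n, f n q.1 * (expMode n).1 q.2

theorem summable_series (hf : RapidOn J f) {t : ℝ} (ht : t ∈ J) (x : ℝ × ℝ) :
    Summable fun n => f n t * (expMode n).1 x := by
  obtain ⟨u, hu, hb⟩ := hf.exists_bound
  refine Summable.of_norm_bounded hu fun n => ?_
  rw [norm_mul, norm_expMode, mul_one]
  exact hb n t ht

theorem norm_I_mul_fst_le (n : ℤ × ℤ) : ‖Complex.I * (n.1 : ℂ)‖ ≤ 1 * ((sz n + 1 : ℕ) : ℝ) ^ 1 := by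
  have := natAbs_fst_le_sz n
  rw [norm_mul, Complex.norm_I, one_mul, one_mul, pow_one, Complex.norm_intCast]
  push_cast
  linarith

theorem norm_I_mul_snd_le (n : ℤ × ℤ) : ‖Complex.I * (n.2 : ℂ)‖ ≤ 1 * ((sz n + 1 : ℕ) : ℝ) ^ 1 := by
  have := natAbs_snd_le_sz n
  rw [norm_mul, Complex.norm_I, one_mul, one_mul, pow_one, Complex.norm_intCast]
  push_cast
  linarith

/-- The differential on space-time with given partial derivatives. -/
def mkDiff (a b c : ℂ) : ℝ × (ℝ × ℝ) →L[ℝ] ℂ :=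
  ContinuousLinearMap.smulRightL ℝ _ ℂ (ContinuousLinearMap.fst ℝ ℝ (ℝ × ℝ)) a +
  ContinuousLinearMap.smulRightL ℝ _ ℂ ((ContinuousLinearMap.fst ℝ ℝ ℝ).comp
    (ContinuousLinearMap.snd ℝ ℝ (ℝ × ℝ))) b +
  ContinuousLinearMap.smulRightL ℝ _ ℂ ((ContinuousLinearMap.snd ℝ ℝ ℝ).comp
    (ContinuousLinearMap.snd ℝ ℝ (ℝ × ℝ))) c

theorem mkDiff_apply (a b c : ℂ) (v : ℝ × (ℝ × ℝ)) :
    mkDiff a b c v = v.1 * a + v.2.1 * b + v.2.2 * c := by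
  simp [mkDiff]

theorem norm_mkDiff_le (a b c : ℂ) : ‖mkDiff a b c‖ ≤ ‖a‖ + ‖b‖ + ‖c‖ := by
  refine ContinuousLinearMap.opNorm_le_bound _ (by positivity) fun v => ?_
  rw [mkDiff_apply]
  have h1 := norm_fst_le v
  have h2 := (norm_fst_le v.2).trans (norm_snd_le v)
  have h3 := (norm_snd_le v.2).trans (norm_snd_le v)
  refine (norm_add₃_le).trans ?_
  simp only [norm_mul, Complex.norm_real]
  calc _ ≤ ‖v‖ * ‖a‖ + ‖v‖ * ‖b‖ + ‖v‖ * ‖c‖ := by gcongr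
    _ = _ := by ring

theorem hasFDerivAt_series (hJ : IsOpen J) (hJ' : IsPreconnected J) (hf : RapidOn J f)
    (hg : RapidOn J g) (hd : ∀ n, ∀ t ∈ J, HasDerivAt (f n) (g n t) t) {q : ℝ × (ℝ × ℝ)}
    (hq : q.1 ∈ J) :
    HasFDerivAt (series f) (mkDiff (series g q) (series (fun n t => Complex.I * n.1 * f n t) q)
      (series (fun n t => Complex.I * n.2 * f n t) q)) q := by
  have hf1 := hf.multiplier zero_le_one norm_I_mul_fst_le
  have hf2 := hf.multiplier zero_le_one norm_I_mul_snd_le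
  obtain ⟨u₀, hu₀, hb₀⟩ := hg.exists_bound
  obtain ⟨u₁, hu₁, hb₁⟩ := hf1.exists_bound
  obtain ⟨u₂, hu₂, hb₂⟩ := hf2.exists_bound
  have hq' : q ∈ J ×ˢ (univ : Set (ℝ × ℝ)) := ⟨hq, mem_univ _⟩
  have key := hasFDerivAt_tsum_of_isPreconnected (𝕜 := ℝ) (u := fun n => u₀ n + u₁ n + u₂ n)
    (f := fun n (q : ℝ × (ℝ × ℝ)) => f n q.1 * (expMode n).1 q.2)
    (f' := fun n q => mkDiff (g n q.1 * (expMode n).1 q.2)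
      (Complex.I * n.1 * f n q.1 * (expMode n).1 q.2)
      (Complex.I * n.2 * f n q.1 * (expMode n).1 q.2)) ((hu₀.add hu₁).add hu₂)
    (hJ.prod isOpen_univ) (hJ'.prod isPreconnected_univ) (fun n q hq => ?_) (fun n q hq => ?_) hq'
    (summable_series hf hq q.2) hq'
  · refine key.congr_fderiv ?_
    refine HasSum.tsum_eq ?_
    exact ((ContinuousLinearMap.hasSum _ (summable_series hg hq q.2).hasSum).add
      (ContinuousLinearMap.hasSum _ (summable_series hf1 hq q.2).hasSum)).add
      (ContinuousLinearMap.hasSum _ (summable_series hf2 hq q.2).hasSum)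
  · have h1 : HasFDerivAt (fun q : ℝ × (ℝ × ℝ) => f n q.1) _ q :=
      (hd n q.1 hq.1).hasFDerivAt.comp q hasFDerivAt_fst
    have h2 : HasFDerivAt (fun q : ℝ × (ℝ × ℝ) => (expMode n).1 q.2) _ q :=
      ((diffT (expMode n)) q.2).hasFDerivAt.comp q hasFDerivAt_snd
    refine (h1.mul h2).congr_fderiv ?_
    ext <;>
    · simp [mkDiff_apply, ← pd_apply, pd_expMode]
      try ring
  · refine (norm_mkDiff_le _ _ _).trans ?_
    simp only [norm_mul _ ((expMode n).1 q.2), norm_expMode, mul_one]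
    exact add_le_add (add_le_add (hb₀ n _ hq.1) (hb₁ n _ hq.1)) (hb₂ n _ hq.1)

/-- Time derivatives stay in the scale by definition, and spatial derivatives act as multipliers of
polynomial growth, harmless under rapid decay. All first partials are thus again series of the same
kind with one order less to prove. -/
theorem SmoothFam.contDiffOn (hJ : IsOpen J) (hJ' : IsPreconnected J) {k : ℕ}
    (hf : SmoothFam J k f) : ContDiffOn ℝ k (series f) (J ×ˢ univ) := by
  induction k generalizing f with
  | zero =>
    rw [Nat.cast_zero, contDiffOn_zero]
    obtain ⟨u, hu, hb⟩ := hf.rapid.exists_bound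
    refine continuousOn_tsum (fun n => ?_) hu fun n q hq => ?_
    · exact ((hf.2 n).comp continuousOn_fst fun q hq => hq.1).mul
        ((contT (expMode n)).comp continuous_snd).continuousOn
    · rw [norm_mul, norm_expMode, mul_one]
      exact hb n _ hq.1
  | succ k ih =>
    have hf0 := hf.pred
    obtain ⟨h1, g, h2, h3⟩ := hf
    have hd : ∀ q ∈ J ×ˢ (univ : Set (ℝ × ℝ)), HasFDerivAt (series f) _ q := fun q hq =>
      hasFDerivAt_series hJ hJ' h1 h2.rapid h3 hq.1
    rw [Nat.cast_succ, contDiffOn_succ_iff_fderiv_of_isOpen (hJ.prod isOpen_univ)]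
    refine ⟨fun q hq => (hd q hq).differentiableAt.differentiableWithinAt, by simp, ?_⟩
    refine ContDiffOn.congr ?_ fun q hq => (hd q hq).fderiv
    exact ((ContinuousLinearMap.contDiff _).comp_contDiffOn (ih h2)).add
      ((ContinuousLinearMap.contDiff _).comp_contDiffOn
        (ih (hf0.multiplier zero_le_one norm_I_mul_fst_le))) |>.add
      ((ContinuousLinearMap.contDiff _).comp_contDiffOn
        (ih (hf0.multiplier zero_le_one norm_I_mul_snd_le)))

/-- The parametrization of the triples of frequencies by the output frequency and two
differences. -/
def triEquiv : (ℤ × ℤ) × ((ℤ × ℤ) × (ℤ × ℤ)) ≃ (ℤ × ℤ) × ((ℤ × ℤ) × (ℤ × ℤ)) where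
  toFun z := (z.1 - z.2.1, (z.1 - z.2.1 - z.2.2, z.1 - z.2.2))
  invFun z := (z.1 - z.2.1 + z.2.2, (z.2.2 - z.2.1, z.1 - z.2.1))
  left_inv z := by
    refine Prod.ext ?_ (Prod.ext ?_ ?_) <;> simp only <;> abel
  right_inv z := by
    refine Prod.ext ?_ (Prod.ext ?_ ?_) <;> simp only <;> abel

theorem tsum_mul_tsum_mul_tsum {F G H : ℤ × ℤ → ℂ} (sF : Summable fun n => ‖F n‖)
    (sG : Summable fun n => ‖G n‖) (sH : Summable fun n => ‖H n‖) :
    (∑' n, F n) * ((∑' n, G n) * ∑' n, H n) = ∑' n, ∑' q : (ℤ × ℤ) × (ℤ × ℤ),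
      F (n - q.1) * (G (n - q.1 - q.2) * H (n - q.2)) := by
  have h1 : Summable fun y : (ℤ × ℤ) × (ℤ × ℤ) => ‖G y.1 * H y.2‖ := sG.mul_norm sH
  have h2 := summable_mul_of_summable_norm sF h1
  have hsum : Summable fun z : (ℤ × ℤ) × ((ℤ × ℤ) × (ℤ × ℤ)) => F z.1 * (G z.2.1 * H z.2.2) := h2
  have hsum' : Summable fun z : (ℤ × ℤ) × ((ℤ × ℤ) × (ℤ × ℤ)) =>
      F (z.1 - z.2.1) * (G (z.1 - z.2.1 - z.2.2) * H (z.1 - z.2.2)) := triEquiv.summable_iff.2 hsum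
  have e2 : ∑' z : (ℤ × ℤ) × ((ℤ × ℤ) × (ℤ × ℤ)),
      F (z.1 - z.2.1) * (G (z.1 - z.2.1 - z.2.2) * H (z.1 - z.2.2))
      = ∑' z : (ℤ × ℤ) × ((ℤ × ℤ) × (ℤ × ℤ)), F z.1 * (G z.2.1 * H z.2.2) :=
    triEquiv.tsum_eq fun z => F z.1 * (G z.2.1 * H z.2.2)
  rw [tsum_mul_tsum_of_summable_norm sG sH,
    tsum_mul_tsum_of_summable_norm sF h1,
    ← e2, hsum'.tsum_prod]

/-- The product of three absolutely convergent series is regrouped by the output frequency through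
`triEquiv`. -/
theorem series_famConv (hf : RapidOn J f) {t : ℝ} (ht : t ∈ J) (x : ℝ × ℝ) :
    series (famConv f f f) (t, x) = cubic (series f (t, x)) := by
  have hs := summable_series hf ht x
  set F := fun n => f n t * (expMode n).1 x with hF
  set G := fun n => (starRingEnd ℂ) (F n) with hG
  have sF : Summable fun n => ‖F n‖ := hs.norm
  have sG : Summable fun n => ‖G n‖ := by simpa [hG] using hs.norm
  have e1 : cubic (series f (t, x)) = (∑' n, F n) * ((∑' n, G n) * ∑' n, F n) := by
    have : ∑' n, G n = (starRingEnd ℂ) (∑' n, F n) := (Complex.conj_tsum F).symm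
    rw [this, cubic, series, ← Complex.conj_mul']
    ring
  rw [e1, tsum_mul_tsum_mul_tsum sF sG sF]
  unfold series
  refine tsum_congr fun n => ?_
  simp only [famConv, conv3]
  rw [← tsum_mul_right]
  refine tsum_congr fun q => ?_
  simp only [hG, hF, map_mul, conj_expMode]
  have : (expMode n).1 x = (expMode (n - q.1)).1 x * (expMode (-(n - q.1 - q.2))).1 x
      * (expMode (n - q.2)).1 x := by
    have hn : n - q.1 + -(n - q.1 - q.2) + (n - q.2) = n := by abel
    rw [expMode_mul, expMode_mul, hn]
  rw [this]
  ring

end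

/-! ## Persistence of regularity -/

/-- Uses x^p = x·x^{p-1} and bounds each term in the second factor by the full sum. -/
theorem lpn_le_tsum {ι : Type*} [MeasurableSpace ι] [MeasurableSingletonClass ι] {p : ℝ≥0∞}
    (hp : 1 ≤ p) (h : p ≠ ⊤) (F : ι → ℝ≥0∞) : lpn p F ≤ ∑' i, F i := by
  have h0 : p ≠ 0 := (zero_lt_one.trans_le hp).ne'
  have hP := ENNReal.toReal_pos h0 h
  have hP1 : 1 ≤ p.toReal := by
    simpa using (ENNReal.toReal_le_toReal (by simp) h).2 hp
  rw [← ENNReal.rpow_le_rpow_iff hP, lpn_rpow h0 h]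
  set S := ∑' i, F i with hS
  have e : ∀ x : ℝ≥0∞, x ^ p.toReal = x * x ^ (p.toReal - 1) := fun x => by
    conv_rhs => rw [← ENNReal.rpow_one x, ← ENNReal.rpow_mul, one_mul]
    rw [← ENNReal.rpow_add_of_nonneg _ _ zero_le_one (by linarith)]
    congr 1
    ring
  rw [e S]
  calc _ ≤ ∑' i, F i * S ^ (p.toReal - 1) := by
        refine ENNReal.tsum_le_tsum fun i => ?_
        rw [e]
        gcongr
        exact ENNReal.le_tsum i
    _ = _ := ENNReal.tsum_mul_right

theorem brW_le_pow {s : ℝ} (n : ℤ × ℤ) :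
    brW s n ≤ ENNReal.ofReal ((2 * ((sz n + 1 : ℕ) : ℝ)) ^ ⌈s⌉₊) := by
  refine ENNReal.ofReal_le_ofReal ?_
  have h1 := one_le_japaneseBracket n
  calc japaneseBracket n ^ s ≤ japaneseBracket n ^ ((⌈s⌉₊ : ℕ) : ℝ) :=
        Real.rpow_le_rpow_of_exponent_le h1 (Nat.le_ceil s)
    _ = japaneseBracket n ^ ⌈s⌉₊ := Real.rpow_natCast _ _
    _ ≤ _ := by
        gcongr
        exact japaneseBracket_le_two_mul_sz_succ n

theorem lpn_fcoef_ne_top {p : ℝ≥0∞} {s Q : ℝ} (E : Exponents p s Q) (f : SmoothTorus) (k : ℕ) :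
    lpn p (fun n => ENNReal.ofReal (((sz n + 1 : ℕ) : ℝ) ^ k) * (brW s n * ‖fcoef f n‖ₑ)) ≠ ⊤ := by
  refine ne_top_of_le_ne_top ?_ (lpn_le_tsum E.one_le E.ne_top _)
  have hs := (summable_pow_mul_fcoef f (k + ⌈s⌉₊)).mul_left (2 ^ ⌈s⌉₊)
  refine ne_top_of_le_ne_top hs.tsum_ofReal_ne_top (ENNReal.tsum_le_tsum fun n => ?_)
  calc _ ≤ ENNReal.ofReal (((sz n + 1 : ℕ) : ℝ) ^ k) *
        (ENNReal.ofReal ((2 * ((sz n + 1 : ℕ) : ℝ)) ^ ⌈s⌉₊) * ENNReal.ofReal ‖fcoef f n‖) := by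
        rw [ofReal_norm]
        gcongr
        exact brW_le_pow n
    _ = _ := by
        rw [← ENNReal.ofReal_mul (by positivity), ← ENNReal.ofReal_mul (by positivity)]
        congr 1
        rw [mul_pow]
        ring

/-- The weight `(1 + δ |n|)^k`. -/
def dilWt (δ : ℝ) (k : ℕ) (n : ℤ × ℤ) : ℝ≥0∞ := ENNReal.ofReal ((1 + δ * sz n) ^ k)

/-- The triangle inequality bounds δ|n| by the sum of the three sizes times δ, which is at most the
product of the factors 1 + δ|·| minus one; the constant is exactly 1 for every δ. -/
theorem triSubmult_dilWt {δ : ℝ} (hδ : 0 ≤ δ) (k : ℕ) : TriSubmult (dilWt δ k) := fun n m l => by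
  unfold dilWt
  rw [← ENNReal.ofReal_mul (by positivity), ← ENNReal.ofReal_mul (by positivity), ← mul_pow,
    ← mul_pow]
  refine ENNReal.ofReal_le_ofReal (pow_le_pow_left₀ (by positivity) ?_ k)
  have h : n = (n - m) + (-(n - m - l) + (n - l)) := by abel
  have h1 : (sz n : ℝ) ≤ sz (n - m) + (sz (n - m - l) + sz (n - l)) := by
    have : sz n ≤ sz (n - m) + (sz (n - m - l) + sz (n - l)) := by
      conv_lhs => rw [h]
      refine (sz_add_le _ _).trans (Nat.add_le_add_left ((sz_add_le _ _).trans ?_) _)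
      rw [sz_neg]
    exact_mod_cast this
  set a : ℝ := (sz (n - m) : ℝ)
  set b : ℝ := (sz (n - m - l) : ℝ)
  set c : ℝ := (sz (n - l) : ℝ)
  have ha : 0 ≤ a := Nat.cast_nonneg _
  have hb : 0 ≤ b := Nat.cast_nonneg _
  have hc : 0 ≤ c := Nat.cast_nonneg _
  calc 1 + δ * (sz n : ℝ) ≤ 1 + δ * (a + (b + c)) := by gcongr
    _ ≤ 1 + δ * (a + (b + c)) + (δ * δ * (a * b + a * c + b * c) + δ * δ * δ * (a * b * c)) :=
        le_add_of_nonneg_right (by positivity)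
    _ = _ := by ring

/-- As δ → 0 the weight (1+δ|n|)^k tends to 1, and by dominated convergence the weighted norm of
smooth data tends to the unweighted one. A strict smallness condition therefore survives the
insertion of a suitable weight. -/
theorem exists_dilWt_lpn_le {p : ℝ≥0∞} {s Q : ℝ} (E : Exponents p s Q) (f : SmoothTorus) (k : ℕ)
    {K : ℝ≥0∞} (hK : lpn p (fun n => brW s n * ‖fcoef f n‖ₑ) < K) :
    ∃ j : ℕ, lpn p (fun n => dilWt (1 / (j + 1)) k n * brW s n * ‖fcoef f n‖ₑ) ≤ K := by
  have hlim : Tendsto (fun j : ℕ => lpn p fun n => ENNReal.ofReal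
      ((1 + 1 / ((j : ℝ) + 1) * sz n) ^ k - 1) * (brW s n * ‖fcoef f n‖ₑ)) atTop (𝓝 0) := by
    refine tendsto_lpn_zero E.ne_zero E.ne_top (lpn_fcoef_ne_top E f k) (fun j n => ?_) fun n => ?_
    · gcongr
      have h1 : 1 / ((j : ℝ) + 1) ≤ 1 := by
        rw [div_le_one (by positivity)]
        linarith [(Nat.cast_nonneg j : (0 : ℝ) ≤ j)]
      refine (sub_le_self _ zero_le_one).trans (pow_le_pow_left₀ (by positivity) ?_ k)
      push_cast
      nlinarith [(Nat.cast_nonneg (sz n) : (0 : ℝ) ≤ sz n)]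
    · have h1 : Tendsto (fun j : ℕ => (1 + 1 / ((j : ℝ) + 1) * sz n) ^ k - 1) atTop (𝓝 0) := by
        have := ((((tendsto_one_div_add_atTop_nhds_zero_nat (𝕜 := ℝ)).mul_const
          (sz n : ℝ)).const_add 1).pow k).sub_const 1
        simpa using this
      have h2 := ENNReal.Tendsto.mul_const (b := brW s n * ‖fcoef f n‖ₑ)
        (ENNReal.tendsto_ofReal h1) (Or.inr (ENNReal.mul_ne_top (brW_ne_top s n) enorm_ne_top))
      simpa using h2
  obtain ⟨j, hj⟩ := (hlim.eventually_le_const (tsub_pos_of_lt hK)).exists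
  refine ⟨j, ?_⟩
  have h1 : (fun n => dilWt (1 / ((j : ℝ) + 1)) k n * brW s n * ‖fcoef f n‖ₑ) =
      (fun n => brW s n * ‖fcoef f n‖ₑ) + fun n => ENNReal.ofReal
      ((1 + 1 / ((j : ℝ) + 1) * sz n) ^ k - 1) * (brW s n * ‖fcoef f n‖ₑ) := by
    ext n
    have h2 : (1 : ℝ) ≤ (1 + 1 / ((j : ℝ) + 1) * sz n) ^ k :=
      one_le_pow₀ (le_add_of_nonneg_right (by positivity))
    have h3 : dilWt (1 / ((j : ℝ) + 1)) k n
        = 1 + ENNReal.ofReal ((1 + 1 / ((j : ℝ) + 1) * sz n) ^ k - 1) := by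
      rw [← ENNReal.ofReal_one, ← ENNReal.ofReal_add zero_le_one (by linarith), dilWt,
        add_sub_cancel]
    rw [h3, Pi.add_apply]
    ring
  rw [h1]
  calc _ ≤ _ := lpn_add_le E.one_le _ _
    _ ≤ lpn p (fun n => brW s n * ‖fcoef f n‖ₑ) + (K - lpn p (fun n => brW s n * ‖fcoef f n‖ₑ)) := by
        gcongr
    _ = K := add_tsub_cancel_of_le hK.le

/-- The smooth data to which the fixed point argument applies, with some room. -/
def SmallData (p : ℝ≥0∞) (s : ℝ) (r : ℝ≥0) (f : SmoothTorus) : Prop :=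
  dataConst p * lpn p (fun n => brW s n * ‖fcoef f n‖ₑ) < r / 2

theorem dataConst_ne_top {p : ℝ≥0∞} {s Q : ℝ} (E : Exponents p s Q) : dataConst p ≠ ⊤ :=
  exists_lpn_cutoff E.one_lt E.ne_top

section Persistence

variable {p : ℝ≥0∞} {s Q : ℝ} {M : ℕ} {r : ℝ≥0} {f : SmoothTorus}

theorem exists_dilWt_small (E : Exponents p s Q) (hf : SmallData p s r f) (k : ℕ) : ∃ j : ℕ,
    dataConst p * lpn p (fun n => dilWt (1 / (j + 1)) k n * brW s n * ‖fcoef f n‖ₑ) ≤ r / 2 := by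
  unfold SmallData at hf
  set L := lpn p (fun n => brW s n * ‖fcoef f n‖ₑ)
  have hκ := dataConst_ne_top E
  rcases eq_or_ne (dataConst p) 0 with h0 | h0
  · exact ⟨0, by simp [h0]⟩
  · have hK : L < (r / 2 : ℝ≥0∞) / dataConst p := by
      rwa [ENNReal.lt_div_iff_mul_lt (Or.inl h0) (Or.inl hκ), mul_comm]
    obtain ⟨j, hj⟩ := exists_dilWt_lpn_le E f k hK
    refine ⟨j, ?_⟩
    rw [mul_comm]
    exact ENNReal.mul_le_of_le_div hj

/-- The weighted fixed point bound holds with the original M and r. For fixed δ = 1/(j+1) the weight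
(1+δ|n|)^k is comparable to (1+|n|)^k, so every polynomial decay follows, with constants depending
on k but on an unchanged time interval. -/
theorem exists_amp_picardSol_le (E : Exponents p s Q) (S : SmallCubic p s M r)
    (hf : SmallData p s r f) (k : ℕ) : ∃ C : ℝ, 0 ≤ C ∧
      ∀ n, ((sz n + 1 : ℕ) : ℝ) ^ k * (amp (picardSol M (fcoef f)) n).toReal ≤ C := by
  obtain ⟨j, hj⟩ := exists_dilWt_small E hf k
  obtain ⟨C, hC, hamp⟩ := exists_lpn_amp_le E
  set A := picardSol M (fcoef f)
  have h1 := xn_picardSol_le E S hf.le (triSubmult_dilWt (δ := 1 / ((j : ℝ) + 1)) (by positivity) k)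
    (fun n => ENNReal.ofReal_ne_top) hj
  have h2 : ∀ n, dilWt (1 / ((j : ℝ) + 1)) k n * amp A n ≤ C * r := fun n => by
    refine le_trans ?_ ((le_lpn E.ne_zero E.ne_top (fun n => dilWt (1 / ((j : ℝ) + 1)) k n *
      brW s n * amp A n) n).trans ((hamp _ A).trans (by gcongr)))
    gcongr
    exact le_mul_of_one_le_right zero_le (one_le_brW E.s_nonneg n)
  refine ⟨((j : ℝ) + 1) ^ k * (C * r).toReal, by positivity, fun n => ?_⟩
  have h3 := ENNReal.toReal_mono (ENNReal.mul_ne_top hC ENNReal.coe_ne_top) (h2 n)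
  rw [ENNReal.toReal_mul, dilWt, ENNReal.toReal_ofReal (by positivity)] at h3
  calc _ ≤ (((j : ℝ) + 1) * (1 + 1 / ((j : ℝ) + 1) * sz n)) ^ k * (amp A n).toReal := by
        gcongr
        have e : ((j : ℝ) + 1) * (1 + 1 / ((j : ℝ) + 1) * sz n) = j + 1 + sz n := by field_simp
        rw [e]
        push_cast
        linarith [(Nat.cast_nonneg j : (0 : ℝ) ≤ j)]
    _ = ((j : ℝ) + 1) ^ k * ((1 + 1 / ((j : ℝ) + 1) * sz n) ^ k * (amp A n).toReal) := by
        rw [mul_pow]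
        ring
    _ ≤ _ := by gcongr

/-! ### Classical solutions from smooth data. -/

theorem xn_picardSol_ne_top (E : Exponents p s Q) (S : SmallCubic p s M r) {a : ℤ × ℤ → ℂ}
    (ha : dataConst p * lpn p (fun n => brW s n * ‖a n‖ₑ) ≤ r / 2) :
    xn p (brW s) (picardSol M a) ≠ ⊤ :=
  ne_top_of_le_ne_top ENNReal.coe_ne_top (xn_picardSol_le' E S ha)

theorem tsum_amp_picardSol_ne_top (E : Exponents p s Q) (S : SmallCubic p s M r)
    (hf : SmallData p s r f) : ∑' n, amp (picardSol M (fcoef f)) n ≠ ⊤ := by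
  obtain ⟨C, hC, h⟩ := exists_amp_picardSol_le E S hf 3
  refine ne_top_of_le_ne_top (summable_sz_pow.mul_left C).tsum_ofReal_ne_top
    (ENNReal.tsum_le_tsum fun n => ?_)
  rw [← ENNReal.ofReal_toReal (amp_ne_top E (xn_picardSol_ne_top E S hf.le) n)]
  refine ENNReal.ofReal_le_ofReal ?_
  have h0 : (0 : ℝ) < ((sz n + 1 : ℕ) : ℝ) ^ 3 := by positivity
  rw [← div_eq_mul_inv, le_div_iff₀ h0, mul_comm]
  exact h n

/-- The open time interval on which the fixed point solves the equation. -/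
def timeInterval (M : ℕ) : Set ℝ := Ioo (-(2 / M)) (2 / M)

theorem mem_timeInterval (hM : M ≠ 0) {t : ℝ} : t ∈ timeInterval M ↔ |M * t| < 2 := by
  have : (0 : ℝ) < M := by positivity
  rw [abs_mul, abs_of_pos this, ← lt_div_iff₀' this, abs_lt]
  rfl

theorem Icc_subset_timeInterval (hM : M ≠ 0) : Icc (0 : ℝ) (1 / M) ⊆ timeInterval M := by
  have : (0 : ℝ) < M := by positivity
  have h1 : (1 : ℝ) / M < 2 / M := by gcongr; norm_num
  have h2 : (0 : ℝ) < 2 / M := by positivity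
  exact fun t ht => ⟨by linarith [ht.1], by linarith [ht.2]⟩

/-- The Fourier coefficients of the solution with smooth data. -/
def evolFam (M : ℕ) (f : SmoothTorus) (n : ℤ × ℤ) (t : ℝ) : ℂ :=
  evol M (picardSol M (fcoef f)) t n

/-- The time derivative of the Fourier coefficients of the solution with smooth data. -/
def evolFam' (M : ℕ) (f : SmoothTorus) (n : ℤ × ℤ) (t : ℝ) : ℂ :=
  -Complex.I * symb n * evolFam M f n t +
    Complex.I * famConv (evolFam M f) (evolFam M f) (evolFam M f) n t

theorem rapidOn_evolFam (E : Exponents p s Q) (S : SmallCubic p s M r) (hf : SmallData p s r f) :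
    RapidOn (timeInterval M) (evolFam M f) := fun k => by
  obtain ⟨C, hC, h⟩ := exists_amp_picardSol_le E S hf k
  refine ⟨C, hC, fun n t _ => le_trans ?_ (h n)⟩
  gcongr
  rw [← toReal_enorm]
  exact ENNReal.toReal_mono (amp_ne_top E (xn_picardSol_ne_top E S hf.le) n) (enorm_evol_le _ _ _ _)

theorem hasDerivAt_evolFam (E : Exponents p s Q) (S : SmallCubic p s M r) (hf : SmallData p s r f)
    (hM : M ≠ 0) (n : ℤ × ℤ) {t : ℝ} (ht : t ∈ timeInterval M) :
    HasDerivAt (evolFam M f n) (evolFam' M f n t) t :=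
  hasDerivAt_evol hM (tsum_amp_picardSol_ne_top E S hf) (picardSol_eq E S hf.le) n
    ((mem_timeInterval hM).1 ht)

theorem norm_I_mul_symb_le (n : ℤ × ℤ) :
    ‖-Complex.I * (symb n : ℂ)‖ ≤ 2 * ((sz n + 1 : ℕ) : ℝ) ^ 2 := by
  have h1 := natAbs_fst_le_sz n
  have h2 := natAbs_snd_le_sz n
  rw [norm_mul, norm_neg, Complex.norm_I, one_mul, Complex.norm_real, Real.norm_eq_abs]
  push_cast
  have h3 : |symb n| ≤ |(n.1 : ℝ)| ^ 2 + |(n.2 : ℝ)| ^ 2 := by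
    unfold symb
    refine (abs_sub _ _).trans (le_of_eq ?_)
    rw [abs_pow, abs_pow]
  have h4 : |(n.1 : ℝ)| ^ 2 ≤ (sz n + 1 : ℝ) ^ 2 := by
    gcongr
    linarith
  have h5 : |(n.2 : ℝ)| ^ 2 ≤ (sz n + 1 : ℝ) ^ 2 := by
    gcongr
    linarith
  linarith

theorem SmoothFam.rhs {J : Set ℝ} (hJ : IsOpen J) (hJ' : IsPreconnected J) {k : ℕ}
    {g : ℤ × ℤ → ℝ → ℂ} (hg : SmoothFam J k g) :
    SmoothFam J k fun n t => -Complex.I * symb n * g n t + Complex.I * famConv g g g n t :=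
  (hg.multiplier zero_le_two norm_I_mul_symb_le).add
    ((hg.conv hJ hJ' hg hg).multiplier (c := fun _ => Complex.I) (N := 0) zero_le_one (by simp))

/-- Bootstrap: the time derivative is given by the right-hand side of the equation, which is as
regular as the family itself, so one more derivative is gained at each step. -/
theorem smoothFam_evolFam (E : Exponents p s Q) (S : SmallCubic p s M r) (hf : SmallData p s r f)
    (hM : M ≠ 0) (k : ℕ) : SmoothFam (timeInterval M) k (evolFam M f) := by
  induction k with
  | zero =>
    exact ⟨rapidOn_evolFam E S hf, fun n =>
      (continuous_evol M (amp_ne_top E (xn_picardSol_ne_top E S hf.le) n)).continuousOn⟩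
  | succ k ih =>
    exact ⟨rapidOn_evolFam E S hf, evolFam' M f, ih.rhs isOpen_Ioo isPreconnected_Ioo,
      fun n t ht => hasDerivAt_evolFam E S hf hM n ht⟩

theorem contDiffOn_series_evolFam (E : Exponents p s Q) (S : SmallCubic p s M r)
    (hf : SmallData p s r f) (hM : M ≠ 0) :
    ContDiffOn ℝ ∞ (series (evolFam M f)) (timeInterval M ×ˢ univ) :=
  contDiffOn_infty.2 fun k =>
    (smoothFam_evolFam E S hf hM k).contDiffOn isOpen_Ioo isPreconnected_Ioo

theorem isPeriodic_series (g : ℤ × ℤ → ℝ → ℂ) (t : ℝ) : IsPeriodic fun x => series g (t, x) :=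
  fun x => by simp only [series, ((expMode _).2.2 x).1, ((expMode _).2.2 x).2, and_self]

theorem contDiff_series_evolFam (E : Exponents p s Q) (S : SmallCubic p s M r)
    (hf : SmallData p s r f) (hM : M ≠ 0) {t : ℝ} (ht : t ∈ timeInterval M) :
    ContDiff ℝ ∞ fun x => series (evolFam M f) (t, x) := by
  have h : ContDiff ℝ ∞ fun x : ℝ × ℝ => (t, x) := contDiff_const.prodMk contDiff_id
  exact contDiffOn_univ.1 ((contDiffOn_series_evolFam E S hf hM).comp h.contDiffOn
    fun x _ => ⟨ht, mem_univ _⟩)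

open Classical in
/-- The function with Fourier coefficients `evolFam`, where this is smooth. -/
def solution (M : ℕ) (f : SmoothTorus) (t : ℝ) : SmoothTorus :=
  if h : ContDiff ℝ ∞ fun x => series (evolFam M f) (t, x) then
    ⟨fun x => series (evolFam M f) (t, x), h, isPeriodic_series _ t⟩ else 0

theorem solution_apply (E : Exponents p s Q) (S : SmallCubic p s M r)
    (hf : SmallData p s r f) (hM : M ≠ 0) {t : ℝ} (ht : t ∈ timeInterval M) (x : ℝ × ℝ) :
    (solution M f t).1 x = series (evolFam M f) (t, x) := by
  rw [solution, dif_pos (contDiff_series_evolFam E S hf hM ht)]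

theorem fcoef_solution (E : Exponents p s Q) (S : SmallCubic p s M r)
    (hf : SmallData p s r f) (hM : M ≠ 0) {t : ℝ} (ht : t ∈ timeInterval M) (n : ℤ × ℤ) :
    fcoef (solution M f t) n = evolFam M f n t := by
  have hs : Summable fun n => ‖evolFam M f n t‖ := by
    obtain ⟨u, hu, hb⟩ := (rapidOn_evolFam E S hf).exists_bound
    exact Summable.of_nonneg_of_le (fun _ => norm_nonneg _) (fun n => hb n t ht) hu
  rw [fcoef_eq]
  simp only [solution_apply E S hf hM ht, series]
  rw [torusIntegral_expMode_mul_tsum hs, neg_neg]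

theorem smoothTorus_ext {f g : SmoothTorus} (h : ∀ n, fcoef f n = fcoef g n) : f = g := by
  refine Subtype.ext (funext fun x => ?_)
  refine (hasSum_fcoef_mul_expMode f x).unique ?_
  simp only [h]
  exact hasSum_fcoef_mul_expMode g x

theorem solution_zero (E : Exponents p s Q) (S : SmallCubic p s M r)
    (hf : SmallData p s r f) (hM : M ≠ 0) : solution M f 0 = f := by
  refine smoothTorus_ext fun n => ?_
  rw [fcoef_solution E S hf hM (Icc_subset_timeInterval hM ⟨le_rfl, by positivity⟩)]
  exact evol_zero (tsum_amp_picardSol_ne_top E S hf) (picardSol_eq E S hf.le) n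

theorem fcoef_boxT (f : SmoothTorus) (n : ℤ × ℤ) : fcoef (boxT f) n = -(symb n) * fcoef f n := by
  have h : fcoef (boxT f) n
      = fcoef (pd (1, 0) (pd (1, 0) f)) n - fcoef (pd (0, 1) (pd (0, 1) f)) n := by
    simp only [fcoef, boxT, map_sub]
  rw [h, fcoef_pd, fcoef_pd, fcoef_pd, fcoef_pd, symb]
  push_cast
  ring_nf
  rw [Complex.I_sq]
  ring

/-- Smoothness holds on an open interval containing [0,1/M], so the one-sided derivatives at the end
points are ordinary ones. The equation is verified by comparing Fourier series: the coefficients of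
its left-hand side vanish identically. -/
theorem isClassicalSolution_solution (E : Exponents p s Q) (S : SmallCubic p s M r)
    (hf : SmallData p s r f) (hM : M ≠ 0) : IsClassicalSolution (1 / M) (solution M f) := by
  have hsub := Icc_subset_timeInterval hM
  have hT : (0 : ℝ) < 1 / M := by positivity
  refine ⟨?_, fun t ht x => ?_⟩
  · refine ContDiffOn.congr ((contDiffOn_series_evolFam E S hf hM).mono
      (prod_mono hsub subset_rfl)) fun q hq => ?_
    exact solution_apply E S hf hM (hsub hq.1) q.2
  · have hR := rapidOn_evolFam E S hf
    have ht' := hsub ht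
    have hR' : RapidOn (timeInterval M) (evolFam' M f) :=
      ((smoothFam_evolFam E S hf hM 0).rhs isOpen_Ioo isPreconnected_Ioo).rapid
    have h1 : HasDerivAt (fun τ => series (evolFam M f) (τ, x)) (series (evolFam' M f) (t, x)) t := by
      have := (hasFDerivAt_series isOpen_Ioo isPreconnected_Ioo hR hR'
        (fun n t ht => hasDerivAt_evolFam E S hf hM n ht) (q := (t, x)) ht').comp_hasDerivAt t
        ((hasDerivAt_id t).prodMk (hasDerivAt_const t x))
      convert! this using 1
      simp [mkDiff_apply]
    have h2 : HasDerivAt (fun τ => (solution M f τ).1 x) (series (evolFam' M f) (t, x)) t := by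
      refine h1.congr_of_eventuallyEq ?_
      filter_upwards [isOpen_Ioo.mem_nhds ht'] with τ hτ
      exact solution_apply E S hf hM hτ x
    rw [h2.hasDerivWithinAt.derivWithin (uniqueDiffOn_Icc hT t ht), ← boxT_apply]
    have h3 := hasSum_fcoef_mul_expMode (boxT (solution M f t)) x
    have h4 : HasSum (fun n => famConv (evolFam M f) (evolFam M f) (evolFam M f) n t
        * (expMode n).1 x) (cubic ((solution M f t).1 x)) := by
      rw [solution_apply E S hf hM ht', ← series_famConv hR ht']
      exact (summable_series (hR.conv hR hR) ht' x).hasSum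
    have h5 := (summable_series hR' ht' x).hasSum
    have h6 := ((h5.mul_left Complex.I).add h3).add h4
    refine h6.unique ?_
    have e : (fun n => Complex.I * (evolFam' M f n t * (expMode n).1 x)
        + fcoef (boxT (solution M f t)) n * (expMode n).1 x
        + famConv (evolFam M f) (evolFam M f) (evolFam M f) n t * (expMode n).1 x) = fun _ => 0 := by
      ext n
      rw [fcoef_boxT, fcoef_solution E S hf hM ht', evolFam']
      linear_combination (-(symb n : ℂ) * evolFam M f n t + famConv (evolFam M f) (evolFam M f)
        (evolFam M f) n t) * (expMode n).1 x * Complex.I_sq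
    rw [e]
    exact hasSum_zero

end Persistence

/-! ## Torus integrals depending on time -/

theorem isCompact_torusBox : IsCompact torusBox := isCompact_Icc.prod isCompact_Icc

theorem hasDerivAt_torusIntegral {U : Set ℝ} (hU : IsOpen U) {g g' : ℝ → ℝ × ℝ → ℂ}
    (hg : ∀ t ∈ U, ∀ x, HasDerivAt (fun τ => g τ x) (g' t x) t)
    (hgc : ∀ t ∈ U, Continuous (g t))
    (hg'c : ContinuousOn (fun q : ℝ × (ℝ × ℝ) => g' q.1 q.2) (U ×ˢ univ)) {t : ℝ} (ht : t ∈ U) :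
    HasDerivAt (fun τ => torusIntegral (g τ)) (torusIntegral (g' t)) t := by
  obtain ⟨ε, hε, hb⟩ := Metric.nhds_basis_closedBall.mem_iff.1 (hU.mem_nhds ht)
  obtain ⟨B, hB⟩ := ((isCompact_closedBall t ε).prod isCompact_torusBox).exists_bound_of_continuousOn
    (hg'c.mono (prod_mono hb (subset_univ _)))
  have hg't : Continuous (g' t) := by
    have : ContinuousOn (g' t) univ := hg'c.comp (f := fun x => (t, x)) (by fun_prop)
      fun x _ => ⟨ht, mem_univ _⟩
    exact continuousOn_univ.1 this
  have key := hasDerivAt_integral_of_dominated_loc_of_deriv_le (μ := volume.restrict torusBox)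
    (F := g) (F' := g') (x₀ := t) (bound := fun _ => B) (s := Metric.ball t ε)
    (Metric.ball_mem_nhds t hε) ?_ (integrableOn_torusBox (hgc t ht))
    hg't.aestronglyMeasurable ?_ ?_ ?_
  · exact key.2.const_smul (((2 * Real.pi) ^ 2)⁻¹ : ℝ)
  · filter_upwards [hU.mem_nhds ht] with τ hτ using (hgc τ hτ).aestronglyMeasurable
  · refine (ae_restrict_iff' isCompact_torusBox.measurableSet).2 (Eventually.of_forall ?_)
    exact fun x hx τ hτ => hB (τ, x) ⟨Metric.ball_subset_closedBall hτ, hx⟩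
  · exact integrableOn_const isCompact_torusBox.measure_lt_top.ne
  · exact Eventually.of_forall fun x τ hτ => hg τ (hb (Metric.ball_subset_closedBall hτ)) x

theorem continuousOn_torusIntegral {T : ℝ} (hT : 0 ≤ T) {g : ℝ → ℝ × ℝ → ℂ}
    (hg : ContinuousOn (fun q : ℝ × (ℝ × ℝ) => g q.1 q.2) (Icc 0 T ×ˢ univ)) :
    ContinuousOn (fun t => torusIntegral (g t)) (Icc 0 T) := by
  have h1 : Continuous (Function.uncurry fun (t : ℝ) (x : ℝ × ℝ) => g (projIcc 0 T hT t) x) := by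
    have h2 : Continuous fun q : ℝ × (ℝ × ℝ) => ((projIcc 0 T hT q.1 : ℝ), q.2) :=
      (continuous_subtype_val.comp (continuous_projIcc.comp continuous_fst)).prodMk continuous_snd
    exact hg.comp_continuous h2 fun q => ⟨(projIcc 0 T hT q.1).2, mem_univ _⟩
  have h3 := (continuous_parametric_integral_of_continuous (μ := volume) h1
    isCompact_torusBox).const_smul (((2 * Real.pi) ^ 2)⁻¹ : ℝ)
  refine h3.continuousOn.congr fun t ht => ?_
  simp only [torusIntegral, Pi.smul_apply, projIcc_of_mem hT ht]

theorem norm_torusIntegral_le_re {f g : ℝ × ℝ → ℂ} {c : ℝ} (hg : Continuous g)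
    (h : ∀ x, ‖f x‖ ≤ c * (g x).re) : ‖torusIntegral f‖ ≤ c * (torusIntegral g).re := by
  have hp := Real.two_pi_pos
  have hgi := integrableOn_torusBox hg
  have h1 : ‖∫ x in torusBox, f x‖ ≤ ∫ x in torusBox, c * (g x).re :=
    norm_integral_le_of_norm_le ((integrableOn_torusBox
      (Complex.continuous_ofReal.comp (Complex.continuous_re.comp hg))).re.const_mul c)
      (Eventually.of_forall h)
  have h2 : (∫ x in torusBox, g x).re = ∫ x in torusBox, (g x).re := by
    have := integral_re (𝕜 := ℂ) hgi
    exact this.symm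
  rw [integral_const_mul, ← h2] at h1
  rw [torusIntegral, torusIntegral, norm_smul, Complex.smul_re, Real.norm_of_nonneg (by positivity),
    smul_eq_mul]
  calc _ ≤ ((2 * Real.pi) ^ 2)⁻¹ * (c * (∫ x in torusBox, g x).re) := by gcongr
    _ = _ := by ring

/-! ## Classical solutions in the interior of the time interval -/

/-- The time derivative of a family of smooth functions. -/
def timeDeriv (w : ℝ → SmoothTorus) (t : ℝ) (x : ℝ × ℝ) : ℂ :=
  fderiv ℝ (fun q : ℝ × (ℝ × ℝ) => (w q.1).1 q.2) (t, x) (1, 0)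

section Classical

variable {T : ℝ} {w w' : ℝ → SmoothTorus}

theorem IsClassicalSolution.continuousOn (hw : IsClassicalSolution T w) :
    ContinuousOn (fun q : ℝ × (ℝ × ℝ) => (w q.1).1 q.2) (Icc 0 T ×ˢ univ) := hw.1.continuousOn

theorem IsClassicalSolution.contDiffOn_interior (hw : IsClassicalSolution T w) :
    ContDiffOn ℝ ∞ (fun q : ℝ × (ℝ × ℝ) => (w q.1).1 q.2) (Ioo 0 T ×ˢ univ) :=
  hw.1.mono (prod_mono Ioo_subset_Icc_self subset_rfl)

theorem IsClassicalSolution.hasDerivAt (hw : IsClassicalSolution T w) {t : ℝ} (ht : t ∈ Ioo 0 T)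
    (x : ℝ × ℝ) : HasDerivAt (fun τ => (w τ).1 x) (timeDeriv w t x) t := by
  have ho : IsOpen (Ioo 0 T ×ˢ (univ : Set (ℝ × ℝ))) := isOpen_Ioo.prod isOpen_univ
  have h1 : DifferentiableAt ℝ (fun q : ℝ × (ℝ × ℝ) => (w q.1).1 q.2) (t, x) :=
    (hw.contDiffOn_interior.differentiableOn (by simp)).differentiableAt
      (ho.mem_nhds ⟨ht, mem_univ _⟩)
  exact h1.hasFDerivAt.comp_hasDerivAt t ((hasDerivAt_id t).prodMk (hasDerivAt_const t x))

theorem IsClassicalSolution.continuousOn_timeDeriv (hw : IsClassicalSolution T w) :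
    ContinuousOn (fun q : ℝ × (ℝ × ℝ) => timeDeriv w q.1 q.2) (Ioo 0 T ×ˢ univ) := by
  have ho : IsOpen (Ioo 0 T ×ˢ (univ : Set (ℝ × ℝ))) := isOpen_Ioo.prod isOpen_univ
  exact (hw.contDiffOn_interior.continuousOn_fderiv_of_isOpen ho (by simp)).clm_apply
    continuousOn_const

theorem IsClassicalSolution.equation (hw : IsClassicalSolution T w) {t : ℝ} (ht : t ∈ Ioo 0 T)
    (x : ℝ × ℝ) : Complex.I * timeDeriv w t x + box (w t).1 x + cubic ((w t).1 x) = 0 := by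
  have h := hw.2 t (Ioo_subset_Icc_self ht) x
  rwa [derivWithin_of_mem_nhds (Icc_mem_nhds ht.1 ht.2), (hw.hasDerivAt ht x).deriv] at h

theorem IsClassicalSolution.exists_bound (hw : IsClassicalSolution T w) :
    ∃ B, 0 ≤ B ∧ ∀ t ∈ Icc 0 T, ∀ x, ‖(w t).1 x‖ ≤ B := by
  obtain ⟨B, hB⟩ := (isCompact_Icc.prod isCompact_torusBox).exists_bound_of_continuousOn
    (hw.continuousOn.mono (prod_mono subset_rfl (subset_univ _)))
  refine ⟨max B 0, le_max_right _ _, fun t ht x => ?_⟩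
  obtain ⟨y, hy, e⟩ := exists_mem_torusBox (w t).2.2 x
  rw [e]
  exact (hB (t, y) ⟨ht, hy⟩).trans (le_max_left _ _)

theorem isClassicalSolution_zero (T : ℝ) : IsClassicalSolution T 0 := by
  refine ⟨contDiffOn_const, fun t ht x => ?_⟩
  have h1 : (fun τ : ℝ => ((0 : ℝ → SmoothTorus) τ).1 x) = fun _ => 0 := rfl
  have h2 : ((0 : ℝ → SmoothTorus) t).1 = fun _ => 0 := rfl
  have h3 : (boxT (0 : SmoothTorus)).1 x = 0 := by
    have : boxT (0 : SmoothTorus) = 0 := smoothTorus_ext fun n => by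
      rw [fcoef_boxT]
      simp [fcoef]
    rw [this]
    rfl
  have h4 : box ((0 : ℝ → SmoothTorus) t).1 x = 0 := by
    rw [← h3, boxT_apply]
    rfl
  rw [h1, h4, h2]
  simp [cubic]

/-! ### Uniqueness of classical solutions by the L² energy method. -/

theorem norm_cubic_sub_le {a b : ℂ} {B : ℝ} (ha : ‖a‖ ≤ B) (hb : ‖b‖ ≤ B) :
    ‖cubic a - cubic b‖ ≤ 3 * B ^ 2 * ‖a - b‖ := by
  have e : cubic a - cubic b = a * (starRingEnd ℂ) a * (a - b) + a * b * (starRingEnd ℂ) (a - b)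
      + (starRingEnd ℂ) b * b * (a - b) := by
    rw [cubic, cubic, ← Complex.mul_conj', ← Complex.mul_conj', map_sub]
    ring
  have hB : 0 ≤ B := (norm_nonneg a).trans ha
  rw [e]
  refine norm_add₃_le.trans ?_
  simp only [norm_mul, RCLike.norm_conj]
  have h1 : ‖a‖ * ‖a‖ ≤ B * B := by gcongr
  have h2 : ‖a‖ * ‖b‖ ≤ B * B := by gcongr
  have h3 : ‖b‖ * ‖b‖ ≤ B * B := by gcongr
  nlinarith [norm_nonneg (a - b)]

theorem pd_conjT (v : ℝ × ℝ) (f : SmoothTorus) (x : ℝ × ℝ) :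
    (pd v (conjT f)).1 x = (starRingEnd ℂ) ((pd v f).1 x) := by
  have h := (Complex.conjCLE.toContinuousLinearMap.hasFDerivAt (x := f.1 x)).comp x
    (diffT f x).hasFDerivAt
  have e : (conjT f).1 = ⇑Complex.conjCLE.toContinuousLinearMap ∘ f.1 := rfl
  rw [pd_apply, e, h.fderiv]
  rfl

theorem box_conjT (f : SmoothTorus) (x : ℝ × ℝ) :
    box (conjT f).1 x = (starRingEnd ℂ) (box f.1 x) := by
  have e : ∀ v, pd v (conjT f) = conjT (pd v f) := fun v => Subtype.ext (funext (pd_conjT v f))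
  rw [box_eq, box_eq, e, e, pd_conjT, pd_conjT, map_sub]

/-- The `L²` distance of two families of smooth functions. -/
def energy (w w' : ℝ → SmoothTorus) (t : ℝ) : ℂ :=
  torusIntegral fun x => ((w t).1 x - (w' t).1 x) * (starRingEnd ℂ) ((w t).1 x - (w' t).1 x)

theorem box_sub (f g : SmoothTorus) (x : ℝ × ℝ) :
    box (f - g : SmoothTorus).1 x = box f.1 x - box g.1 x := by
  have e : ∀ (v : ℝ × ℝ) (f g : SmoothTorus), pd v (f - g) = pd v f - pd v g := fun v f g => by
    refine Subtype.ext (funext fun x => ?_)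
    have : (f - g : SmoothTorus).1 = f.1 - g.1 := rfl
    rw [pd_apply, this, fderiv_sub (diffT f x) (diffT g x)]
    rfl
  simp only [box_eq, e]
  have h : ∀ (f g : SmoothTorus), (f - g : SmoothTorus).1 x = f.1 x - g.1 x := fun _ _ => rfl
  rw [h, h]
  ring

/-- The hyperbolic Laplacian is symmetric and commutes with conjugation, so its contribution cancels
despite being indefinite; only the difference of the nonlinearities remains. -/
theorem hasDerivAt_energy (hw : IsClassicalSolution T w) (hw' : IsClassicalSolution T w') {t : ℝ}
    (ht : t ∈ Ioo 0 T) : HasDerivAt (energy w w') (torusIntegral fun x => Complex.I *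
      ((cubic ((w t).1 x) - cubic ((w' t).1 x)) * (starRingEnd ℂ) ((w t).1 x - (w' t).1 x)
      - ((w t).1 x - (w' t).1 x) * (starRingEnd ℂ) (cubic ((w t).1 x) - cubic ((w' t).1 x)))) t := by
  have h1 := hasDerivAt_torusIntegral isOpen_Ioo
    (g := fun t x => ((w t).1 x - (w' t).1 x) * (starRingEnd ℂ) ((w t).1 x - (w' t).1 x))
    (g' := fun t x => (timeDeriv w t x - timeDeriv w' t x) * (starRingEnd ℂ) ((w t).1 x - (w' t).1 x)
      + ((w t).1 x - (w' t).1 x) * (starRingEnd ℂ) (timeDeriv w t x - timeDeriv w' t x))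
    (fun t ht x => ?_) (fun t _ => ?_) ?_ ht
  · refine h1.congr_deriv ?_
    have hd : ∀ x, ((w t - w' t : SmoothTorus)).1 x = (w t).1 x - (w' t).1 x := fun _ => rfl
    have hz : torusIntegral (fun x => box (w t - w' t : SmoothTorus).1 x * (conjT (w t - w' t)).1 x
        - (w t - w' t : SmoothTorus).1 x * box (conjT (w t - w' t)).1 x) = 0 := by
      have c1 : Continuous fun x => box (w t - w' t : SmoothTorus).1 x * (conjT (w t - w' t)).1 x := by
        simp only [← boxT_apply]
        exact continuous_mulT _ _
      have c2 : Continuous fun x => (w t - w' t : SmoothTorus).1 x * box (conjT (w t - w' t)).1 x := by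
        simp only [← boxT_apply]
        exact continuous_mulT _ _
      rw [torusIntegral_sub c1 c2, torusIntegral_box_mul, sub_self]
    have hcub : ∀ f : SmoothTorus, Continuous fun x => cubic (f.1 x) := fun f => by
      have := contT f
      unfold cubic
      fun_prop
    have e : (fun x => (timeDeriv w t x - timeDeriv w' t x) *
        (starRingEnd ℂ) ((w t).1 x - (w' t).1 x)
        + ((w t).1 x - (w' t).1 x) * (starRingEnd ℂ) (timeDeriv w t x - timeDeriv w' t x)) =
        fun x => Complex.I * (box (w t - w' t : SmoothTorus).1 x * (conjT (w t - w' t)).1 x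
        - (w t - w' t : SmoothTorus).1 x * box (conjT (w t - w' t)).1 x) + Complex.I *
      ((cubic ((w t).1 x) - cubic ((w' t).1 x)) * (starRingEnd ℂ) ((w t).1 x - (w' t).1 x)
      - ((w t).1 x - (w' t).1 x) * (starRingEnd ℂ) (cubic ((w t).1 x) - cubic ((w' t).1 x))) := by
      ext x
      have q1 := hw.equation ht x
      have q2 := hw'.equation ht x
      have q : timeDeriv w t x - timeDeriv w' t x = Complex.I * ((box (w t).1 x - box (w' t).1 x)
          + (cubic ((w t).1 x) - cubic ((w' t).1 x))) := by
        linear_combination -Complex.I * q1 + Complex.I * q2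
          + (timeDeriv w t x - timeDeriv w' t x) * Complex.I_sq
      have hc : (conjT (w t - w' t)).1 x = (starRingEnd ℂ) ((w t).1 x - (w' t).1 x) := rfl
      rw [q, box_conjT, box_sub, hc, hd, map_mul, Complex.conj_I, map_add]
      ring
    have c3 : Continuous fun x => Complex.I *
        (box (w t - w' t : SmoothTorus).1 x * (conjT (w t - w' t)).1 x
        - (w t - w' t : SmoothTorus).1 x * box (conjT (w t - w' t)).1 x) := by
      simp only [← boxT_apply]
      exact continuous_const.mul ((continuous_mulT _ _).sub (continuous_mulT _ _))
    have c4 : Continuous fun x => Complex.I *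
      ((cubic ((w t).1 x) - cubic ((w' t).1 x)) * (starRingEnd ℂ) ((w t).1 x - (w' t).1 x)
      - ((w t).1 x - (w' t).1 x) * (starRingEnd ℂ) (cubic ((w t).1 x) - cubic ((w' t).1 x))) := by
      have a1 := hcub (w t)
      have a2 := hcub (w' t)
      have a3 := contT (w t)
      have a4 := contT (w' t)
      have a5 : Continuous fun x => (starRingEnd ℂ) ((w t).1 x - (w' t).1 x) :=
        Complex.continuous_conj.comp (a3.sub a4)
      have a6 : Continuous fun x => (starRingEnd ℂ) (cubic ((w t).1 x) - cubic ((w' t).1 x)) :=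
        Complex.continuous_conj.comp (a1.sub a2)
      exact continuous_const.mul (((a1.sub a2).mul a5).sub ((a3.sub a4).mul a6))
    rw [e, torusIntegral_add c3 c4, torusIntegral_const_mul, hz, mul_zero, zero_add]
  · have a := (hw.hasDerivAt ht x).sub (hw'.hasDerivAt ht x)
    exact a.mul a.star
  · have a := (contT (w t)).sub (contT (w' t))
    exact a.mul (Complex.continuous_conj.comp a)
  · have a := (hw.contDiffOn_interior.continuousOn).sub hw'.contDiffOn_interior.continuousOn
    have b := hw.continuousOn_timeDeriv.sub hw'.continuousOn_timeDeriv
    exact (b.mul (Complex.continuous_conj.comp_continuousOn a)).add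
      (a.mul (Complex.continuous_conj.comp_continuousOn b))

/-- Both solutions are bounded by some B on [0,T], so the energy satisfies |E'| ≤ 6B²E in the
interior. Hence E·e^{-6B²t} is nonincreasing and E vanishes. Equality almost everywhere on the box
is enough, since smooth functions are determined by their Fourier coefficients. -/
theorem IsClassicalSolution.unique (hw : IsClassicalSolution T w) (hw' : IsClassicalSolution T w')
    (h0 : w 0 = w' 0) {t : ℝ} (ht : t ∈ Icc 0 T) : w t = w' t := by
  have hT : 0 ≤ T := ht.1.trans ht.2
  obtain ⟨B₁, hB₁, hb₁⟩ := hw.exists_bound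
  obtain ⟨B₂, hB₂, hb₂⟩ := hw'.exists_bound
  set B := max B₁ B₂
  set K := 6 * B ^ 2
  have hcd : ∀ t, Continuous fun x =>
      ((w t).1 x - (w' t).1 x) * (starRingEnd ℂ) ((w t).1 x - (w' t).1 x) := fun t => by
    have a := (contT (w t)).sub (contT (w' t))
    exact a.mul (Complex.continuous_conj.comp a)
  have hE' : ∀ t ∈ Ioo 0 T, ∃ e', HasDerivAt (energy w w') e' t ∧
      ‖e'‖ ≤ K * (energy w w' t).re := fun t ht => by
    refine ⟨_, hasDerivAt_energy hw hw' ht, norm_torusIntegral_le_re (hcd t) fun x => ?_⟩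
    have ht' := Ioo_subset_Icc_self ht
    have h1 := norm_cubic_sub_le ((hb₁ t ht' x).trans (le_max_left B₁ B₂))
      ((hb₂ t ht' x).trans (le_max_right B₁ B₂))
    rw [Complex.mul_conj', norm_mul, Complex.norm_I, one_mul]
    refine (norm_sub_le _ _).trans ?_
    rw [norm_mul, norm_mul, RCLike.norm_conj, RCLike.norm_conj, ← Complex.ofReal_pow,
      Complex.ofReal_re]
    have := norm_nonneg ((w t).1 x - (w' t).1 x)
    calc _ ≤ (3 * B ^ 2 * ‖(w t).1 x - (w' t).1 x‖) * ‖(w t).1 x - (w' t).1 x‖ +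
          ‖(w t).1 x - (w' t).1 x‖ * (3 * B ^ 2 * ‖(w t).1 x - (w' t).1 x‖) := by gcongr
      _ = _ := by ring
  have hcont : ContinuousOn (energy w w') (Icc 0 T) := by
    refine continuousOn_torusIntegral hT ?_
    have a := hw.continuousOn.sub hw'.continuousOn
    exact a.mul (Complex.continuous_conj.comp_continuousOn a)
  have hanti : AntitoneOn (fun t => (energy w w' t).re * Real.exp (-(K * t))) (Icc 0 T) := by
    refine antitoneOn_of_deriv_nonpos (convex_Icc 0 T) ?_ ?_ ?_
    · exact (Complex.continuous_re.comp_continuousOn hcont).mul (by fun_prop)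
    · rw [interior_Icc]
      intro t ht
      obtain ⟨e', he, _⟩ := hE' t ht
      have h1 : HasDerivAt (fun t => (energy w w' t).re) e'.re t :=
        Complex.reCLM.hasFDerivAt.comp_hasDerivAt t he
      exact (h1.differentiableAt.mul (by fun_prop)).differentiableWithinAt
    · rw [interior_Icc]
      intro t ht
      obtain ⟨e', he, hle⟩ := hE' t ht
      have h1 : HasDerivAt (fun t => (energy w w' t).re) e'.re t :=
        Complex.reCLM.hasFDerivAt.comp_hasDerivAt t he
      have h2 : HasDerivAt (fun t => Real.exp (-(K * t))) (Real.exp (-(K * t)) * -(K * 1)) t :=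
        ((hasDerivAt_id t).const_mul K).neg.exp
      have h3 := (h1.mul h2).deriv
      have h4 : deriv (fun t => (energy w w' t).re * Real.exp (-(K * t))) t
          = e'.re * Real.exp (-(K * t)) + (energy w w' t).re * (Real.exp (-(K * t)) * -(K * 1)) := h3
      rw [h4]
      have h5 : e'.re ≤ K * (energy w w' t).re := (Complex.re_le_norm e').trans hle
      have h6 := Real.exp_pos (-(K * t))
      nlinarith
  have hz : energy w w' 0 = 0 := by
    simp [energy, h0, torusIntegral]
  have h1 := hanti ⟨le_rfl, hT⟩ ht ht.1
  simp only [hz, Complex.zero_re, zero_mul] at h1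
  have h2 : (energy w w' t).re ≤ 0 := by
    by_contra hlt
    push Not at hlt
    have := mul_pos hlt (Real.exp_pos (-(K * t)))
    linarith
  have hint : ∫ x in torusBox, ‖(w t).1 x - (w' t).1 x‖ ^ 2 = 0 := by
    have hp := Real.two_pi_pos
    have e1 : (energy w w' t).re
        = ((2 * Real.pi) ^ 2)⁻¹ * ∫ x in torusBox, ‖(w t).1 x - (w' t).1 x‖ ^ 2 := by
      rw [energy, torusIntegral, Complex.smul_re, smul_eq_mul]
      congr 1
      simp only [Complex.mul_conj', ← Complex.ofReal_pow]
      rw [integral_complex_ofReal, Complex.ofReal_re]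
    have e2 : 0 ≤ ∫ x in torusBox, ‖(w t).1 x - (w' t).1 x‖ ^ 2 := integral_nonneg fun x => by positivity
    rw [e1] at h2
    have e3 : 0 < ((2 * Real.pi) ^ 2)⁻¹ := by positivity
    nlinarith
  have hae : (fun x => ‖(w t).1 x - (w' t).1 x‖ ^ 2) =ᵐ[volume.restrict torusBox] 0 := by
    refine (integral_eq_zero_iff_of_nonneg (fun x => by positivity) ?_).1 hint
    have : Continuous fun x => ‖(w t).1 x - (w' t).1 x‖ ^ 2 :=
      (((contT (w t)).sub (contT (w' t))).norm).pow 2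
    exact this.continuousOn.integrableOn_compact isCompact_torusBox
  refine smoothTorus_ext fun n => ?_
  rw [fcoef_eq, fcoef_eq]
  unfold torusIntegral
  congr 1
  refine integral_congr_ae ?_
  filter_upwards [hae] with x hx
  have : (w t).1 x = (w' t).1 x := by
    simpa [sub_eq_zero] using hx
  rw [this]

end Classical

/-! ## The nonlinearity tested against smooth functions -/

/-- Smooth functions on space-time that are periodic in space. -/
def SpaceTimeSmooth (F : ℝ × (ℝ × ℝ) → ℂ) : Prop :=
  ContDiff ℝ ∞ F ∧ ∀ t, IsPeriodic fun x => F (t, x)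

/-- The restriction to a fixed time. -/
def slice (F : ℝ × (ℝ × ℝ) → ℂ) (hF : SpaceTimeSmooth F) (t : ℝ) : SmoothTorus :=
  ⟨fun x => F (t, x), hF.1.comp (contDiff_const.prodMk contDiff_id), hF.2 t⟩

/-- The derivative in the direction `v`. -/
def stDeriv (v : ℝ × (ℝ × ℝ)) (F : ℝ × (ℝ × ℝ) → ℂ) (q : ℝ × (ℝ × ℝ)) : ℂ := fderiv ℝ F q v

section

variable {F : ℝ × (ℝ × ℝ) → ℂ}

theorem SpaceTimeSmooth.eq_translate (hF : SpaceTimeSmooth F) :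
    (F = fun q => F (q + (0, (2 * Real.pi, 0)))) ∧ F = fun q => F (q + (0, (0, 2 * Real.pi))) := by
  constructor
  · ext ⟨t, x⟩
    have := (hF.2 t x).1.symm
    simpa [Prod.add_def] using this
  · ext ⟨t, x⟩
    have := (hF.2 t x).2.symm
    simpa [Prod.add_def] using this

theorem SpaceTimeSmooth.stDeriv (hF : SpaceTimeSmooth F) (v : ℝ × (ℝ × ℝ)) :
    SpaceTimeSmooth (stDeriv v F) := by
  refine ⟨(hF.1.fderiv_right (m := ∞) (by simp)).clm_apply contDiff_const, fun t x => ?_⟩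
  obtain ⟨h1, h2⟩ := hF.eq_translate
  constructor
  · have := congrArg (fun g => fderiv ℝ g (t, x) v) h1
    simp only [fderiv_comp_add_right] at this
    simpa [HNLS.stDeriv, Prod.add_def] using this.symm
  · have := congrArg (fun g => fderiv ℝ g (t, x) v) h2
    simp only [fderiv_comp_add_right] at this
    simpa [HNLS.stDeriv, Prod.add_def] using this.symm

theorem norm_iteratedFDeriv_stDeriv_le (hF : SpaceTimeSmooth F) (v : ℝ × (ℝ × ℝ)) (hv : ‖v‖ ≤ 1)
    (j : ℕ) (q : ℝ × (ℝ × ℝ)) :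
    ‖iteratedFDeriv ℝ j (stDeriv v F) q‖ ≤ ‖iteratedFDeriv ℝ (j + 1) F q‖ := by
  rw [← norm_iteratedFDeriv_fderiv]
  refine (norm_iteratedFDeriv_clm_apply_const (N := ∞)
    (hF.1.fderiv_right (m := ∞) (by simp)).contDiffAt (by exact_mod_cast le_top)).trans ?_
  exact mul_le_of_le_one_left (norm_nonneg _) hv

theorem pd_slice (hF : SpaceTimeSmooth F) (v : ℝ × ℝ) (t : ℝ) :
    pd v (slice F hF t) = slice (stDeriv (0, v) F) (hF.stDeriv _) t := by
  refine Subtype.ext (funext fun x => ?_)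
  have h1 : HasFDerivAt (fun x : ℝ × ℝ => (t, x)) (ContinuousLinearMap.inr ℝ ℝ (ℝ × ℝ)) x :=
    hasFDerivAt_prodMk_right t x
  have h2 := ((hF.1.differentiable (by simp) (t, x)).hasFDerivAt).comp x h1
  have e : (slice F hF t).1 = F ∘ fun x => (t, x) := rfl
  rw [pd_apply, e, h2.fderiv]
  rfl

theorem norm_iteratedFDeriv_slice_le (hF : SpaceTimeSmooth F) (t : ℝ) (j : ℕ) (x : ℝ × ℝ) :
    ‖iteratedFDeriv ℝ j (slice F hF t).1 x‖ ≤ ‖iteratedFDeriv ℝ j F (t, x)‖ := by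
  have e : (slice F hF t).1 = (fun q => F (q + (t, 0))) ∘ ContinuousLinearMap.inr ℝ ℝ (ℝ × ℝ) := by
    ext x
    simp [slice]
  have hs : ContDiff ℝ ∞ fun q => F (q + (t, 0)) := hF.1.comp (contDiff_id.add contDiff_const)
  rw [e, ContinuousLinearMap.iteratedFDeriv_comp_right _ hs x (i := j) (by exact_mod_cast le_top)]
  refine (ContinuousMultilinearMap.norm_compContinuousLinearMap_le _ _).trans ?_
  rw [iteratedFDeriv_comp_add_right]
  have h1 : ContinuousLinearMap.inr ℝ ℝ (ℝ × ℝ) x + (t, 0) = (t, x) := by simp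
  rw [h1]
  refine mul_le_of_le_one_right (norm_nonneg _) (Finset.prod_le_one (fun _ _ => norm_nonneg _)
    fun _ _ => ?_)
  exact ContinuousLinearMap.opNorm_le_bound _ zero_le_one fun y => by simp

/-- The adjoint `i ∂ₜ - □` of the linear part of the equation, applied to a test function. -/
def adjFun (F : ℝ × (ℝ × ℝ) → ℂ) : ℝ × (ℝ × ℝ) → ℂ :=
  Complex.I • stDeriv (1, 0) F - (stDeriv (0, (1, 0)) (stDeriv (0, (1, 0)) F)
    - stDeriv (0, (0, 1)) (stDeriv (0, (0, 1)) F))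

theorem SpaceTimeSmooth.adjFun (hF : SpaceTimeSmooth F) : SpaceTimeSmooth (adjFun F) := by
  have h0 := hF.stDeriv (1, 0)
  have h1 := (hF.stDeriv (0, (1, 0))).stDeriv (0, (1, 0))
  have h2 := (hF.stDeriv (0, (0, 1))).stDeriv (0, (0, 1))
  refine ⟨(contDiff_const.smul h0.1).sub (h1.1.sub h2.1), fun t x => ?_⟩
  have a0 := h0.2 t x
  have a1 := h1.2 t x
  have a2 := h2.2 t x
  simp only at a0 a1 a2
  simp only [HNLS.adjFun, Pi.sub_apply, Pi.smul_apply, a0.1, a0.2, a1.1, a1.2, a2.1, a2.2, and_self]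

theorem adjFun_apply (hF : SpaceTimeSmooth F) (t : ℝ) (x : ℝ × ℝ) :
    adjFun F (t, x) = Complex.I * stDeriv (1, 0) F (t, x) - box (slice F hF t).1 x := by
  rw [box_eq, pd_slice, pd_slice, pd_slice, pd_slice]
  rfl

/-- Three terms, each involving at most two more derivatives: 3 + 2 = 5. -/
theorem norm_iteratedFDeriv_adjFun_le (hF : SpaceTimeSmooth F) {M : ℝ} {q : ℝ × (ℝ × ℝ)}
    (h : ∀ k ≤ 5, ‖iteratedFDeriv ℝ k F q‖ ≤ M) (j : ℕ) (hj : j ≤ 3) :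
    ‖iteratedFDeriv ℝ j (adjFun F) q‖ ≤ 3 * M := by
  have h0 := hF.stDeriv (1, 0)
  have h1 := (hF.stDeriv (0, (1, 0)))
  have h2 := (hF.stDeriv (0, (0, 1)))
  have h11 := h1.stDeriv (0, (1, 0))
  have h22 := h2.stDeriv (0, (0, 1))
  have n0 : ‖((1, 0) : ℝ × (ℝ × ℝ))‖ ≤ 1 := by simp
  have n1 : ‖((0, (1, 0)) : ℝ × (ℝ × ℝ))‖ ≤ 1 := by simp
  have n2 : ‖((0, (0, 1)) : ℝ × (ℝ × ℝ))‖ ≤ 1 := by simp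
  have c : ∀ {G : ℝ × (ℝ × ℝ) → ℂ}, SpaceTimeSmooth G → ContDiffAt ℝ j G q := fun hG =>
    (hG.1.of_le (by exact_mod_cast le_top)).contDiffAt
  have e : iteratedFDeriv ℝ j (adjFun F) q = Complex.I • iteratedFDeriv ℝ j (stDeriv (1, 0) F) q
      - (iteratedFDeriv ℝ j (stDeriv (0, (1, 0)) (stDeriv (0, (1, 0)) F)) q
      - iteratedFDeriv ℝ j (stDeriv (0, (0, 1)) (stDeriv (0, (0, 1)) F)) q) := by
    have c0 : ContDiffAt ℝ j (Complex.I • stDeriv (1, 0) F) q := (c h0).const_smul Complex.I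
    have c1 : ContDiffAt ℝ j (stDeriv (0, (1, 0)) (stDeriv (0, (1, 0)) F)
      - stDeriv (0, (0, 1)) (stDeriv (0, (0, 1)) F)) q := (c h11).sub (c h22)
    rw [adjFun, iteratedFDeriv_sub_apply c0 c1,
      iteratedFDeriv_sub_apply (c h11) (c h22), iteratedFDeriv_const_smul_apply (c h0)]
  have b0 := (norm_iteratedFDeriv_stDeriv_le hF _ n0 j q).trans (h _ (by omega))
  have b1 := ((norm_iteratedFDeriv_stDeriv_le h1 _ n1 j q).trans
    (norm_iteratedFDeriv_stDeriv_le hF _ n1 (j + 1) q)).trans (h _ (by omega))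
  have b2 := ((norm_iteratedFDeriv_stDeriv_le h2 _ n2 j q).trans
    (norm_iteratedFDeriv_stDeriv_le hF _ n2 (j + 1) q)).trans (h _ (by omega))
  rw [e]
  refine (norm_sub_le _ _).trans ?_
  rw [norm_smul, Complex.norm_I, one_mul]
  have := norm_sub_le (iteratedFDeriv ℝ j (stDeriv (0, (1, 0)) (stDeriv (0, (1, 0)) F)) q)
    (iteratedFDeriv ℝ j (stDeriv (0, (0, 1)) (stDeriv (0, (0, 1)) F)) q)
  linarith

theorem exists_norm_iteratedFDeriv_spaceTime_le (hF : SpaceTimeSmooth F) (T : ℝ) (N : ℕ) :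
    ∃ M, ∀ k ≤ N, ∀ t ∈ Icc 0 T, ∀ x, ‖iteratedFDeriv ℝ k F (t, x)‖ ≤ M := by
  have h1 : ∀ j, ∃ M, ∀ t ∈ Icc 0 T, ∀ x, ‖iteratedFDeriv ℝ j F (t, x)‖ ≤ M := fun j => by
    obtain ⟨M, hM⟩ := ((isCompact_Icc (a := 0) (b := T)).prod
      isCompact_torusBox).exists_bound_of_continuousOn
      (hF.1.continuous_iteratedFDeriv (m := j) (by exact_mod_cast le_top)).continuousOn
    refine ⟨M, fun t ht x => ?_⟩
    obtain ⟨y, hy, e⟩ := exists_mem_torusBox (g := fun x => iteratedFDeriv ℝ j F (t, x)) (fun x => by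
      obtain ⟨e1, e2⟩ := hF.eq_translate
      constructor
      · have := congrArg (fun g => iteratedFDeriv ℝ j g (t, x)) e1
        simp only [iteratedFDeriv_comp_add_right] at this
        simpa [Prod.add_def] using this.symm
      · have := congrArg (fun g => iteratedFDeriv ℝ j g (t, x)) e2
        simp only [iteratedFDeriv_comp_add_right] at this
        simpa [Prod.add_def] using this.symm) x
    rw [e]
    exact hM (t, y) ⟨ht, hy⟩
  choose B hB using h1
  refine ⟨∑ j ∈ Finset.range (N + 1), |B j|, fun j hj t ht x =>
    ((hB j t ht x).trans (le_abs_self _)).trans ?_⟩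
  exact Finset.single_le_sum (f := fun j => |B j|) (fun i _ => abs_nonneg _)
    (Finset.mem_range.2 (by omega))

end

theorem spaceTimeSmooth_test {T : ℝ} (φ : SpaceTimeTest T) : SpaceTimeSmooth φ.1 :=
  ⟨φ.2.1, φ.2.2.1⟩

section Pairing

variable {T : ℝ} {w w' : ℝ → SmoothTorus}

theorem IsClassicalSolution.continuousOn_pairing (hT : 0 ≤ T) (hw : IsClassicalSolution T w)
    (φ : SpaceTimeTest T) :
    ContinuousOn (fun t => torusIntegral fun x => cubic ((w t).1 x) * φ.1 (t, x)) (Icc 0 T) := by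
  refine continuousOn_torusIntegral (g := fun t x => cubic ((w t).1 x) * φ.1 (t, x)) hT ?_
  have h1 := hw.continuousOn
  have h2 : Continuous cubic := by
    unfold cubic
    fun_prop
  exact (h2.comp_continuousOn h1).mul φ.2.1.continuous.continuousOn

theorem IsClassicalSolution.continuousOn_adjoint_pairing (hT : 0 ≤ T) (hw : IsClassicalSolution T w)
    (φ : SpaceTimeTest T) :
    ContinuousOn (fun t => torusIntegral fun x => (w t).1 x * adjFun φ.1 (t, x)) (Icc 0 T) := by
  refine continuousOn_torusIntegral (g := fun t x => (w t).1 x * adjFun φ.1 (t, x)) hT ?_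
  exact hw.continuousOn.mul (spaceTimeSmooth_test φ).adjFun.1.continuous.continuousOn

/-- The equation gives |w|²w = -(i∂ₜ + □)w, and integrating by parts moves the operator onto the
test function. The cubic expression becomes linear in w, so weak bounds on w suffice to pass to the
limit. -/
theorem nonlinearityPairing_eq (hT : 0 ≤ T) (hw : IsClassicalSolution T w) (φ : SpaceTimeTest T) :
    nonlinearityPairing T w φ
      = ∫ t in Icc 0 T, torusIntegral fun x => (w t).1 x * adjFun φ.1 (t, x) := by
  have hφ := spaceTimeSmooth_test φ
  have c1 := hw.continuousOn_pairing hT φ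
  have c2 := hw.continuousOn_adjoint_pairing hT φ
  have i1 : IntegrableOn _ (Icc 0 T) := c1.integrableOn_compact isCompact_Icc
  have i2 : IntegrableOn _ (Icc 0 T) := c2.integrableOn_compact isCompact_Icc
  rw [← sub_eq_zero, nonlinearityPairing, ← integral_sub i1 i2, integral_Icc_eq_integral_Ioc,
    ← intervalIntegral.integral_of_le hT]
  have hderiv : ∀ t ∈ Ioo 0 T, HasDerivAt
      (fun t => -Complex.I * torusIntegral fun x => (w t).1 x * φ.1 (t, x))
      ((torusIntegral fun x => cubic ((w t).1 x) * φ.1 (t, x))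
        - torusIntegral fun x => (w t).1 x * adjFun φ.1 (t, x)) t := by
    intro t ht
    have h1 := hasDerivAt_torusIntegral isOpen_Ioo (g := fun t x => (w t).1 x * φ.1 (t, x))
      (g' := fun t x => timeDeriv w t x * φ.1 (t, x) + (w t).1 x * stDeriv (1, 0) φ.1 (t, x))
      (fun t ht x => ?_) (fun t _ => ?_) ?_ ht
    · refine (h1.const_mul (-Complex.I)).congr_deriv ?_
      have k1 : Continuous (timeDeriv w t) := by
        have := hw.continuousOn_timeDeriv.comp (f := fun x => (t, x)) (s := univ) (by fun_prop)
          fun x _ => ⟨ht, mem_univ _⟩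
        exact continuousOn_univ.1 this
      have k2 : Continuous fun x => φ.1 (t, x) := contT (slice φ.1 hφ t)
      have k3 : Continuous fun x => stDeriv (1, 0) φ.1 (t, x) :=
        contT (slice _ (hφ.stDeriv (1, 0)) t)
      have k4 := contT (w t)
      have k5 : Continuous fun x => box (w t).1 x := by
        simp only [← boxT_apply]
        exact contT _
      have k6 : Continuous fun x => box (slice φ.1 hφ t).1 x := by
        simp only [← boxT_apply]
        exact contT _
      have e1 : (fun x => cubic ((w t).1 x) * φ.1 (t, x)) = fun x =>
          -Complex.I * (timeDeriv w t x * φ.1 (t, x)) - box (w t).1 x * (slice φ.1 hφ t).1 x := by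
        ext x
        have := hw.equation ht x
        have h2 : (slice φ.1 hφ t).1 x = φ.1 (t, x) := rfl
        rw [h2]
        linear_combination φ.1 (t, x) * this
      have e2 : (fun x => (w t).1 x * adjFun φ.1 (t, x)) = fun x =>
          Complex.I * ((w t).1 x * stDeriv (1, 0) φ.1 (t, x))
          - (w t).1 x * box (slice φ.1 hφ t).1 x := by
        ext x
        rw [adjFun_apply hφ]
        ring
      have kA : Continuous fun x => -Complex.I * (timeDeriv w t x * φ.1 (t, x)) :=
        continuous_const.mul (k1.mul k2)
      have kB : Continuous fun x => box (w t).1 x * (slice φ.1 hφ t).1 x := k5.mul (contT _)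
      have kC : Continuous fun x => Complex.I * ((w t).1 x * stDeriv (1, 0) φ.1 (t, x)) :=
        continuous_const.mul (k4.mul k3)
      have kD : Continuous fun x => (w t).1 x * box (slice φ.1 hφ t).1 x := k4.mul k6
      have kE : Continuous fun x => timeDeriv w t x * φ.1 (t, x) := k1.mul k2
      have kF : Continuous fun x => (w t).1 x * stDeriv (1, 0) φ.1 (t, x) := k4.mul k3
      rw [e1, e2, torusIntegral_sub kA kB, torusIntegral_sub kC kD, torusIntegral_const_mul,
        torusIntegral_const_mul, torusIntegral_box_mul, torusIntegral_add kE kF]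
      ring
    · have h2 : HasDerivAt (fun τ => φ.1 (τ, x)) (stDeriv (1, 0) φ.1 (t, x)) t :=
        ((φ.2.1.differentiable (by simp)) (t, x)).hasFDerivAt.comp_hasDerivAt t
          ((hasDerivAt_id t).prodMk (hasDerivAt_const t x))
      exact (hw.hasDerivAt ht x).mul h2
    · exact (contT (w t)).mul (contT (slice φ.1 hφ t))
    · exact (hw.continuousOn_timeDeriv.mul φ.2.1.continuous.continuousOn).add
        (hw.contDiffOn_interior.continuousOn.mul (hφ.stDeriv (1, 0)).1.continuous.continuousOn)
  have hcont : ContinuousOn (fun t => -Complex.I * torusIntegral fun x => (w t).1 x * φ.1 (t, x))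
      (Icc 0 T) := by
    refine continuousOn_const.mul (continuousOn_torusIntegral
      (g := fun t x => (w t).1 x * φ.1 (t, x)) hT ?_)
    exact hw.continuousOn.mul φ.2.1.continuous.continuousOn
  rw [intervalIntegral.integral_eq_sub_of_hasDerivAt_of_le hT hcont hderiv]
  -- The boundary terms vanish because the test function is supported away from t = 0 and t = T.
  · obtain ⟨a, b, ha, hb, hs⟩ := φ.2.2.2
    have z0 : ∀ x, φ.1 (0, x) = 0 := hs 0 fun h => absurd h.1 (not_le.2 ha)
    have zT : ∀ x, φ.1 (T, x) = 0 := hs T fun h => absurd h.2 (not_le.2 hb)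
    simp [z0, zT, torusIntegral]
  · rw [intervalIntegrable_iff_integrableOn_Icc_of_le hT]
    exact i1.sub i2

/-- The constant in the bound of the pairing of a distribution with a test function. -/
def pairConst : ℝ := 8 * ∑' n : ℤ × ℤ, (((sz n + 1 : ℕ) : ℝ) ^ 3)⁻¹

/-- At each time a uniform bound on the difference of the Fourier coefficients controls its pairing
with the smooth function (i∂ₜ - □)φ. -/
theorem norm_nonlinearityPairing_sub_le (hT : 0 ≤ T) (hw : IsClassicalSolution T w)
    (hw' : IsClassicalSolution T w') (φ : SpaceTimeTest T) {M δ : ℝ}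
    (hM : ∀ k ≤ 5, ∀ t ∈ Icc 0 T, ∀ x, ‖iteratedFDeriv ℝ k φ.1 (t, x)‖ ≤ M)
    (hδ : ∀ t ∈ Icc 0 T, ∀ n, ‖fcoef (w t) n - fcoef (w' t) n‖ ≤ δ) :
    ‖nonlinearityPairing T w φ - nonlinearityPairing T w' φ‖ ≤ δ * (pairConst * (3 * M)) * T := by
  have hφ := (spaceTimeSmooth_test φ)
  rw [nonlinearityPairing_eq hT hw, nonlinearityPairing_eq hT hw', ← integral_sub
    ((hw.continuousOn_adjoint_pairing hT φ).integrableOn_compact isCompact_Icc)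
    ((hw'.continuousOn_adjoint_pairing hT φ).integrableOn_compact isCompact_Icc)]
  refine (norm_setIntegral_le_of_norm_le_const (C := δ * (pairConst * (3 * M)))
    isCompact_Icc.measure_lt_top fun t ht => ?_).trans (le_of_eq ?_)
  · have e : (torusIntegral fun x => (w t).1 x * adjFun φ.1 (t, x))
        - (torusIntegral fun x => (w' t).1 x * adjFun φ.1 (t, x))
        = (toDistribution (w t) - toDistribution (w' t)).1 (slice _ hφ.adjFun t) := rfl
    rw [e]
    refine norm_torusDistribution_le (fun n => ?_) fun j hj x => ?_
    · rw [fourierCoeff_sub, fourierCoeff_toDistribution, fourierCoeff_toDistribution]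
      exact hδ t ht n
    · exact (norm_iteratedFDeriv_slice_le hφ.adjFun t j x).trans
        (norm_iteratedFDeriv_adjFun_le hφ (fun k hk => hM k hk t ht x) j hj)
  · simp [measureReal_def, hT]

theorem nonlinearityPairing_zero (φ : SpaceTimeTest T) : nonlinearityPairing T 0 φ = 0 := by
  have : ∀ (t : ℝ) (x : ℝ × ℝ), cubic (((0 : ℝ → SmoothTorus) t).1 x) = 0 := fun t x => by
    have h : ((0 : ℝ → SmoothTorus) t).1 x = 0 := rfl
    rw [h]
    simp [cubic]
  simp only [nonlinearityPairing, torusIntegral, this, zero_mul, integral_zero, smul_zero]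

theorem nonlinearityPairing_add (hT : 0 ≤ T) (hw : IsClassicalSolution T w) (φ ψ : SpaceTimeTest T) :
    nonlinearityPairing T w (φ + ψ) = nonlinearityPairing T w φ + nonlinearityPairing T w ψ := by
  have i1 := (hw.continuousOn_pairing hT φ).integrableOn_compact (μ := volume) isCompact_Icc
  have i2 := (hw.continuousOn_pairing hT ψ).integrableOn_compact (μ := volume) isCompact_Icc
  unfold nonlinearityPairing
  rw [← integral_add i1 i2]
  congr 1
  ext t
  have h2 : Continuous cubic := by
    unfold cubic
    fun_prop
  have k1 : Continuous fun x => cubic ((w t).1 x) * φ.1 (t, x) :=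
    (h2.comp (contT (w t))).mul (contT (slice φ.1 (spaceTimeSmooth_test φ) t))
  have k2 : Continuous fun x => cubic ((w t).1 x) * ψ.1 (t, x) :=
    (h2.comp (contT (w t))).mul (contT (slice ψ.1 (spaceTimeSmooth_test ψ) t))
  rw [← torusIntegral_add k1 k2]
  congr 1
  ext x
  have : (φ + ψ).1 (t, x) = φ.1 (t, x) + ψ.1 (t, x) := rfl
  rw [this, mul_add]

theorem nonlinearityPairing_smul (c : ℂ) (φ : SpaceTimeTest T) :
    nonlinearityPairing T w (c • φ) = c * nonlinearityPairing T w φ := by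
  unfold nonlinearityPairing
  rw [← integral_const_mul]
  congr 1
  ext t
  rw [← torusIntegral_const_mul]
  congr 1
  ext x
  have : (c • φ).1 (t, x) = c * φ.1 (t, x) := rfl
  rw [this]
  ring

end Pairing

/-! ## The solution map on Fourier–Lebesgue spaces -/

section Norm

variable {p : ℝ≥0∞} {s : ℝ}

theorem flNorm_add_le (hp : 1 ≤ p) (L L' : TorusDistribution) :
    flNorm s p (L + L') ≤ flNorm s p L + flNorm s p L' := by
  rw [flNorm, weightedCoeff_add]
  exact eLpNorm_add_le .of_discrete .of_discrete hp

theorem flNorm_sub_comm (L L' : TorusDistribution) : flNorm s p (L - L') = flNorm s p (L' - L) := by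
  rw [flNorm_eq, flNorm_eq]
  simp only [fourierCoeff_sub, enorm_sub_rev]

theorem flNorm_sub_le (hp : 1 ≤ p) (L L' L'' : TorusDistribution) :
    flNorm s p (L - L'') ≤ flNorm s p (L - L') + flNorm s p (L' - L'') := by
  rw [← sub_add_sub_cancel L L' L'']
  exact flNorm_add_le hp _ _

theorem eq_of_flNorm_sub_eq_zero (h0 : p ≠ 0) (h : p ≠ ⊤) {L L' : TorusDistribution}
    (hL : flNorm s p (L - L') = 0) : L = L' := by
  refine torusDistribution_ext fun n => ?_
  rw [flNorm_eq] at hL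
  have h1 := le_lpn h0 h (fun n => brW s n * ‖fourierCoeff (L - L') n‖ₑ) n
  rw [hL, nonpos_iff_eq_zero, mul_eq_zero, or_iff_right (brW_ne_zero s n), enorm_eq_zero,
    fourierCoeff_sub, sub_eq_zero] at h1
  exact h1

theorem flNorm_toDistribution (f : SmoothTorus) :
    flNorm s p (toDistribution f) = lpn p fun n => brW s n * ‖fcoef f n‖ₑ := by
  rw [flNorm_eq]
  simp only [fourierCoeff_toDistribution]

end Norm

/-! ### Approximation by trigonometric polynomials -/

/-- The truncation of the Fourier series of a distribution to the square of side `2m`. -/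
def trunc (L : TorusDistribution) (m : ℕ) : SmoothTorus :=
  ∑ n ∈ Finset.Icc (-(m : ℤ), -(m : ℤ)) ((m : ℤ), (m : ℤ)), fourierCoeff L n • expMode n

theorem fcoef_trunc (L : TorusDistribution) (m : ℕ) (n : ℤ × ℤ) :
    fcoef (trunc L m) n = if n ∈ Finset.Icc (-(m : ℤ), -(m : ℤ)) ((m : ℤ), (m : ℤ))
      then fourierCoeff L n else 0 := by
  have h : ∀ k, (toDistribution (expMode (-n))).1 (expMode k) = if k = n then 1 else 0 := fun k =>
    fcoef_expMode k n
  rw [fcoef, trunc, map_sum]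
  simp only [map_smul, h, smul_eq_mul, mul_ite, mul_one, mul_zero]
  rw [Finset.sum_ite_eq' (Finset.Icc (-(m : ℤ), -(m : ℤ)) ((m : ℤ), (m : ℤ)))]

theorem flNorm_trunc_le {p : ℝ≥0∞} {s : ℝ} (L : TorusDistribution) (m : ℕ) :
    flNorm s p (toDistribution (trunc L m)) ≤ flNorm s p L := by
  rw [flNorm_toDistribution, flNorm_eq]
  refine lpn_mono fun n => ?_
  rw [fcoef_trunc]
  split_ifs <;> simp

theorem tendsto_trunc {p : ℝ≥0∞} {s : ℝ} (h0 : p ≠ 0) (h : p ≠ ⊤) {L : TorusDistribution}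
    (hL : flNorm s p L ≠ ⊤) :
    Tendsto (fun m => flNorm s p (toDistribution (trunc L m) - L)) atTop (𝓝 0) := by
  simp only [flNorm_eq, fourierCoeff_sub, fourierCoeff_toDistribution, fcoef_trunc]
  rw [flNorm_eq] at hL
  refine tendsto_lpn_zero h0 h hL (fun m n => ?_) fun n => ?_
  · split_ifs <;> simp
  · refine tendsto_const_nhds.congr' ?_
    filter_upwards [eventually_ge_atTop (sz n)] with m hm
    rw [if_pos]
    · simp
    · have h1 : n.1.natAbs ≤ m := (le_max_left _ _).trans hm
      have h2 : n.2.natAbs ≤ m := (le_max_right _ _).trans hm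
      rw [Finset.mem_Icc, Prod.le_def, Prod.le_def]
      refine ⟨⟨?_, ?_⟩, ?_, ?_⟩ <;> simp only <;> omega

/-! ### The flow -/

section Flow

variable {p : ℝ≥0∞} {s Q : ℝ} {M : ℕ} {r : ℝ≥0}

/-- `f` has the Fourier coefficients, at time `t`, of the solution with initial datum `L`. -/
def IsFlow (M : ℕ) (L : TorusDistribution) (t : ℝ) (f : TorusDistribution) : Prop :=
  ∀ n, fourierCoeff f n = evol M (picardSol M (fourierCoeff L)) t n

theorem smallData_iff {f : SmoothTorus} :
    SmallData p s r f ↔ dataConst p * flNorm s p (toDistribution f) < r / 2 := by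
  rw [SmallData, flNorm_toDistribution]

/-- Lipschitz dependence of the fixed point in the space-time norm, followed by the embedding into
continuous functions of time. The constant is uniform in t and over data of the admissible size. -/
theorem exists_isFlow_lipschitz (E : Exponents p s Q) (S : SmallCubic p s M r) : ∃ K : ℝ≥0∞, K ≠ ⊤ ∧
    ∀ L L' : TorusDistribution, dataConst p * flNorm s p L ≤ r / 2 →
      dataConst p * flNorm s p L' ≤ r / 2 → ∀ t f g, IsFlow M L t f → IsFlow M L' t g →
        flNorm s p (f - g) ≤ K * flNorm s p (L - L') := by
  obtain ⟨C, hC, h⟩ := exists_lpn_amp_le E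
  refine ⟨C * (2 * dataConst p), ENNReal.mul_ne_top hC (ENNReal.mul_ne_top (by simp)
    (dataConst_ne_top E)), fun L L' hL hL' t f g hf hg => ?_⟩
  rw [flNorm_eq] at hL hL'
  refine (flNorm_sub_le_of_evol E h (xn_picardSol_ne_top E S hL) (xn_picardSol_ne_top E S hL')
    hf hg).trans ?_
  rw [mul_assoc, flNorm_eq s p (L - L')]
  gcongr
  exact xn_picardSol_sub_le E S hL hL'

/-- By uniqueness an arbitrary classical solution coincides with the constructed one, so the
Lipschitz bounds for fixed points apply to it. -/
theorem isFlow_of_isClassicalSolution (E : Exponents p s Q) (S : SmallCubic p s M r) (hM : M ≠ 0)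
    {f : SmoothTorus} (hf : SmallData p s r f) {w : ℝ → SmoothTorus}
    (hw : IsClassicalSolution (1 / M) w) (h0 : w 0 = f) {t : ℝ} (ht : t ∈ Icc (0 : ℝ) (1 / M)) :
    IsFlow M (toDistribution f) t (toDistribution (w t)) := fun n => by
  have e : fourierCoeff (toDistribution f) = fcoef f := funext (fourierCoeff_toDistribution f)
  rw [hw.unique (isClassicalSolution_solution E S hf hM) (h0.trans (solution_zero E S hf hM).symm) ht,
    fourierCoeff_toDistribution, fcoef_solution E S hf hM (Icc_subset_timeInterval hM ht), e]
  rfl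

theorem eventually_smallData (E : Exponents p s Q) {L : TorusDistribution}
    (hL : dataConst p * flNorm s p L < r / 2) {a : ℕ → SmoothTorus}
    (ha : Tendsto (fun m => flNorm s p (toDistribution (a m) - L)) atTop (𝓝 0)) :
    ∀ᶠ m in atTop, SmallData p s r (a m) := by
  have h1 : Tendsto (fun m => dataConst p * (flNorm s p (toDistribution (a m) - L) + flNorm s p L))
      atTop (𝓝 (dataConst p * (0 + flNorm s p L))) :=
    ENNReal.Tendsto.const_mul (ha.add tendsto_const_nhds) (Or.inr (dataConst_ne_top E))
  rw [zero_add] at h1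
  filter_upwards [h1.eventually_lt_const hL] with m hm
  rw [smallData_iff]
  refine lt_of_le_of_lt ?_ hm
  gcongr
  have := flNorm_add_le (s := s) E.one_le (toDistribution (a m) - L) L
  rwa [sub_add_cancel] at this

/-- The solution map. -/
def flow [Fact (1 ≤ p)] (E : Exponents p s Q) (S : SmallCubic p s M r) (L : TorusDistribution)
    (hL : dataConst p * flNorm s p L ≤ r / 2) : C(Icc (0 : ℝ) (1 / M), FL s p) :=
  evolFL E M (1 / M) (picardSol M (fourierCoeff L))
    (xn_picardSol_ne_top E S (by rwa [flNorm_eq] at hL))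

theorem isFlow_flow [Fact (1 ≤ p)] (E : Exponents p s Q) (S : SmallCubic p s M r)
    (L : TorusDistribution) (hL : dataConst p * flNorm s p L ≤ r / 2) (t : Icc (0 : ℝ) (1 / M)) :
    IsFlow M L t (flow E S L hL t).1 :=
  fourierCoeff_evolFL E M _ _ (xn_picardSol_ne_top E S (by rwa [flNorm_eq] at hL)) t

/-- The distance in ℱL^{s,p} dominates every Fourier coefficient because s ≥ 0. The Lipschitz bound
for the flow therefore yields one for the pairings, involving five derivatives of the test function.
-/
theorem exists_pairing_lipschitz (E : Exponents p s Q) (S : SmallCubic p s M r) (hM : M ≠ 0) :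
    ∃ K : ℝ≥0∞, K ≠ ⊤ ∧ ∀ f g : SmoothTorus, SmallData p s r f → SmallData p s r g →
      ∀ w w' : ℝ → SmoothTorus, IsClassicalSolution (1 / M) w → w 0 = f →
        IsClassicalSolution (1 / M) w' → w' 0 = g → ∀ (φ : SpaceTimeTest (1 / M)) (B : ℝ),
          (∀ k ≤ 5, ∀ t ∈ Icc (0 : ℝ) (1 / M), ∀ x, ‖iteratedFDeriv ℝ k φ.1 (t, x)‖ ≤ B) →
          ‖nonlinearityPairing (1 / M) w φ - nonlinearityPairing (1 / M) w' φ‖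
            ≤ (K * flNorm s p (toDistribution f - toDistribution g)).toReal *
              (pairConst * (3 * B)) * (1 / M) := by
  obtain ⟨K, hK, h⟩ := exists_isFlow_lipschitz E S
  refine ⟨K, hK, fun f g hf hg w w' hw h0 hw' h0' φ B hB => ?_⟩
  refine norm_nonlinearityPairing_sub_le (by positivity) hw hw' φ hB fun t ht n => ?_
  have h1 := h _ _ (smallData_iff.1 hf).le (smallData_iff.1 hg).le t _ _
    (isFlow_of_isClassicalSolution E S hM hf hw h0 ht)
    (isFlow_of_isClassicalSolution E S hM hg hw' h0' ht)
  have ht' : K * flNorm s p (toDistribution f - toDistribution g) ≠ ⊤ := by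
    refine ENNReal.mul_ne_top hK (ne_top_of_le_ne_top (ENNReal.add_ne_top.2 ⟨?_, ?_⟩)
      (flNorm_sub_le E.one_le _ 0 _))
    · rw [sub_zero, flNorm_toDistribution]
      simpa using lpn_fcoef_ne_top E f 0
    · rw [flNorm_sub_comm, sub_zero, flNorm_toDistribution]
      simpa using lpn_fcoef_ne_top E g 0
  rw [flNorm_eq] at h1
  have h2 := norm_le_of_lpn E.ne_zero E.ne_top E.s_nonneg (ne_top_of_le_ne_top ht' h1) n
  rw [fourierCoeff_sub, fourierCoeff_toDistribution, fourierCoeff_toDistribution] at h2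
  exact h2.trans (ENNReal.toReal_mono ht' h1)

end Flow

/-! ## Sensible weak solutions -/

theorem pairConst_nonneg : 0 ≤ pairConst := by
  unfold pairConst
  have : 0 ≤ ∑' n : ℤ × ℤ, (((sz n + 1 : ℕ) : ℝ) ^ 3)⁻¹ := tsum_nonneg fun n => by positivity
  positivity

section Sensible

variable {p : ℝ≥0∞} {s Q : ℝ} {M : ℕ} {r : ℝ≥0}

/-- The pairings along the truncated data form a Cauchy sequence and define the distribution. Any
other approximating sequence is asymptotically close to the truncations, hence has the same limit.
-/
theorem exists_spaceTimeDistribution (E : Exponents p s Q) (S : SmallCubic p s M r) (hM : M ≠ 0)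
    {L : TorusDistribution} (hL : dataConst p * flNorm s p L < r / 2) (hLt : flNorm s p L ≠ ⊤) :
    ∃ v : SpaceTimeDistribution (1 / M), ∀ a : ℕ → SmoothTorus,
      Tendsto (fun m => flNorm s p (toDistribution (a m) - L)) atTop (𝓝 0) →
      ∀ w : ℕ → ℝ → SmoothTorus,
        (∀ᶠ m in atTop, IsClassicalSolution (1 / M) (w m) ∧ w m 0 = a m) →
        ∀ φ : SpaceTimeTest (1 / M),
          Tendsto (fun m => nonlinearityPairing (1 / M) (w m) φ) atTop (𝓝 (v.toLinearMap φ)) := by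
  obtain ⟨K, hK, hlip⟩ := exists_pairing_lipschitz E S hM
  have hT : (0 : ℝ) ≤ 1 / M := by positivity
  set b : ℕ → SmoothTorus := trunc L with hb
  have hbs : ∀ m, SmallData p s r (b m) := fun m => by
    rw [smallData_iff]
    refine lt_of_le_of_lt ?_ hL
    gcongr
    exact flNorm_trunc_le L m
  have hbt : Tendsto (fun m => flNorm s p (toDistribution (b m) - L)) atTop (𝓝 0) :=
    tendsto_trunc E.ne_zero E.ne_top hLt
  have hbc : ∀ m, IsClassicalSolution (1 / M) (solution M (b m)) := fun m =>
    isClassicalSolution_solution E S (hbs m) hM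
  have hb0 : ∀ m, solution M (b m) 0 = b m := fun m => solution_zero E S (hbs m) hM
  -- differences of pairings vanish in the limit
  have hdiff : ∀ a : ℕ → SmoothTorus,
      Tendsto (fun m => flNorm s p (toDistribution (a m) - L)) atTop (𝓝 0) →
      ∀ w : ℕ → ℝ → SmoothTorus,
        (∀ᶠ m in atTop, IsClassicalSolution (1 / M) (w m) ∧ w m 0 = a m) →
        ∀ φ : SpaceTimeTest (1 / M), Tendsto (fun z : ℕ × ℕ => dist
          (nonlinearityPairing (1 / M) (w z.1) φ)
          (nonlinearityPairing (1 / M) (solution M (b z.2)) φ)) (atTop ×ˢ atTop) (𝓝 0) := by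
    intro a ha w hw φ
    obtain ⟨B, hB⟩ := exists_norm_iteratedFDeriv_spaceTime_le (spaceTimeSmooth_test φ) (1 / M) 5
    have hx : Tendsto (fun z : ℕ × ℕ => flNorm s p (toDistribution (a z.1) - toDistribution (b z.2)))
        (atTop ×ˢ atTop) (𝓝 0) := by
      have h1 := (ha.comp tendsto_fst).add (hbt.comp (tendsto_snd (f := (atTop : Filter ℕ))))
      rw [add_zero] at h1
      refine tendsto_of_tendsto_of_tendsto_of_le_of_le tendsto_const_nhds h1 (fun _ => zero_le)
        fun z => ?_
      refine (flNorm_sub_le E.one_le _ L _).trans ?_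
      rw [flNorm_sub_comm L]
      rfl
    have hy := ENNReal.Tendsto.const_mul (a := K) hx (Or.inr hK)
    rw [mul_zero] at hy
    have hz := ((ENNReal.tendsto_toReal (by simp)).comp hy).mul_const
      (pairConst * (3 * B)) |>.mul_const ((1 : ℝ) / M)
    rw [ENNReal.toReal_zero, zero_mul, zero_mul] at hz
    refine squeeze_zero' (Eventually.of_forall fun _ => dist_nonneg) ?_ hz
    filter_upwards [tendsto_fst.eventually (hw.and (eventually_smallData E hL ha))] with z hz
    rw [dist_eq_norm]
    exact hlip _ _ hz.2 (hbs z.2) _ _ hz.1.1 hz.1.2 (hbc _) (hb0 _) φ B hB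
  have hlim : ∀ φ : SpaceTimeTest (1 / M), ∃ y, Tendsto
      (fun m => nonlinearityPairing (1 / M) (solution M (b m)) φ) atTop (𝓝 y) := fun φ => by
    refine cauchySeq_tendsto_of_complete (cauchySeq_iff_tendsto_dist_atTop_0.2 ?_)
    rw [← prod_atTop_atTop_eq]
    exact hdiff b hbt _ (Eventually.of_forall fun m => ⟨hbc m, hb0 m⟩) φ
  choose V hV using hlim
  refine ⟨⟨{ toFun := V
             map_add' := fun φ ψ => ?_
             map_smul' := fun c φ => ?_ }, fun t₁ t₂ _ _ => ?_⟩, fun a ha w hw φ => ?_⟩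
  · refine tendsto_nhds_unique (hV _) (((hV φ).add (hV ψ)).congr fun m => ?_)
    exact (nonlinearityPairing_add hT (hbc m) φ ψ).symm
  · refine tendsto_nhds_unique (hV _) (((hV φ).const_mul c).congr fun m => ?_)
    exact (nonlinearityPairing_smul c φ).symm
  -- Continuity of the limit: comparing with the zero solution turns the Lipschitz estimate into a
  -- bound of order 5, uniform in the truncation because truncating does not increase the norm.
  · refine ⟨(K * flNorm s p L).toReal * (pairConst * 3) * (1 / M), 5, fun φ _ B hB => ?_⟩
    refine le_of_tendsto (hV φ).norm (Eventually.of_forall fun m => ?_)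
    have hB0 : 0 ≤ B := (norm_nonneg _).trans (hB 0 (by norm_num) 0)
    have h0 : SmallData p s r 0 := by
      rw [smallData_iff]
      refine lt_of_le_of_lt ?_ hL
      have : flNorm s p (toDistribution 0) = 0 := by
        rw [flNorm_toDistribution]
        have : ∀ n, fcoef 0 n = 0 := fun n => map_zero _
        simp [this, lpn]
      rw [this, mul_zero]
      exact zero_le
    have h1 := hlip _ _ (hbs m) h0 _ _ (hbc m) (hb0 m) (isClassicalSolution_zero _) rfl φ B
      fun k hk t _ x => hB k hk (t, x)
    rw [nonlinearityPairing_zero, sub_zero] at h1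
    have h2 : flNorm s p (toDistribution (b m) - toDistribution 0) ≤ flNorm s p L := by
      have : toDistribution (b m) - toDistribution 0 = toDistribution (b m) := by
        refine torusDistribution_ext fun n => ?_
        have h : fcoef 0 n = 0 := map_zero _
        rw [fourierCoeff_sub, fourierCoeff_toDistribution 0, h, sub_zero]
      rw [this]
      exact flNorm_trunc_le L m
    have h3 : (K * flNorm s p (toDistribution (b m) - toDistribution 0)).toReal
        ≤ (K * flNorm s p L).toReal :=
      ENNReal.toReal_mono (ENNReal.mul_ne_top hK hLt) (by gcongr)
    have := pairConst_nonneg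
    calc _ ≤ _ := h1
      _ ≤ (K * flNorm s p L).toReal * (pairConst * (3 * B)) * (1 / M) := by gcongr
      _ = _ := by ring
  · have h1 := (hdiff a ha w hw φ).comp (tendsto_id.prodMk tendsto_id)
    exact (tendsto_iff_of_dist h1).2 (hV φ)

theorem tendsto_iSup_flNorm_sub_flow [Fact (1 ≤ p)] (E : Exponents p s Q) (S : SmallCubic p s M r)
    (hM : M ≠ 0) {L : TorusDistribution} (hL : dataConst p * flNorm s p L < r / 2)
    {a : ℕ → SmoothTorus}
    (ha : Tendsto (fun m => flNorm s p (toDistribution (a m) - L)) atTop (𝓝 0))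
    {w : ℕ → ℝ → SmoothTorus}
    (hw : ∀ᶠ m in atTop, IsClassicalSolution (1 / M) (w m) ∧ w m 0 = a m) :
    Tendsto (fun m => ⨆ t : Icc (0 : ℝ) (1 / M),
      flNorm s p (toDistribution (w m t) - flow E S L hL.le t)) atTop (𝓝 0) := by
  obtain ⟨K, hK, h⟩ := exists_isFlow_lipschitz E S
  have h1 := ENNReal.Tendsto.const_mul (a := K) ha (Or.inr hK)
  rw [mul_zero] at h1
  refine tendsto_of_tendsto_of_tendsto_of_le_of_le' tendsto_const_nhds h1
    (Eventually.of_forall fun _ => zero_le) ?_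
  filter_upwards [hw, eventually_smallData E hL ha] with m hm hs
  exact iSup_le fun t => h _ _ (smallData_iff.1 hs).le hL.le t _ _
    (isFlow_of_isClassicalSolution E S hM hs hm.1 hm.2 t.2) (isFlow_flow E S L hL.le t)

/-- A sensible weak solution is the limit of the classical solutions along every approximating
sequence; the truncations are one such sequence and their solutions converge to the flow, so no
other function qualifies. Conversely the flow qualifies, the approximating data being eventually
small. -/
theorem isSensibleWeakSolution_iff [Fact (1 ≤ p)] (E : Exponents p s Q) (S : SmallCubic p s M r)
    (hM : M ≠ 0) (u₀ : FL s p) (hL : dataConst p * flNorm s p u₀ < r / 2)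
    (u : C(Icc (0 : ℝ) (1 / M), FL s p)) :
    IsSensibleWeakSolution s p (1 / M) u₀ u ↔ u = flow E S u₀ hL.le := by
  have hLt : flNorm s p u₀ ≠ ⊤ := (show flNorm s p u₀ < ⊤ from u₀.2).ne
  constructor
  · rintro ⟨v, hv⟩
    have hbs : ∀ m, SmallData p s r (trunc u₀ m) := fun m => by
      rw [smallData_iff]
      refine lt_of_le_of_lt ?_ hL
      gcongr
      exact flNorm_trunc_le _ m
    have hbt := tendsto_trunc E.ne_zero E.ne_top hLt
    have hw : ∀ᶠ m in atTop, IsClassicalSolution (1 / M) (solution M (trunc u₀ m)) ∧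
        solution M (trunc u₀ m) 0 = trunc u₀ m := Eventually.of_forall fun m =>
      ⟨isClassicalSolution_solution E S (hbs m) hM, solution_zero E S (hbs m) hM⟩
    have h1 := ((hv _ hbt).2 _ hw).1
    have h2 := tendsto_iSup_flNorm_sub_flow E S hM hL hbt hw
    have h3 := h1.add h2
    rw [add_zero] at h3
    refine ContinuousMap.ext fun t => Subtype.ext (eq_of_flNorm_sub_eq_zero (s := s) E.ne_zero E.ne_top ?_)
    refine le_antisymm (ge_of_tendsto' h3 fun m => ?_) zero_le
    refine (flNorm_sub_le E.one_le _ (toDistribution (solution M (trunc u₀ m) t)) _).trans ?_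
    rw [flNorm_sub_comm]
    exact add_le_add
      (le_iSup (fun t : Icc (0 : ℝ) (1 / M) =>
        flNorm s p (toDistribution (solution M (trunc u₀ m) t) - u t)) t)
      (le_iSup (fun t : Icc (0 : ℝ) (1 / M) =>
        flNorm s p (toDistribution (solution M (trunc u₀ m) t) - flow E S u₀ hL.le t)) t)
  · rintro rfl
    obtain ⟨v, hv⟩ := exists_spaceTimeDistribution E S hM hL hLt
    refine ⟨v, fun a ha => ⟨?_, fun w hw => ⟨?_, hv a ha w hw⟩⟩⟩
    · filter_upwards [eventually_smallData E hL ha] with m hm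
      exact ⟨_, isClassicalSolution_solution E S hm hM, solution_zero E S hm hM⟩
    · exact tendsto_iSup_flNorm_sub_flow E S hM hL ha hw

theorem continuous_flow [Fact (1 ≤ p)] (E : Exponents p s Q) (S : SmallCubic p s M r)
    {X : Set (FL s p)} (hX : ∀ u₀ : X, dataConst p * flNorm s p u₀ ≤ r / 2) :
    Continuous fun u₀ : X => flow E S u₀ (hX u₀) := by
  obtain ⟨K, hK, h⟩ := exists_isFlow_lipschitz E S
  refine continuous_iff_continuousAt.2 fun u₀ => ?_
  rw [ContinuousAt, ContinuousMap.tendsto_iff_tendstoUniformly, EMetric.tendstoUniformly_iff]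
  intro ε hε
  have h1 : Tendsto (fun u : X => K * edist u u₀) (𝓝 u₀) (𝓝 0) := by
    have := ENNReal.Tendsto.const_mul (a := K) (tendsto_iff_edist_tendsto_0.1 (tendsto_id (x := 𝓝 u₀)))
      (Or.inr hK)
    rwa [mul_zero] at this
  filter_upwards [h1.eventually_lt_const hε] with u hu t
  rw [edist_comm]
  exact (h _ _ (hX u) (hX u₀) t _ _ (isFlow_flow E S u _ t) (isFlow_flow E S u₀ _ t)).trans_lt hu

end Sensible

/-- Since 1 - 1/p = 1/Q, the regularity hypothesis is equivalent to sQ > 1. -/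
theorem exponents_conjExponent {p : ℝ≥0∞} (hp : 1 < p) (hp' : p < ⊤) {s : ℝ}
    (hs : 1 - 1 / p.toReal < s) : Exponents p s (Real.conjExponent p.toReal) := by
  have h1 : 1 < p.toReal := by
    simpa using (ENNReal.toReal_lt_toReal (by simp) hp'.ne).2 hp
  have hc := Real.HolderConjugate.conjExponent h1
  refine ⟨hp, hp'.ne, hc, ?_⟩
  have h2 := hc.inv_add_inv_eq_one
  have h3 := hc.symm.pos
  have h4 : (Real.conjExponent p.toReal)⁻¹ < s := by
    rw [one_div] at hs
    linarith
  calc (1 : ℝ) = (Real.conjExponent p.toReal)⁻¹ * Real.conjExponent p.toReal :=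
        (inv_mul_cancel₀ h3.ne').symm
    _ < _ := by gcongr

end HNLS

end

/-- Local well-posedness in `ℱL^{s,p}(𝕋²)`: the existence time depends only on the size of the data;
every datum has exactly one sensible weak solution; the solution depends continuously on the
datum. -/
theorem corollary1p5 (p : ℝ≥0∞) [Fact (1 ≤ p)] (hp : 1 < p) (hp' : p < ⊤)
    (s : ℝ) (hs : 1 - 1 / p.toReal < s) :
    ∀ R : ℝ≥0, ∃ T : ℝ, 0 < T ∧
      ∃ Φ : {u₀ : HNLS.FL s p // HNLS.flNorm s p u₀ ≤ R} → C(Icc (0 : ℝ) T, HNLS.FL s p),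
        (∀ (u₀ : {u₀ : HNLS.FL s p // HNLS.flNorm s p u₀ ≤ R}) (u : C(Icc (0 : ℝ) T, HNLS.FL s p)),
          HNLS.IsSensibleWeakSolution s p T u₀ u ↔ u = Φ u₀) ∧
        Continuous Φ := by
  intro R
  have E := HNLS.exponents_conjExponent hp hp' hs
  have hD := HNLS.dataConst_ne_top E
  -- The linear part has norm at most dataConst·R on the ball of data. The added 1 makes the
  -- smallness condition strict, which leaves room both for nearby approximating data and for the
  -- regularity weights.
  set r : ℝ≥0 := 2 * ((HNLS.dataConst p).toNNReal * R + 1) with hr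
  have hsmall : ∀ u₀ : {u₀ : HNLS.FL s p // HNLS.flNorm s p u₀ ≤ R},
      HNLS.dataConst p * HNLS.flNorm s p u₀ < r / 2 := fun u₀ => by
    have e : (r : ℝ≥0∞) / 2 = HNLS.dataConst p * R + 1 := by
      rw [hr]
      push_cast
      rw [ENNReal.coe_toNNReal hD, mul_comm, ENNReal.mul_div_cancel_right (by simp) (by simp)]
    rw [e]
    refine (mul_le_mul_right u₀.2 _).trans_lt (ENNReal.lt_add_right ?_ one_ne_zero)
    exact ENNReal.mul_ne_top hD ENNReal.coe_ne_top
  obtain ⟨M, hM, S⟩ := HNLS.exists_smallCubic E r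
  refine ⟨1 / M, by positivity, fun u₀ => HNLS.flow E S u₀ (hsmall u₀).le, fun u₀ u => ?_, ?_⟩
  · exact HNLS.isSensibleWeakSolution_iff E S hM u₀ (hsmall u₀) u
  · exact HNLS.continuous_flow E S fun u₀ => (hsmall u₀).le
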